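/- **Conventions.** Let $d\ge 1$. Cubes in $\mathbb R^d$ have edges parallel to the axes; $\ell(Q)$ is the side length of $Q$, $|Q|$ its volume, and $sQ$ the concentric cube of side length $s\,\ell(Q)$. $\mathcal P_n$ is the space of polynomials on $\mathbb R^d$ of degree at most $n$. Functions are real valued. *Lipschitz domains.* A bounded domain $D\subset\mathbb R^d$ is $(\delta,R)$-Lipschitz if for every $a\in\partial D$ there are a function $A:\mathbb R^{d-1}\to\mathbb R$ with Lipschitz constant at most $\delta$ and a cube $Q$ of side length $R>0$ centred at $a$ such that, after a suitable shift and rotation (or reflection), $D\cap Q=\{(x,y)\in Q: y>A(x)\}$. *Moduli of continuity.* A continuous increasing $\omega:[0,\infty)\to[0,\infty)$ with $\omega(0)=0$ is a modulus of continuity of order $n\in\mathbb N$ if $n$ is the smallest positive integer such that: for some $q\in[n,n+1)$ and some $C>0$, $\omega(st)<Cs^q\omega(t)$ for all $s>1$, $t>0$; and for some $r\in(n-1,n)$ and some $C>0$, $\omega(st)<Cs^r\omega(t)$ for all $0<s<1$, $t>0$. *Spaces.* For $f\in L^1_{loc}(D)$ put $$\|f\|_{\omega,D}=\sup_{Q\subset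 D}\inf_{P\in\mathcal P_n}\frac{1}{\omega(\ell(Q))}\frac1{|Q|}\int_Q|f-P|\,dx,\qquad \|f\|^{int}_{\omega,D}=\sup_{Q:\,2Q\subset D}\inf_{P\in\mathcal P_n}\frac{1}{\omega(\ell(Q))}\frac1{|Q|}\int_Q|f-P|\,dx,$$ and let $\mathcal C_\omega(D)$, $\mathcal C^{int}_\omega(D)$ be the sets of $f\in L^1_{loc}(D)$ for which the respective quantity is finite. For $f\in\mathcal C^{int}_\omega(D)$ and a cube $Q$ with $2Q\subset D$, $P_Q\in\mathcal P_n$ is a polynomial of near best approximation, with constant $C_0$, if $\frac1{|Q|}\int_Q|f-P_Q|\,dx\le C_0\,\omega(\ell(Q))\,\|f\|^{int}_{\omega,D}$. *Whitney coverings.* A Whitney covering of an open set $G$ is a family $\mathcal W$ of pairwise disjoint semi-open dyadic cubes with union $G$ such that $\operatorname{diam}Q\le\operatorname{dist}(Q,\partial G)\le4\operatorname{diam}Q$ for $Q\in\mathcal W$, $\ell(Q)\le4\ell(S)$ whenever $Q,S\in\mathcal W$ and $\overline Q\cap\overline S\ne\varnothing$, and $\sup_G\sum_{Q\in\mathcal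 W}\chi_{\frac65Q}<\infty$. *The extension.* Let $D$ be a bounded $(\delta,R)$-Lipschitz domain and $D'=\mathbb R^d\setminus\overline D$. Fix Whitney coverings $\mathcal W$ of $D$ and $\mathcal W'$ of $D'$ and a smooth partition of unity $\{\psi_Q\}_{Q\in\mathcal W'}$: each $\psi_Q$ is $C^\infty$ on $\mathbb R^d$, $\chi_{\frac45Q}\le\psi_Q\le\chi_{\frac54Q}$, $\sum_{Q\in\mathcal W'}\psi_Q=\chi_{D'}$, and for each $k\ge 0$ there is $C_k$ with $\|D^k\psi_Q(x)\|\le C_k\,\ell(Q)^{-k}$ for all $Q\in\mathcal W'$ and all $x$. For each $Q\in\mathcal W'$ with $\ell(Q)\le R$ fix a reflective cube $\widetilde Q\in\mathcal W$, that is, a cube of maximal size among the $S\in\mathcal W$ with $\operatorname{dist}(Q,S)\le2\operatorname{dist}(Q,\partial D)$. Fix a constant $C_0$. For $f\in\mathcal C^{int}_\omega(D)$ and polynomials $P_{\widetilde Q}$ of near best approximation for $f$ on $\widetilde Q$ with constant $C_0$, put $$\widetilde f=f\chi_D+\sum_{Q\in\mathcal W',\ \ell(Q)\le R}\psi_Q\,P_{\widetilde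 Q}.$$ **Proposition 3.** Let $\omega$ be a modulus of continuity of order $n\in\mathbb N$. There is a constant $C$, independent of $f$ and of the choice of the near best polynomials, such that for every $f\in\mathcal C^{int}_\omega(D)$ every such extension $\widetilde f$ has the following properties: (i) the support of $\widetilde f$ is compact; (ii) $\widetilde f$ is $C^\infty$-smooth in $D'=\mathbb R^d\setminus\overline D$; (iii) $\widetilde f\in L^1(\mathbb R^d,dx)\cap\mathcal C_\omega(\mathbb R^d)$ and $$\|\widetilde f\|_{\omega,\mathbb R^d}+\|\widetilde f\|_{L^1(\mathbb R^d,dx)}\le C\left(\|f\|^{int}_{\omega,D}+\|f\|_{L^1(D,dx)}\right).$$ -/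

import Mathlib

open MeasureTheory Set
open scoped ENNReal NNReal

noncomputable section

/-- The Euclidean space `ℝ^d`. -/
abbrev Euc (d : ℕ) : Type := EuclideanSpace ℝ (Fin d)

/-- A bounded domain `D ⊆ ℝ^d` is `(δ, R)`-Lipschitz if around each boundary point `a` there is a
(rotated) cube with centre `a` and side length `R` in which, in the rotated coordinates
`ρ (z - a) = (x, y) ∈ ℝ^(d-1) × ℝ`, the domain is the part lying above the graph of a
`δ`-Lipschitz function `A`. -/
def IsLipschitzDomain {d : ℕ} (δ : ℝ≥0) (R : ℝ) (D : Set (Euc d)) : Prop :=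
  IsOpen D ∧ IsConnected D ∧ Bornology.IsBounded D ∧ 0 < R ∧
  ∀ a ∈ frontier D, ∃ (ρ : Euc d ≃ₗᵢ[ℝ] WithLp 2 (Euc (d - 1) × ℝ)) (A : Euc (d - 1) → ℝ),
    LipschitzWith δ A ∧
    ∀ z : Euc d, (∀ i, |(ρ (z - a)).fst i| < R / 2) → |(ρ (z - a)).snd| < R / 2 →
      (z ∈ D ↔ A (ρ (z - a)).fst < (ρ (z - a)).snd)

/-- `ω(t) / t^q` is almost decreasing for some `q ∈ [n, n + 1)`, and `ω(t) / t^r` is almost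
increasing for some `r ∈ (n - 1, n)`. -/
def HasOrderRegularity (ω : ℝ → ℝ) (n : ℕ) : Prop :=
  (∃ q : ℝ, (n : ℝ) ≤ q ∧ q < n + 1 ∧ ∃ C : ℝ, 0 < C ∧
    ∀ s t : ℝ, 1 < s → 0 < t → ω (s * t) < C * s ^ q * ω t) ∧
  (∃ r : ℝ, (n : ℝ) - 1 < r ∧ r < n ∧ ∃ C : ℝ, 0 < C ∧
    ∀ s t : ℝ, 0 < s → s < 1 → 0 < t → ω (s * t) < C * s ^ r * ω t)

/-- Moduli of continuity of order `n`; only the values of `ω` on `[0, ∞)` matter. -/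
structure IsModulusOfOrder (ω : ℝ → ℝ) (n : ℕ) : Prop where
  continuousOn : ContinuousOn ω (Ici 0)
  monotoneOn : MonotoneOn ω (Ici 0)
  map_zero : ω 0 = 0
  isLeast : IsLeast {m : ℕ | 1 ≤ m ∧ HasOrderRegularity ω m} n

/-- A nondegenerate cube in `ℝ^d` with edges parallel to the axes. -/
structure AxisCube (d : ℕ) where
  center : Euc d
  side : ℝ
  side_pos : 0 < side

namespace AxisCube

variable {d : ℕ}

/-- The (semi-open) cube as a set of points. -/
def carrier (Q : AxisCube d) : Set (Euc d) :=
  {x | ∀ i, Q.center i - Q.side / 2 ≤ x i ∧ x i < Q.center i + Q.side / 2}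

/-- `s Q`: the same centre, side length `s ℓ(Q)`. -/
def scale (s : ℝ) (hs : 0 < s) (Q : AxisCube d) : AxisCube d where
  center := Q.center
  side := s * Q.side
  side_pos := mul_pos hs Q.side_pos

/-- The semi-open dyadic cubes `∏ᵢ [mᵢ 2^k, (mᵢ + 1) 2^k)`. -/
def IsDyadic (Q : AxisCube d) : Prop :=
  ∃ (k : ℤ) (m : Fin d → ℤ), Q.side = (2 : ℝ) ^ k ∧
    ∀ i, Q.center i = ((m i : ℝ) + 1 / 2) * (2 : ℝ) ^ k

end AxisCube

/-- The distance `inf {|x - y| : x ∈ A, y ∈ B}` between two sets. -/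
def setEDist {X : Type*} [PseudoEMetricSpace X] (A B : Set X) : ℝ≥0∞ :=
  ⨅ x ∈ A, ⨅ y ∈ B, edist x y

/-- The value of a polynomial at a point of `ℝ^d`. -/
def polyVal {d : ℕ} (P : MvPolynomial (Fin d) ℝ) (x : Euc d) : ℝ :=
  MvPolynomial.eval (fun i => x i) P

/-- `‖f - P‖_{L¹(Q, dx/|Q|)}`. -/
def meanDev {d : ℕ} (f : Euc d → ℝ) (P : MvPolynomial (Fin d) ℝ) (Q : AxisCube d) : ℝ≥0∞ :=
  (volume Q.carrier)⁻¹ * ∫⁻ x in Q.carrier, ‖f x - polyVal P x‖ₑ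

/-- `inf_P ω(ℓ)⁻¹ ‖f - P‖_{L¹(Q, dx/|Q|)}` over the polynomials `P` of degree at most `n`. -/
def cubeOsc {d : ℕ} (ω : ℝ → ℝ) (n : ℕ) (f : Euc d → ℝ) (Q : AxisCube d) : ℝ≥0∞ :=
  ⨅ (P : MvPolynomial (Fin d) ℝ) (_ : P.totalDegree ≤ n),
    (ENNReal.ofReal (ω Q.side))⁻¹ * meanDev f P Q

/-- The Campanato type seminorm `‖f‖_{ω,D}`: supremum over all cubes `Q ⊆ D`. -/
def zygSeminorm {d : ℕ} (ω : ℝ → ℝ) (n : ℕ) (D : Set (Euc d)) (f : Euc d → ℝ) : ℝ≥0∞ :=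
  ⨆ (Q : AxisCube d) (_ : Q.carrier ⊆ D), cubeOsc ω n f Q

/-- The interior seminorm `‖f‖^int_{ω,D}`: supremum over all cubes `Q` with `2Q ⊆ D`. -/
def zygIntSeminorm {d : ℕ} (ω : ℝ → ℝ) (n : ℕ) (D : Set (Euc d)) (f : Euc d → ℝ) : ℝ≥0∞ :=
  ⨆ (Q : AxisCube d) (_ : (Q.scale 2 two_pos).carrier ⊆ D), cubeOsc ω n f Q

/-- `f ∈ C_ω(D)`. -/
def MemZyg {d : ℕ} (ω : ℝ → ℝ) (n : ℕ) (D : Set (Euc d)) (f : Euc d → ℝ) : Prop :=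
  LocallyIntegrableOn f D ∧ zygSeminorm ω n D f < ∞

/-- `f ∈ C^int_ω(D)`. -/
def MemZygInt {d : ℕ} (ω : ℝ → ℝ) (n : ℕ) (D : Set (Euc d)) (f : Euc d → ℝ) : Prop :=
  LocallyIntegrableOn f D ∧ zygIntSeminorm ω n D f < ∞

/-- `P` is a polynomial of near best approximation, with constant `C₀`, for `f ∈ C^int_ω(D)` on
the cube `Q`. -/
def IsNearBest {d : ℕ} (ω : ℝ → ℝ) (n : ℕ) (D : Set (Euc d)) (C₀ : ℝ≥0) (f : Euc d → ℝ)
    (Q : AxisCube d) (P : MvPolynomial (Fin d) ℝ) : Prop :=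
  P.totalDegree ≤ n ∧
    meanDev f P Q ≤ C₀ * ENNReal.ofReal (ω Q.side) * zygIntSeminorm ω n D f

/-- Whitney coverings of `G` (used for a Lipschitz domain `D` and for `ℝ^d \ closure D`). -/
structure IsWhitneyCovering {d : ℕ} (G : Set (Euc d)) (W : Set (AxisCube d)) : Prop where
  dyadic : ∀ Q ∈ W, Q.IsDyadic
  disjoint : W.PairwiseDisjoint AxisCube.carrier
  covers : ⋃ Q ∈ W, Q.carrier = G
  diam_le : ∀ Q ∈ W, Metric.ediam Q.carrier ≤ setEDist Q.carrier (frontier G)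
  le_diam : ∀ Q ∈ W, setEDist Q.carrier (frontier G) ≤ 4 * Metric.ediam Q.carrier
  neighbor : ∀ Q ∈ W, ∀ S ∈ W, (closure Q.carrier ∩ closure S.carrier).Nonempty →
    Q.side ≤ 4 * S.side
  overlap : ∃ N : ℕ, ∀ x ∈ G,
    {Q ∈ W | x ∈ (Q.scale (6 / 5) (by norm_num)).carrier}.encard ≤ N

/-- Smooth partitions of unity associated with a Whitney covering `W` of `G`. -/
structure IsWhitneyPartition {d : ℕ} (G : Set (Euc d)) (W : Set (AxisCube d))
    (ψ : AxisCube d → Euc d → ℝ) : Prop where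
  smooth : ∀ Q ∈ W, ContDiff ℝ ((⊤ : ℕ∞) : WithTop ℕ∞) (ψ Q)
  lower : ∀ Q ∈ W, ∀ x,
    (Q.scale (4 / 5) (by norm_num)).carrier.indicator (fun _ => (1 : ℝ)) x ≤ ψ Q x
  upper : ∀ Q ∈ W, ∀ x,
    ψ Q x ≤ (Q.scale (5 / 4) (by norm_num)).carrier.indicator (fun _ => (1 : ℝ)) x
  sum_eq : ∀ x, ∑ᶠ Q ∈ W, ψ Q x = G.indicator (fun _ => (1 : ℝ)) x
  deriv_le : ∀ k : ℕ, ∃ C : ℝ, ∀ Q ∈ W, ∀ x, ‖iteratedFDeriv ℝ k (ψ Q) x‖ ≤ C / Q.side ^ k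

/-- `S ∈ W` is admissible for reflecting `Q`: `dist(Q, S) ≤ 2 dist(Q, ∂D)`. -/
def IsReflCandidate {d : ℕ} (D : Set (Euc d)) (W : Set (AxisCube d)) (Q S : AxisCube d) : Prop :=
  S ∈ W ∧ setEDist Q.carrier S.carrier ≤ 2 * setEDist Q.carrier (frontier D)

/-- `S` is reflective to `Q`: an admissible cube of maximal size. -/
def IsReflective {d : ℕ} (D : Set (Euc d)) (W : Set (AxisCube d)) (Q S : AxisCube d) : Prop :=
  IsReflCandidate D W Q S ∧ ∀ T, IsReflCandidate D W Q T → T.side ≤ S.side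

/-- The extension `f χ_D + ∑ ψ_Q P_{Q~}` over the cubes `Q ∈ W'` with `ℓ(Q) ≤ R`, where
`refl Q` is the cube `Q~` and `P S` the polynomial attached to the cube `S`. -/
def whitneyExt {d : ℕ} (D : Set (Euc d)) (R : ℝ) (W' : Set (AxisCube d))
    (ψ : AxisCube d → Euc d → ℝ) (refl : AxisCube d → AxisCube d)
    (P : AxisCube d → MvPolynomial (Fin d) ℝ) (f : Euc d → ℝ) (x : Euc d) : ℝ :=
  D.indicator f x + ∑ᶠ Q ∈ {Q ∈ W' | Q.side ≤ R}, ψ Q x * polyVal (P (refl Q)) x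

end

/-!
Near a boundary point the domain contains a cone over each of its nearby points, all with a common
axis. A cube of `D` is joined to a large cube on the axis by a chain of cubes of geometrically
growing sides along the cone, consecutive cubes overlapping in a fixed proportion; by the decay of
`ω` the differences of near best polynomials along the chain sum up to `O(ω(h))`. So at every scale
`h` and boundary point `a` one polynomial approximates `f` on `D` and all the reflected polynomials
near `a`, hence also the extension on both sides of the boundary, which is a null set. This settles
the cubes close to `∂D` relative to their size. On the exterior cubes that are smaller than their
distance to `∂D` the extension is compared with its Taylor polynomial, the derivatives of the
partition functions falling on differences of reflected polynomials, and `ω(st) ≤ C s^(n+1) ω(t)`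
for `s ≥ 1` turns the bound at the scale of the distance into one at the scale of the cube. Large
cubes are controlled by the `L¹` norm.
-/

section EuclideanCoordinates

variable {d : ℕ}

lemma Euc.abs_apply_le_norm (v : Euc d) (i : Fin d) : |v i| ≤ ‖v‖ := by
  simpa using PiLp.norm_apply_le v i

lemma Euc.norm_le_of_abs_le {v : Euc d} {r : ℝ} (hr : 0 ≤ r) (h : ∀ i, |v i| ≤ r) :
    ‖v‖ ≤ d * r := by
  have hd : (d : ℝ) ≤ (d : ℝ) ^ 2 := by exact_mod_cast Nat.le_self_pow two_ne_zero d
  rw [EuclideanSpace.norm_eq]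
  refine Real.sqrt_le_iff.2 ⟨by positivity, ?_⟩
  calc ∑ i, ‖v i‖ ^ 2 ≤ ∑ _i : Fin d, r ^ 2 :=
        Finset.sum_le_sum fun i _ => pow_le_pow_left₀ (norm_nonneg _) (h i) 2
    _ = d * r ^ 2 := by simp
    _ ≤ (d : ℝ) ^ 2 * r ^ 2 := by gcongr
    _ = (d * r) ^ 2 := (mul_pow _ _ _).symm

end EuclideanCoordinates

section SetDistance

lemma setEDist_le_edist {X : Type*} [PseudoEMetricSpace X] {A B : Set X} {x y : X} (hx : x ∈ A)
    (hy : y ∈ B) : setEDist A B ≤ edist x y :=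
  (iInf₂_le x hx).trans (iInf₂_le y hy)

lemma exists_dist_le_of_setEDist_lt {X : Type*} [PseudoMetricSpace X] {A B : Set X} {r : ℝ}
    (h : setEDist A B < ENNReal.ofReal r) : ∃ x ∈ A, ∃ y ∈ B, dist x y ≤ r := by
  simp only [setEDist, iInf_lt_iff] at h
  obtain ⟨x, hx, y, hy, h⟩ := h
  exact ⟨x, hx, y, hy, (edist_lt_ofReal.1 h).le⟩

end SetDistance

namespace AxisCube

variable {d : ℕ} {Q : AxisCube d} {x : Euc d}

lemma center_mem (Q : AxisCube d) : Q.center ∈ Q.carrier := fun i => by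
  have := Q.side_pos
  constructor <;> linarith

lemma abs_sub_center_le (hx : x ∈ Q.carrier) (i : Fin d) : |(x - Q.center) i| ≤ Q.side / 2 := by
  have := hx i
  rw [abs_le, PiLp.sub_apply]
  constructor <;> linarith

lemma norm_sub_center_le (hx : x ∈ Q.carrier) : ‖x - Q.center‖ ≤ d * (Q.side / 2) :=
  Euc.norm_le_of_abs_le (half_pos Q.side_pos).le (abs_sub_center_le hx)

lemma mem_carrier_of_norm_lt (hx : ‖x - Q.center‖ < Q.side / 2) : x ∈ Q.carrier := fun i => by
  have := abs_lt.1 ((Euc.abs_apply_le_norm (x - Q.center) i).trans_lt hx)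
  rw [PiLp.sub_apply] at this
  constructor <;> linarith

lemma carrier_eq_preimage (Q : AxisCube d) :
    Q.carrier = (WithLp.ofLp : Euc d → Fin d → ℝ) ⁻¹' (Set.pi univ
      fun i => Ico (Q.center i - Q.side / 2) (Q.center i + Q.side / 2)) := by
  ext x
  simp [carrier, Set.mem_pi]

lemma measurableSet_carrier (Q : AxisCube d) : MeasurableSet Q.carrier := by
  rw [carrier_eq_preimage]
  exact (PiLp.volume_preserving_ofLp (Fin d)).measurable
    (MeasurableSet.pi countable_univ fun i _ => measurableSet_Ico)

lemma volume_carrier (Q : AxisCube d) : volume Q.carrier = ENNReal.ofReal (Q.side ^ d) := by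
  have hside : ∀ i : Fin d, Q.center i + Q.side / 2 - (Q.center i - Q.side / 2) = Q.side :=
    fun i => by ring
  rw [carrier_eq_preimage, (PiLp.volume_preserving_ofLp (Fin d)).measure_preimage
    (MeasurableSet.pi countable_univ fun i _ => measurableSet_Ico).nullMeasurableSet,
    Real.volume_pi_Ico]
  simp only [hside]
  rw [Finset.prod_const, Finset.card_univ, Fintype.card_fin, ENNReal.ofReal_pow Q.side_pos.le]

lemma volume_carrier_ne_zero (Q : AxisCube d) : volume Q.carrier ≠ 0 := by
  rw [volume_carrier]
  simpa using pow_pos Q.side_pos d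

lemma volume_carrier_ne_top (Q : AxisCube d) : volume Q.carrier ≠ ∞ := by
  rw [volume_carrier]
  exact ENNReal.ofReal_ne_top

lemma isBounded_carrier (Q : AxisCube d) : Bornology.IsBounded Q.carrier :=
  Metric.isBounded_closedBall.subset fun _ hx => mem_closedBall_iff_norm.2 (norm_sub_center_le hx)

lemma carrier_subset_of_abs_le {E Q : AxisCube d}
    (h : ∀ i, |E.center i - Q.center i| + E.side / 2 ≤ Q.side / 2) : E.carrier ⊆ Q.carrier := by
  intro x hx i
  have hxi := hx i
  have hEQ := abs_le.1 (le_sub_iff_add_le.2 (h i))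
  constructor <;> linarith

lemma carrier_subset_of_norm_le {E Q : AxisCube d}
    (h : ‖E.center - Q.center‖ + E.side / 2 ≤ Q.side / 2) : E.carrier ⊆ Q.carrier :=
  carrier_subset_of_abs_le fun i =>
    (add_le_add_left (Euc.abs_apply_le_norm (E.center - Q.center) i) _).trans h

lemma carrier_subset_scale {s : ℝ} (hs : 0 < s) (hs1 : 1 ≤ s) (Q : AxisCube d) :
    Q.carrier ⊆ (Q.scale s hs).carrier :=
  carrier_subset_of_abs_le fun i => by
    simp only [scale, sub_self, abs_zero]
    nlinarith [Q.side_pos]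

lemma center_add_inv_smul_mem {s : ℝ} (hs : 0 < s) (hx : x ∈ (Q.scale s hs).carrier) :
    Q.center + s⁻¹ • (x - Q.center) ∈ Q.carrier := by
  intro i
  have hxi := hx i
  simp only [scale] at hxi
  rw [PiLp.add_apply, PiLp.smul_apply, PiLp.sub_apply, smul_eq_mul, inv_mul_eq_div]
  have hlower : -(Q.side / 2) ≤ (x i - Q.center i) / s := by
    rw [le_div_iff₀ hs]
    linarith
  have hupper : (x i - Q.center i) / s < Q.side / 2 := by
    rw [div_lt_iff₀ hs]
    linarith
  constructor <;> linarith

lemma ediam_carrier (Q : AxisCube d) :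
    Metric.ediam Q.carrier = ENNReal.ofReal (Metric.diam Q.carrier) := by
  rw [Metric.diam, ENNReal.ofReal_toReal (Metric.isBounded_iff_ediam_ne_top.1 Q.isBounded_carrier)]

lemma diam_carrier_le (Q : AxisCube d) : Metric.diam Q.carrier ≤ d * Q.side := by
  have hs := Q.side_pos
  refine Metric.diam_le_of_forall_dist_le (by positivity) fun x hx y hy => ?_
  rw [dist_eq_norm]
  refine Euc.norm_le_of_abs_le hs.le fun i => ?_
  have hxi := hx i
  have hyi := hy i
  rw [PiLp.sub_apply, abs_le]
  constructor <;> linarith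

lemma half_side_le_diam (hd : 0 < d) (Q : AxisCube d) : Q.side / 2 ≤ Metric.diam Q.carrier := by
  have hs := Q.side_pos
  have hmem : Q.center - EuclideanSpace.single (⟨0, hd⟩ : Fin d) (Q.side / 2) ∈ Q.carrier := by
    intro i
    by_cases hi : i = ⟨0, hd⟩
    · subst hi
      simp only [PiLp.sub_apply, PiLp.single_apply, if_true]
      constructor <;> linarith
    · simp only [PiLp.sub_apply, PiLp.single_apply, if_neg hi]
      constructor <;> linarith
  simpa [dist_eq_norm, abs_of_pos hs] using
    Metric.dist_le_diam_of_mem Q.isBounded_carrier Q.center_mem hmem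

lemma norm_sub_center_le_diam (hx : x ∈ Q.carrier) :
    3 / 2 * ‖x - Q.center‖ ≤ Metric.diam Q.carrier := by
  have hs := Q.side_pos
  -- A factor below `1` keeps the point reflected in the centre inside the half-open cube.
  have hmem : ∀ t : ℝ, |t| = 3 / 4 → Q.center + t • (x - Q.center) ∈ Q.carrier := by
    intro t ht i
    have hti : |t * (x - Q.center) i| ≤ 3 / 4 * (Q.side / 2) := by
      rw [abs_mul, ht]
      exact mul_le_mul_of_nonneg_left (abs_sub_center_le hx i) (by norm_num)
    rw [abs_le] at hti
    rw [PiLp.add_apply, PiLp.smul_apply, smul_eq_mul]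
    constructor <;> linarith
  have hdist := Metric.dist_le_diam_of_mem Q.isBounded_carrier
    (hmem (3 / 4) (abs_of_pos (by norm_num))) (hmem (-(3 / 4)) (by norm_num [abs_of_pos]))
  rwa [dist_eq_norm, add_sub_add_left_eq_sub, ← sub_smul, norm_smul, Real.norm_of_nonneg
    (by norm_num), show (3 / 4 - -(3 / 4) : ℝ) = 3 / 2 by norm_num] at hdist

end AxisCube

section PolynomialFunctions

variable {d n : ℕ}

lemma polyVal_zero (x : Euc d) : polyVal 0 x = 0 := by simp [polyVal]

lemma polyVal_add (P Q : MvPolynomial (Fin d) ℝ) (x : Euc d) :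
    polyVal (P + Q) x = polyVal P x + polyVal Q x := by simp [polyVal]

lemma polyVal_sub (P Q : MvPolynomial (Fin d) ℝ) (x : Euc d) :
    polyVal (P - Q) x = polyVal P x - polyVal Q x := by simp [polyVal]

lemma polyVal_smul (c : ℝ) (P : MvPolynomial (Fin d) ℝ) (x : Euc d) :
    polyVal (c • P) x = c * polyVal P x := by simp [polyVal]

lemma polyVal_sum {ι : Type*} (s : Finset ι) (P : ι → MvPolynomial (Fin d) ℝ) (x : Euc d) :
    polyVal (∑ i ∈ s, P i) x = ∑ i ∈ s, polyVal (P i) x := by simp [polyVal]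

lemma contDiff_polyVal (P : MvPolynomial (Fin d) ℝ) {m : WithTop ℕ∞} :
    ContDiff ℝ m (polyVal P) := by
  unfold polyVal
  simp only [MvPolynomial.eval_eq]
  fun_prop

lemma continuous_polyVal (P : MvPolynomial (Fin d) ℝ) : Continuous (polyVal P) :=
  (contDiff_polyVal P (m := 0)).continuous

lemma totalDegree_sub_le_of_le {P Q : MvPolynomial (Fin d) ℝ} (hP : P.totalDegree ≤ n)
    (hQ : Q.totalDegree ≤ n) : (P - Q).totalDegree ≤ n :=
  (MvPolynomial.totalDegree_sub P Q).trans (max_le hP hQ)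

lemma eq_zero_of_polyVal_eventuallyEq_zero {P : MvPolynomial (Fin d) ℝ} {x : Euc d}
    (h : polyVal P =ᶠ[nhds x] 0) : P = 0 := by
  have hzero : polyVal P = 0 :=
    (contDiff_polyVal P).analyticOnNhd.eq_of_eventuallyEq analyticOnNhd_const h
  refine MvPolynomial.funext fun y => ?_
  simpa [polyVal] using congrFun hzero (WithLp.toLp 2 y)

lemma eq_zero_of_polyVal_ae_eq_zero {P : MvPolynomial (Fin d) ℝ} {Q : AxisCube d}
    (h : polyVal P =ᵐ[volume.restrict Q.carrier] 0) : P = 0 := by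
  have hball : Metric.ball Q.center (Q.side / 2) ⊆ Q.carrier := fun x hx =>
    AxisCube.mem_carrier_of_norm_lt (mem_ball_iff_norm.1 hx)
  have heq : EqOn (polyVal P) 0 (Metric.ball Q.center (Q.side / 2)) :=
    Measure.eqOn_open_of_ae_eq (ae_restrict_of_ae_restrict_of_subset hball h) Metric.isOpen_ball
      (continuous_polyVal P).continuousOn continuousOn_const
  exact eq_zero_of_polyVal_eventuallyEq_zero
    (heq.eventuallyEq_of_mem (Metric.ball_mem_nhds _ (half_pos Q.side_pos)))

lemma exists_abs_polyVal_le (P : MvPolynomial (Fin d) ℝ) (hP : P.totalDegree ≤ n) :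
    ∃ C : ℝ, 0 ≤ C ∧ ∀ y : Euc d, |polyVal P y| ≤ C * (1 + ‖y‖) ^ n := by
  refine ⟨∑ m ∈ P.support, |P.coeff m|, Finset.sum_nonneg fun _ _ => abs_nonneg _, fun y => ?_⟩
  unfold polyVal
  rw [MvPolynomial.eval_eq, Finset.sum_mul]
  refine (Finset.abs_sum_le_sum_abs _ _).trans (Finset.sum_le_sum fun m hm => ?_)
  rw [abs_mul, Finset.abs_prod]
  refine mul_le_mul_of_nonneg_left ?_ (abs_nonneg _)
  calc ∏ i ∈ m.support, |y i ^ m i| ≤ ∏ i ∈ m.support, (1 + ‖y‖) ^ m i := by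
        refine Finset.prod_le_prod (fun _ _ => abs_nonneg _) fun i _ => ?_
        rw [abs_pow]
        exact pow_le_pow_left₀ (abs_nonneg _)
          ((Euc.abs_apply_le_norm y i).trans (by linarith)) _
    _ = (1 + ‖y‖) ^ (m.sum fun _ e => e) := Finset.prod_pow_eq_pow_sum _ _ _
    _ ≤ (1 + ‖y‖) ^ n := pow_le_pow_right₀ (by linarith [norm_nonneg y])
        ((MvPolynomial.le_totalDegree hm).trans hP)

lemma totalDegree_bind₁_le {σ τ K : Type*} [CommSemiring K] {f : σ → MvPolynomial τ K}
    (hf : ∀ i, (f i).totalDegree ≤ 1) (P : MvPolynomial σ K) :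
    (MvPolynomial.bind₁ f P).totalDegree ≤ P.totalDegree := by
  conv_lhs => rw [MvPolynomial.as_sum P, map_sum]
  refine MvPolynomial.totalDegree_finsetSum_le fun m hm => ?_
  rw [MvPolynomial.bind₁_monomial]
  calc (MvPolynomial.C (P.coeff m) * ∏ i ∈ m.support, f i ^ m i).totalDegree
      ≤ 0 + ∑ i ∈ m.support, m i * 1 := by
        refine (MvPolynomial.totalDegree_mul _ _).trans (add_le_add
          (MvPolynomial.totalDegree_C _).le ((MvPolynomial.totalDegree_finsetProd _ _).trans ?_))
        exact Finset.sum_le_sum fun i _ =>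
          (MvPolynomial.totalDegree_pow _ _).trans (Nat.mul_le_mul_left _ (hf i))
    _ = m.sum fun _ e => e := by simp [Finsupp.sum]
    _ ≤ P.totalDegree := MvPolynomial.le_totalDegree hm

lemma exists_polyVal_eq_comp_affine (P : MvPolynomial (Fin d) ℝ) (z : Euc d) (h : ℝ) :
    ∃ P' : MvPolynomial (Fin d) ℝ, P'.totalDegree ≤ P.totalDegree ∧
      ∀ y, polyVal P' y = polyVal P (z + h • y) := by
  refine ⟨MvPolynomial.bind₁ (fun i => MvPolynomial.C (z i) + h • MvPolynomial.X i) P,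
    totalDegree_bind₁_le (fun i => ?_) P, fun y => ?_⟩
  · refine (MvPolynomial.totalDegree_add _ _).trans (max_le (by simp) ?_)
    exact (MvPolynomial.totalDegree_smul_le _ _).trans (by simp)
  · unfold polyVal
    rw [← MvPolynomial.coe_aeval_eq_eval, RingHom.coe_coe, MvPolynomial.aeval_bind₁,
      ← MvPolynomial.coe_aeval_eq_eval, RingHom.coe_coe]
    congr 1
    ext i
    simp

end PolynomialFunctions

section PolynomialNorms

variable {d n : ℕ}

/-- The cube `[-1/2, 1/2)^d`, the reference cube to which estimates of polynomials on arbitrary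
cubes are transported by an affine map. -/
def unitCube (d : ℕ) : AxisCube d := ⟨0, 1, one_pos⟩

lemma mem_unitCube_iff {z : Euc d} {s : ℝ} (hs : 0 < s) {y : Euc d} :
    y ∈ (unitCube d).carrier ↔ z + s • y ∈ (AxisCube.mk z s hs).carrier := by
  refine forall_congr' fun i => ?_
  simp only [unitCube, PiLp.zero_apply, PiLp.add_apply, PiLp.smul_apply, smul_eq_mul]
  refine and_congr ⟨fun h => by nlinarith, fun h => ?_⟩ ⟨fun h => by nlinarith, fun h => ?_⟩ <;>
  · by_contra! hlt
    nlinarith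

lemma volume_unitCube : volume (unitCube d).carrier = 1 := by
  simp [AxisCube.volume_carrier, unitCube]

lemma lintegral_unitCube_comp_affine (Q : AxisCube d) (F : Euc d → ℝ≥0∞) :
    ∫⁻ y in (unitCube d).carrier, F (Q.center + Q.side • y) =
      (volume Q.carrier)⁻¹ * ∫⁻ x in Q.carrier, F x := by
  have hpos := Q.side_pos
  have hmem : ∀ y, y ∈ (unitCube d).carrier ↔ Q.center + Q.side • y ∈ Q.carrier :=
    fun y => mem_unitCube_iff hpos
  have hemb : MeasurableEmbedding (fun y : Euc d => Q.side • y) :=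
    (Homeomorph.smulOfNeZero Q.side hpos.ne').measurableEmbedding
  calc ∫⁻ y in (unitCube d).carrier, F (Q.center + Q.side • y)
      = ∫⁻ y, Q.carrier.indicator F (Q.center + Q.side • y) := by
        rw [← lintegral_indicator (unitCube d).measurableSet_carrier]
        refine lintegral_congr fun y => ?_
        by_cases hy : y ∈ (unitCube d).carrier
        · rw [indicator_of_mem hy, indicator_of_mem ((hmem y).1 hy)]
        · rw [indicator_of_notMem hy, indicator_of_notMem (mt (hmem y).2 hy)]
    _ = ENNReal.ofReal |(Q.side ^ d)⁻¹| * ∫⁻ x, Q.carrier.indicator F (Q.center + x) := by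
        rw [← hemb.lintegral_map (μ := volume) (fun x => Q.carrier.indicator F (Q.center + x)),
          Measure.map_addHaar_smul _ hpos.ne', lintegral_smul_measure, finrank_euclideanSpace_fin,
          smul_eq_mul]
    _ = (volume Q.carrier)⁻¹ * ∫⁻ x in Q.carrier, F x := by
        rw [lintegral_add_left_eq_self (μ := (volume : Measure (Euc d))),
          lintegral_indicator Q.measurableSet_carrier, Q.volume_carrier,
          abs_of_pos (by positivity), ENNReal.ofReal_inv_of_pos (by positivity)]

lemma memLp_polyVal (P : MvPolynomial (Fin d) ℝ) (Q : AxisCube d) :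
    MemLp (polyVal P) 1 (volume.restrict Q.carrier) :=
  memLp_one_iff_integrable.2 (((continuous_polyVal P).locallyIntegrable.integrableOn_isCompact
    Q.isBounded_carrier.isCompact_closure).mono_set subset_closure)

/-- The map sending a polynomial to its class in `L¹(Q)`. -/
noncomputable def polyToLp (Q : AxisCube d) :
    MvPolynomial (Fin d) ℝ →ₗ[ℝ] Lp ℝ 1 (volume.restrict Q.carrier) where
  toFun P := (memLp_polyVal P Q).toLp
  map_add' P₁ P₂ := by
    rw [← MemLp.toLp_add]
    exact MemLp.toLp_congr _ _ (Filter.Eventually.of_forall (polyVal_add P₁ P₂))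
  map_smul' c P := by
    rw [← MemLp.toLp_const_smul]
    exact MemLp.toLp_congr _ _ (Filter.Eventually.of_forall (polyVal_smul c P))

lemma polyToLp_injective (Q : AxisCube d) : Function.Injective (polyToLp Q) := by
  refine (injective_iff_map_eq_zero _).2 fun P hP => eq_zero_of_polyVal_ae_eq_zero (Q := Q) ?_
  have hzero : (memLp_polyVal P Q).toLp = 0 := hP
  refine (memLp_polyVal P Q).coeFn_toLp.symm.trans ?_
  rw [hzero]
  exact Lp.coeFn_zero ..

lemma norm_polyToLp_le {P : MvPolynomial (Fin d) ℝ} {Q : AxisCube d} {B : ℝ} (hB : 0 ≤ B)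
    (h : ∫⁻ x in Q.carrier, ‖polyVal P x‖ₑ ≤ ENNReal.ofReal B) : ‖polyToLp Q P‖ ≤ B := by
  change ‖(memLp_polyVal P Q).toLp‖ ≤ B
  rw [Lp.norm_def, eLpNorm_congr_ae (memLp_polyVal P Q).coeFn_toLp, eLpNorm_one_eq_lintegral_enorm]
  exact ENNReal.toReal_le_of_le_ofReal hB h

/- All norms on the finite dimensional space of polynomials of degree at most `n` are equivalent:
here the norm of `L¹` on the unit cube and that of the coordinates in a basis. -/
lemma exists_abs_repr_le {ι : Type*} [Finite ι]
    (β : Module.Basis ι ℝ (MvPolynomial.restrictTotalDegree (Fin d) ℝ n)) :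
    ∃ C : ℝ, 0 ≤ C ∧ ∀ (p : MvPolynomial.restrictTotalDegree (Fin d) ℝ n) (B : ℝ), 0 ≤ B →
      ∫⁻ x in (unitCube d).carrier, ‖polyVal p x‖ₑ ≤ ENNReal.ofReal B →
      ∀ k, |β.repr p k| ≤ C * B := by
  have := Fintype.ofFinite ι
  let L : (ι → ℝ) →ₗ[ℝ] Lp ℝ 1 (volume.restrict (unitCube d).carrier) :=
    polyToLp (unitCube d) ∘ₗ (MvPolynomial.restrictTotalDegree (Fin d) ℝ n).subtype ∘ₗ
      (β.equivFun.symm : (ι → ℝ) →ₗ[ℝ] _)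
  have hL : LinearMap.ker L = ⊥ := LinearMap.ker_eq_bot.2 ((polyToLp_injective _).comp
    (Subtype.val_injective.comp β.equivFun.symm.injective))
  obtain ⟨K, -, hK⟩ := L.exists_antilipschitzWith hL
  refine ⟨K, K.2, fun p B hB hI k => ?_⟩
  calc |β.repr p k| ≤ ‖β.equivFun p‖ := norm_le_pi_norm (β.equivFun p) k
    _ ≤ K * ‖L (β.equivFun p)‖ := by simpa using hK.le_mul_dist (β.equivFun p) 0
    _ ≤ K * B := by
        refine mul_le_mul_of_nonneg_left (norm_polyToLp_le hB ?_) K.2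
        simpa [L] using hI

lemma polyVal_eq_sum_repr {ι : Type*} [Fintype ι]
    (β : Module.Basis ι ℝ (MvPolynomial.restrictTotalDegree (Fin d) ℝ n))
    (p : MvPolynomial.restrictTotalDegree (Fin d) ℝ n) (x : Euc d) :
    polyVal p x = ∑ k, β.repr p k * polyVal (β k) x := by
  conv_lhs => rw [← β.sum_repr p]
  simp only [Submodule.coe_sum, Submodule.coe_smul, polyVal_sum, polyVal_smul]

lemma exists_abs_polyVal_le_lintegral_unitCube (d n : ℕ) :
    ∃ C : ℝ, 0 < C ∧ ∀ P : MvPolynomial (Fin d) ℝ, P.totalDegree ≤ n → ∀ B : ℝ, 0 ≤ B →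
      ∫⁻ x in (unitCube d).carrier, ‖polyVal P x‖ₑ ≤ ENNReal.ofReal B →
      ∀ y, |polyVal P y| ≤ C * B * (1 + ‖y‖) ^ n := by
  let β := Module.finBasis ℝ (MvPolynomial.restrictTotalDegree (Fin d) ℝ n)
  obtain ⟨C, hC, hrepr⟩ := exists_abs_repr_le β
  choose G hG0 hG using fun k => exists_abs_polyVal_le (β k : MvPolynomial (Fin d) ℝ)
    ((MvPolynomial.mem_restrictTotalDegree _ _ _).1 (β k).2)
  have hG_sum : 0 ≤ ∑ k, G k := Finset.sum_nonneg fun k _ => hG0 k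
  refine ⟨C * (∑ k, G k) + 1, by positivity, fun P hP B hB hI y => ?_⟩
  let p : MvPolynomial.restrictTotalDegree (Fin d) ℝ n :=
    ⟨P, (MvPolynomial.mem_restrictTotalDegree _ _ _).2 hP⟩
  calc |polyVal P y| = |∑ k, β.repr p k * polyVal (β k) y| := by
        rw [← polyVal_eq_sum_repr β p y]
    _ ≤ ∑ k, |β.repr p k| * |polyVal (β k) y| := by
        simpa only [abs_mul] using Finset.abs_sum_le_sum_abs
          (fun k => β.repr p k * polyVal (β k) y) Finset.univ
    _ ≤ ∑ k, (C * B) * (G k * (1 + ‖y‖) ^ n) :=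
        Finset.sum_le_sum fun k _ =>
          mul_le_mul (hrepr p B hB hI k) (hG k y) (abs_nonneg _) (by positivity)
    _ = C * (∑ k, G k) * (B * (1 + ‖y‖) ^ n) := by
        rw [Finset.mul_sum, Finset.sum_mul]
        exact Finset.sum_congr rfl fun k _ => by ring
    _ ≤ (C * (∑ k, G k) + 1) * (B * (1 + ‖y‖) ^ n) := by
        gcongr
        linarith
    _ = _ := by ring

lemma exists_abs_polyVal_le_mean (d n : ℕ) :
    ∃ C : ℝ, 0 < C ∧ ∀ P : MvPolynomial (Fin d) ℝ, P.totalDegree ≤ n → ∀ (Q : AxisCube d) (B : ℝ),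
      0 ≤ B → (volume Q.carrier)⁻¹ * ∫⁻ x in Q.carrier, ‖polyVal P x‖ₑ ≤ ENNReal.ofReal B →
      ∀ x, |polyVal P x| ≤ C * B * (1 + ‖x - Q.center‖ / Q.side) ^ n := by
  obtain ⟨C, hC, hunit⟩ := exists_abs_polyVal_le_lintegral_unitCube d n
  refine ⟨C, hC, fun P hP Q B hB hI x => ?_⟩
  have hs := Q.side_pos
  obtain ⟨P', hP', hval⟩ := exists_polyVal_eq_comp_affine P Q.center Q.side
  rw [← lintegral_unitCube_comp_affine Q fun x => ‖polyVal P x‖ₑ] at hI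
  simp only [← hval] at hI
  have hx := hunit P' (hP'.trans hP) B hB hI (Q.side⁻¹ • (x - Q.center))
  rwa [hval, smul_inv_smul₀ hs.ne', add_sub_cancel, norm_smul, norm_inv,
    Real.norm_of_nonneg hs.le, inv_mul_eq_div] at hx

end PolynomialNorms

section TaylorPolynomials

variable {d n : ℕ}

lemma exists_polyVal_eq_diagonal (A : ContinuousMultilinearMap ℝ (fun _ : Fin n => Euc d) ℝ) :
    ∃ P : MvPolynomial (Fin d) ℝ, P.totalDegree ≤ n ∧ ∀ y, polyVal P y = A fun _ => y := by
  classical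
  refine ⟨∑ r : Fin n → Fin d, MvPolynomial.C (A fun j => EuclideanSpace.single (r j) 1) *
    ∏ j, MvPolynomial.X (r j), MvPolynomial.totalDegree_finsetSum_le fun r _ => ?_, fun y => ?_⟩
  · refine (MvPolynomial.totalDegree_mul _ _).trans ?_
    rw [MvPolynomial.totalDegree_C, zero_add]
    exact (MvPolynomial.totalDegree_finsetProd _ _).trans (by simp)
  · have hy : y = ∑ i, y i • (EuclideanSpace.single i (1 : ℝ) : Euc d) := by
      ext j
      simp [Pi.single_apply]
    conv_rhs => rw [hy]
    rw [ContinuousMultilinearMap.map_sum]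
    simp only [ContinuousMultilinearMap.map_smul_univ, smul_eq_mul]
    simp [polyVal, mul_comm]

lemma abs_taylor_remainder_le {φ : Euc d → ℝ} (hφ : ContDiff ℝ (n + 1) φ) {a y : Euc d} {B : ℝ}
    (hB : ∀ t ∈ Icc (0 : ℝ) 1, ‖iteratedFDeriv ℝ (n + 1) φ (a + t • y)‖ ≤ B) :
    |φ (a + y) - ∑ k ∈ Finset.range (n + 1), (k.factorial : ℝ)⁻¹ •
      iteratedFDeriv ℝ k φ a fun _ => y| ≤ B * ‖y‖ ^ (n + 1) := by
  have hintegrand : ∀ t ∈ uIoc (0 : ℝ) 1,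
      ‖(1 - t) ^ n • iteratedFDeriv ℝ (n + 1) φ (a + t • y) fun _ => y‖ ≤ B * ‖y‖ ^ (n + 1) := by
    intro t ht
    rw [uIoc_of_le zero_le_one] at ht
    have hweight : ‖(1 - t) ^ n‖ ≤ 1 := by
      rw [norm_pow, Real.norm_of_nonneg (by linarith [ht.2])]
      exact pow_le_one₀ (by linarith [ht.2]) (by linarith [ht.1])
    have hderiv : ‖iteratedFDeriv ℝ (n + 1) φ (a + t • y) fun _ => y‖ ≤ B * ‖y‖ ^ (n + 1) := by
      refine (ContinuousMultilinearMap.le_opNorm _ _).trans ?_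
      rw [Finset.prod_const, Finset.card_univ, Fintype.card_fin]
      exact mul_le_mul_of_nonneg_right (hB t ⟨ht.1.le, ht.2⟩) (by positivity)
    rw [norm_smul]
    simpa using mul_le_mul hweight hderiv (norm_nonneg _) zero_le_one
  have hfactorial : |(n.factorial : ℝ)⁻¹| ≤ 1 := by
    rw [abs_of_nonneg (by positivity)]
    exact inv_le_one_of_one_le₀ (by exact_mod_cast Nat.factorial_pos n)
  rw [map_add_eq_sum_add_integral_iteratedFDeriv fun t _ => hφ.contDiffAt, add_sub_cancel_left,
    smul_eq_mul, abs_mul]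
  have hintegral := intervalIntegral.norm_integral_le_of_norm_le_const hintegrand
  rw [sub_zero, abs_one, mul_one, Real.norm_eq_abs] at hintegral
  simpa using mul_le_mul hfactorial hintegral (abs_nonneg _) zero_le_one

lemma exists_taylor_polyVal {φ : Euc d → ℝ} (hφ : ContDiff ℝ (n + 1) φ) {a : Euc d} {r B : ℝ}
    (hB : ∀ x, ‖x - a‖ ≤ r → ‖iteratedFDeriv ℝ (n + 1) φ x‖ ≤ B) :
    ∃ P : MvPolynomial (Fin d) ℝ, P.totalDegree ≤ n ∧
      ∀ x, ‖x - a‖ ≤ r → |φ x - polyVal P x| ≤ B * ‖x - a‖ ^ (n + 1) := by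
  choose p hp hpval using fun k => exists_polyVal_eq_diagonal (iteratedFDeriv ℝ k φ a)
  obtain ⟨P, hP, hPval⟩ := exists_polyVal_eq_comp_affine
    (∑ k ∈ Finset.range (n + 1), (k.factorial : ℝ)⁻¹ • p k) (-a) 1
  refine ⟨P, hP.trans (MvPolynomial.totalDegree_finsetSum_le fun k hk => ?_), fun x hx => ?_⟩
  · exact (MvPolynomial.totalDegree_smul_le _ _).trans
      ((hp k).trans (Finset.mem_range_succ_iff.1 hk))
  · have hremainder := abs_taylor_remainder_le hφ (a := a) (y := x - a) (B := B) fun t ht => by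
      refine hB _ ?_
      rw [add_sub_cancel_left, norm_smul, Real.norm_of_nonneg ht.1]
      exact (mul_le_of_le_one_left (norm_nonneg _) ht.2).trans hx
    rw [hPval, one_smul, neg_add_eq_sub, polyVal_sum]
    simpa only [add_sub_cancel, smul_eq_mul, polyVal_smul, hpval] using hremainder

lemma lintegral_unitCube_enorm_le {φ : Euc d → ℝ} {B : ℝ}
    (hB : ∀ y ∈ (unitCube d).carrier, |φ y| ≤ B) :
    ∫⁻ y in (unitCube d).carrier, ‖φ y‖ₑ ≤ ENNReal.ofReal B :=
  calc ∫⁻ y in (unitCube d).carrier, ‖φ y‖ₑ ≤ ∫⁻ _ in (unitCube d).carrier, ENNReal.ofReal B :=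
        setLIntegral_mono measurable_const fun y hy => by
          rw [Real.enorm_eq_ofReal_abs]
          exact ENNReal.ofReal_le_ofReal (hB y hy)
    _ = ENNReal.ofReal B := by rw [setLIntegral_const, volume_unitCube, mul_one]

lemma exists_norm_iteratedFDeriv_polyVal_le_on_unitBall (P : MvPolynomial (Fin d) ℝ) (m : ℕ) :
    ∃ G : ℝ, 0 ≤ G ∧ ∀ j ≤ m, ∀ y, ‖y‖ ≤ 1 → ‖iteratedFDeriv ℝ j (polyVal P) y‖ ≤ G := by
  have hbound : ∀ j, ∃ G, ∀ y ∈ Metric.closedBall (0 : Euc d) 1,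
      ‖iteratedFDeriv ℝ j (polyVal P) y‖ ≤ G := fun j =>
    (isCompact_closedBall 0 1).exists_bound_of_continuousOn
      ((contDiff_polyVal P).continuous_iteratedFDeriv le_rfl).continuousOn
  choose G hG using hbound
  have hG0 : ∀ j, 0 ≤ G j := fun j => (norm_nonneg _).trans (hG j 0 (by simp))
  refine ⟨∑ j ∈ Finset.range (m + 1), G j, Finset.sum_nonneg fun j _ => hG0 j,
    fun j hj y hy => (hG j y (by simpa using hy)).trans ?_⟩
  exact Finset.single_le_sum (fun j _ => hG0 j) (Finset.mem_range_succ_iff.2 hj)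

lemma iteratedFDeriv_polyVal_eq_sum_repr {ι : Type*} [Fintype ι]
    (β : Module.Basis ι ℝ (MvPolynomial.restrictTotalDegree (Fin d) ℝ n))
    (p : MvPolynomial.restrictTotalDegree (Fin d) ℝ n) (j : ℕ) (x : Euc d) :
    iteratedFDeriv ℝ j (polyVal p) x =
      ∑ k, β.repr p k • iteratedFDeriv ℝ j (polyVal (β k)) x := by
  have hp : polyVal p = fun x => ∑ k, β.repr p k • polyVal (β k) x :=
    funext fun x => polyVal_eq_sum_repr β p x
  rw [hp, iteratedFDeriv_fun_sum_apply
    (f := fun k x => β.repr p k • polyVal (β k : MvPolynomial (Fin d) ℝ) x)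
    fun k _ => (contDiff_const.mul (contDiff_polyVal _)).contDiffAt]
  exact Finset.sum_congr rfl fun k _ => iteratedFDeriv_const_smul_apply (𝕜 := ℝ)
    (a := β.repr p k) (f := polyVal (β k : MvPolynomial (Fin d) ℝ)) (contDiff_polyVal _).contDiffAt

lemma exists_norm_iteratedFDeriv_polyVal_le_unitCube (d n m : ℕ) :
    ∃ C : ℝ, 0 ≤ C ∧ ∀ P : MvPolynomial (Fin d) ℝ, P.totalDegree ≤ n → ∀ B : ℝ,
      (∀ y ∈ (unitCube d).carrier, |polyVal P y| ≤ B) →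
      ∀ j ≤ m, ∀ y, ‖y‖ ≤ 1 → ‖iteratedFDeriv ℝ j (polyVal P) y‖ ≤ C * B := by
  let β := Module.finBasis ℝ (MvPolynomial.restrictTotalDegree (Fin d) ℝ n)
  obtain ⟨C, hC, hrepr⟩ := exists_abs_repr_le β
  choose G hG0 hG using fun k =>
    exists_norm_iteratedFDeriv_polyVal_le_on_unitBall (β k : MvPolynomial (Fin d) ℝ) m
  refine ⟨C * ∑ k, G k, mul_nonneg hC (Finset.sum_nonneg fun k _ => hG0 k),
    fun P hP B hB j hj y hy => ?_⟩
  have hB0 : 0 ≤ B := (abs_nonneg _).trans (hB _ (unitCube d).center_mem)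
  let p : MvPolynomial.restrictTotalDegree (Fin d) ℝ n :=
    ⟨P, (MvPolynomial.mem_restrictTotalDegree _ _ _).2 hP⟩
  calc ‖iteratedFDeriv ℝ j (polyVal P) y‖
      = ‖∑ k, β.repr p k • iteratedFDeriv ℝ j (polyVal (β k)) y‖ := by
        rw [← iteratedFDeriv_polyVal_eq_sum_repr β p j y]
    _ ≤ ∑ k, |β.repr p k| * ‖iteratedFDeriv ℝ j (polyVal (β k)) y‖ := by
        simpa only [norm_smul, Real.norm_eq_abs] using norm_sum_le Finset.univ
          fun k => β.repr p k • iteratedFDeriv ℝ j (polyVal (β k)) y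
    _ ≤ ∑ k, (C * B) * G k := Finset.sum_le_sum fun k _ => mul_le_mul
        (hrepr p B hB0 (lintegral_unitCube_enorm_le hB) k) (hG k j hj y hy) (norm_nonneg _)
        (by positivity)
    _ = C * (∑ k, G k) * B := by
        rw [← Finset.mul_sum]
        ring

lemma exists_norm_iteratedFDeriv_polyVal_le (d n m : ℕ) :
    ∃ C : ℝ, 0 ≤ C ∧ ∀ P : MvPolynomial (Fin d) ℝ, P.totalDegree ≤ n →
      ∀ (Q : AxisCube d) (B : ℝ), (∀ x ∈ Q.carrier, |polyVal P x| ≤ B) →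
      ∀ j ≤ m, ∀ x, ‖x - Q.center‖ ≤ Q.side →
        ‖iteratedFDeriv ℝ j (polyVal P) x‖ ≤ C * B / Q.side ^ j := by
  obtain ⟨C, hC, hunit⟩ := exists_norm_iteratedFDeriv_polyVal_le_unitCube d n m
  refine ⟨C, hC, fun P hP Q B hB j hj x hx => ?_⟩
  have hs := Q.side_pos
  obtain ⟨P', hP', hval⟩ := exists_polyVal_eq_comp_affine P Q.center Q.side
  have hP_eq : polyVal P = fun x => polyVal P' (-(Q.side⁻¹ • Q.center) + Q.side⁻¹ • x) := by
    funext x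
    rw [hval, smul_add, smul_neg, smul_inv_smul₀ hs.ne', smul_inv_smul₀ hs.ne',
      add_neg_cancel_left]
  have hscale := congrFun (iteratedFDeriv_comp_const_smul (𝕜 := ℝ) (i := j)
    (f := fun z => polyVal P' (-(Q.side⁻¹ • Q.center) + z)) Q.side⁻¹
    ((contDiff_polyVal P').comp (contDiff_const.add contDiff_id))) x
  rw [hP_eq, hscale, iteratedFDeriv_comp_add_left, norm_smul, norm_pow, norm_inv,
    Real.norm_of_nonneg hs.le, div_eq_mul_inv, mul_comm, ← inv_pow]
  refine mul_le_mul_of_nonneg_right (hunit P' (hP'.trans hP) B (fun y hy => ?_) j hj _ ?_)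
    (by positivity)
  · rw [hval]
    exact hB _ ((mem_unitCube_iff hs).1 hy)
  · rw [neg_add_eq_sub, ← smul_sub, norm_smul, norm_inv, Real.norm_of_nonneg hs.le]
    exact inv_mul_le_one_of_le₀ hx hs.le

lemma exists_norm_iteratedFDeriv_mul_polyVal_le (d n m : ℕ) :
    ∃ C : ℝ, 0 ≤ C ∧ ∀ (Q : AxisCube d) (A B : ℝ) (ψ : Euc d → ℝ) (P : MvPolynomial (Fin d) ℝ),
      ContDiff ℝ m ψ → (∀ k ≤ m, ∀ x, ‖iteratedFDeriv ℝ k ψ x‖ ≤ A / Q.side ^ k) →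
      P.totalDegree ≤ n → (∀ x ∈ Q.carrier, |polyVal P x| ≤ B) →
      ∀ x, ‖x - Q.center‖ ≤ Q.side →
        ‖iteratedFDeriv ℝ m (fun y => ψ y * polyVal P y) x‖ ≤ C * A * B / Q.side ^ m := by
  obtain ⟨C, hC, hderiv⟩ := exists_norm_iteratedFDeriv_polyVal_le d n m
  refine ⟨2 ^ m * C, by positivity, fun Q A B ψ P hψ hA hP hB x hx => ?_⟩
  have hPx := hderiv P hP Q B hB
  calc ‖iteratedFDeriv ℝ m (fun y => ψ y * polyVal P y) x‖
      ≤ ∑ i ∈ Finset.range (m + 1), (m.choose i : ℝ) * ‖iteratedFDeriv ℝ i ψ x‖ *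
          ‖iteratedFDeriv ℝ (m - i) (polyVal P) x‖ :=
        norm_iteratedFDeriv_mul_le hψ (contDiff_polyVal P) x le_rfl
    _ ≤ ∑ i ∈ Finset.range (m + 1), (m.choose i : ℝ) * (C * A * B / Q.side ^ m) := by
        refine Finset.sum_le_sum fun i hi => ?_
        have him := Finset.mem_range_succ_iff.1 hi
        rw [mul_assoc]
        refine mul_le_mul_of_nonneg_left ?_ (Nat.cast_nonneg _)
        calc _ ≤ A / Q.side ^ i * (C * B / Q.side ^ (m - i)) :=
              mul_le_mul (hA i him x) (hPx _ (Nat.sub_le m i) x hx) (norm_nonneg _)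
                ((norm_nonneg _).trans (hA i him x))
          _ = C * A * B / Q.side ^ m := by
              rw [div_mul_div_comm, ← pow_add, Nat.add_sub_cancel' him]
              ring
    _ = 2 ^ m * C * A * B / Q.side ^ m := by
        rw [← Finset.sum_mul, ← Nat.cast_sum, Nat.sum_range_choose]
        push_cast
        ring

lemma exists_polyVal_approx_mul_polyVal (d n : ℕ) :
    ∃ C : ℝ, 0 ≤ C ∧ ∀ (Q : AxisCube d) (A B : ℝ) (ψ : Euc d → ℝ) (g : MvPolynomial (Fin d) ℝ),
      ContDiff ℝ (n + 1) ψ →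
      (∀ k ≤ n + 1, ∀ x, ‖iteratedFDeriv ℝ k ψ x‖ ≤ A / Q.side ^ k) → g.totalDegree ≤ n →
      (∀ x ∈ Q.carrier, |polyVal g x| ≤ B) →
      ∃ P : MvPolynomial (Fin d) ℝ, P.totalDegree ≤ n ∧ ∀ x, ‖x - Q.center‖ ≤ Q.side →
        |ψ x * polyVal g x - polyVal P x| ≤ C * A * B * (‖x - Q.center‖ / Q.side) ^ (n + 1) := by
  obtain ⟨C, hC, hderiv⟩ := exists_norm_iteratedFDeriv_mul_polyVal_le d n (n + 1)
  refine ⟨C, hC, fun Q A B ψ g hψ hA hg hB => ?_⟩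
  obtain ⟨P, hP, hPx⟩ := exists_taylor_polyVal (n := n) (hψ.mul (contDiff_polyVal g))
    (hderiv Q A B ψ g (by exact_mod_cast hψ) hA hg hB)
  refine ⟨P, hP, fun x hx => (hPx x hx).trans_eq ?_⟩
  rw [div_pow]
  ring

end TaylorPolynomials

section Moduli

/-- The growth conditions satisfied by a modulus of continuity of order `n`: at most growth of order
`n + 1` at large scales, and decay of some positive order `r` at small ones. -/
structure ModulusBounds (ω : ℝ → ℝ) (n : ℕ) (A r : ℝ) : Prop where
  one_le : 1 ≤ A
  r_pos : 0 < r
  pos : ∀ t, 0 < t → 0 < ω t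
  mono : ∀ s t, 0 ≤ s → s ≤ t → ω s ≤ ω t
  growth : ∀ s t, 1 ≤ s → 0 < t → ω (s * t) ≤ A * s ^ (n + 1) * ω t
  decay : ∀ s t, 0 < s → s ≤ 1 → 0 < t → ω (s * t) ≤ A * s ^ r * ω t

variable {ω : ℝ → ℝ} {n : ℕ}

lemma IsModulusOfOrder.pos (h : IsModulusOfOrder ω n) {t : ℝ} (ht : 0 < t) : 0 < ω t := by
  obtain ⟨-, ⟨q, -, -, C, hC, hgrowth⟩, -⟩ := h.isLeast.1
  have hnonneg : 0 ≤ ω (2 * t) := by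
    rw [← h.map_zero]
    have h2t : 0 ≤ 2 * t := by positivity
    exact h.monotoneOn self_mem_Ici h2t h2t
  exact (mul_pos_iff_of_pos_left (by positivity)).1 (hnonneg.trans_lt (hgrowth 2 t one_lt_two ht))

lemma IsModulusOfOrder.exists_bounds (h : IsModulusOfOrder ω n) :
    ∃ A r : ℝ, ModulusBounds ω n A r := by
  obtain ⟨hn, ⟨q, -, hqn, C₁, -, hgrowth⟩, r, hnr, -, C₂, -, hdecay⟩ := h.isLeast.1
  have hn1 : (1 : ℝ) ≤ n := by exact_mod_cast hn
  refine ⟨max 1 (max C₁ C₂), r, le_max_left _ _, by linarith, fun t => h.pos,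
    fun s t hs hst => h.monotoneOn hs (hs.trans hst) hst, fun s t hs ht => ?_,
    fun s t hs0 hs ht => ?_⟩
  · have hω := h.pos ht
    rcases hs.eq_or_lt with rfl | hs
    · simpa using le_mul_of_one_le_left hω.le (le_max_left 1 (max C₁ C₂))
    · have hpow : s ^ q ≤ s ^ (n + 1) := by
        rw [← Real.rpow_natCast]
        exact Real.rpow_le_rpow_of_exponent_le hs.le (by exact_mod_cast hqn.le)
      refine (hgrowth s t hs ht).le.trans ?_
      gcongr
      exact (le_max_left _ _).trans (le_max_right _ _)
  · have hω := h.pos ht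
    rcases hs.eq_or_lt with rfl | hs
    · simpa using le_mul_of_one_le_left hω.le (le_max_left 1 (max C₁ C₂))
    · refine (hdecay s t hs0 hs ht).le.trans ?_
      gcongr
      exact (le_max_right _ _).trans (le_max_right _ _)

namespace ModulusBounds

variable {A r : ℝ}

lemma nonneg (h : ModulusBounds ω n A r) : 0 ≤ A := zero_le_one.trans h.one_le

lemma mul_div_pow_le (h : ModulusBounds ω n A r) {s t : ℝ} (hs : 0 < s) (hst : s ≤ t) :
    ω t * (s / t) ^ (n + 1) ≤ A * ω s := by
  have ht : 0 < t := hs.trans_le hst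
  have hgrowth := h.growth (t / s) s ((one_le_div hs).2 hst) hs
  rw [div_mul_cancel₀ _ hs.ne'] at hgrowth
  calc ω t * (s / t) ^ (n + 1) ≤ A * (t / s) ^ (n + 1) * ω s * (s / t) ^ (n + 1) := by gcongr
    _ = A * ω s * (t / s * (s / t)) ^ (n + 1) := by rw [mul_pow]; ring
    _ = A * ω s := by rw [div_mul_div_cancel₀ hs.ne', div_self ht.ne', one_pow, mul_one]

lemma le_geometric (h : ModulusBounds ω n A r) {l t : ℝ} (hl : 1 < l) (ht : 0 < t) (k : ℕ) :
    ω t ≤ A * (l⁻¹ ^ r) ^ k * ω (l ^ k * t) := by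
  have hl0 : 0 < l := zero_lt_one.trans hl
  have hdecay := h.decay (l⁻¹ ^ k) (l ^ k * t) (by positivity)
    (pow_le_one₀ (by positivity) (inv_lt_one_of_one_lt₀ hl).le) (by positivity)
  rwa [← mul_assoc, ← mul_pow, inv_mul_cancel₀ hl0.ne', one_pow, one_mul,
    ← Real.rpow_natCast, ← Real.rpow_mul (by positivity), mul_comm (k : ℝ),
    Real.rpow_mul (by positivity), Real.rpow_natCast] at hdecay

lemma exists_sum_le (h : ModulusBounds ω n A r) {l : ℝ} (hl : 1 < l) :
    ∃ K : ℝ, 0 ≤ K ∧ ∀ (J : ℕ) (t : ℝ), 0 < t →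
      ∑ i ∈ Finset.range (J + 1), ω (l ^ i * t) ≤ K * ω (l ^ J * t) := by
  have : 0 < l := zero_lt_one.trans hl
  have hA := h.nonneg
  set θ : ℝ := l⁻¹ ^ r
  have hθ0 : 0 ≤ θ := by positivity
  have hθ1 : θ < 1 := Real.rpow_lt_one (by positivity) (inv_lt_one_of_one_lt₀ hl) h.r_pos
  refine ⟨A * (1 - θ)⁻¹, mul_nonneg hA (inv_nonneg.2 (sub_nonneg.2 hθ1.le)), fun J t ht => ?_⟩
  have hωJ := h.pos (l ^ J * t) (by positivity)
  calc ∑ i ∈ Finset.range (J + 1), ω (l ^ i * t)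
      ≤ ∑ i ∈ Finset.range (J + 1), A * ω (l ^ J * t) * θ ^ (J - i) := by
        refine Finset.sum_le_sum fun i hi => ?_
        have hiJ := h.le_geometric hl (t := l ^ i * t) (by positivity) (J - i)
        rw [← mul_assoc, ← pow_add, Nat.sub_add_cancel (Finset.mem_range_succ_iff.1 hi)] at hiJ
        linarith
    _ = A * ω (l ^ J * t) * ∑ i ∈ Finset.range (J + 1), θ ^ i := by
        rw [← Finset.mul_sum, ← Finset.sum_range_reflect (fun i => θ ^ i)]
        simp only [Nat.add_sub_cancel]
    _ ≤ A * ω (l ^ J * t) * (1 - θ)⁻¹ := by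
        gcongr
        rw [← tsum_geometric_of_lt_one hθ0 hθ1]
        exact (summable_geometric_of_lt_one hθ0 hθ1).sum_le_tsum _ fun i _ => by positivity
    _ = A * (1 - θ)⁻¹ * ω (l ^ J * t) := by ring

end ModulusBounds

end Moduli

section Cones

variable {d : ℕ}

/-- `e` is a common axis of interior cones near `a`: the cones of aperture `c`, height `r₀` and
axis `e` with vertices in `closure D` at distance at most `r₀` from `a` lie in `D`. -/
structure IsConeAxis (D : Set (Euc d)) (c r₀ : ℝ) (a e : Euc d) : Prop where
  norm_eq_one : ‖e‖ = 1
  add_mem : ∀ z ∈ closure D, ‖z - a‖ ≤ r₀ → ∀ t, 0 < t → t ≤ r₀ → ∀ v, ‖v‖ ≤ c * t →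
    z + t • e + v ∈ D

/-- The interior cone condition: near every boundary point the set `D` contains cones with a common
axis, and their aperture `c` and height `r₀` do not depend on the point. Lipschitz domains satisfy
it. -/
structure HasInteriorCones (D : Set (Euc d)) (c r₀ : ℝ) : Prop where
  aperture_pos : 0 < c
  aperture_le_one : c ≤ 1
  height_pos : 0 < r₀
  exists_isConeAxis : ∀ a ∈ frontier D, ∃ e, IsConeAxis D c r₀ a e

lemma lt_snd_of_lipschitzWith {F : Type*} [NormedAddCommGroup F] [NormedSpace ℝ F] {δ : ℝ≥0}
    {A : F → ℝ} (hA : LipschitzWith δ A) {p v : WithLp 2 (F × ℝ)} (hp : A p.fst < p.snd) {c t : ℝ}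
    (hc : c * (1 + δ) ≤ 1) (ht : 0 ≤ t) (hv : ‖v‖ ≤ c * t) :
    A (p + t • WithLp.toLp 2 (0, 1) + v).fst < (p + t • WithLp.toLp 2 (0, 1) + v).snd := by
  have hlip := (abs_le.1 (hA.dist_le_mul (p.fst + v.fst) p.fst)).2
  rw [dist_eq_norm, add_sub_cancel_left] at hlip
  have hfst : δ * ‖v.fst‖ ≤ δ * (c * t) :=
    mul_le_mul_of_nonneg_left ((WithLp.norm_fst_le _ v).trans hv) δ.2
  have hsnd := (abs_le.1 ((WithLp.norm_snd_le _ v).trans hv)).1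
  have hct := mul_le_mul_of_nonneg_right hc ht
  change A (p.fst + t • 0 + v.fst) < p.snd + t * 1 + v.snd
  rw [smul_zero, add_zero]
  linarith

lemma IsLipschitzDomain.exists_open_cone {δ : ℝ≥0} {R : ℝ} {D : Set (Euc d)}
    (hD : IsLipschitzDomain δ R D) {c : ℝ} (hc : c * (1 + δ) ≤ 1) {a : Euc d}
    (ha : a ∈ frontier D) :
    ∃ e : Euc d, ‖e‖ = 1 ∧ ∀ z ∈ D, ∀ t, 0 ≤ t → ‖z - a‖ + 2 * t < R / 2 → ∀ v, ‖v‖ ≤ c * t →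
      z + t • e + v ∈ D := by
  obtain ⟨-, -, -, -, hloc⟩ := hD
  obtain ⟨ρ, A, hA, hiff⟩ := hloc a ha
  have hnear : ∀ z : Euc d, ‖z - a‖ < R / 2 →
      (z ∈ D ↔ A (ρ (z - a)).fst < (ρ (z - a)).snd) := by
    intro z hz
    rw [← ρ.norm_map] at hz
    exact hiff z
      (fun i => ((Euc.abs_apply_le_norm _ i).trans (WithLp.norm_fst_le _ _)).trans_lt hz)
      ((WithLp.norm_snd_le _ _).trans_lt hz)
  have he : ‖ρ.symm (WithLp.toLp 2 (0, 1))‖ = 1 := by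
    rw [ρ.symm.norm_map]
    simp
  refine ⟨ρ.symm (WithLp.toLp 2 (0, 1)), he, fun z hz t ht hzt v hv => ?_⟩
  set e := ρ.symm (WithLp.toLp 2 (0, 1)) with he_def
  have hvt : ‖v‖ ≤ t := by nlinarith [δ.2]
  have hsub : z + t • e + v - a = (z - a) + t • e + v := by abel
  have hnorm : ‖(z - a) + t • e + v‖ < R / 2 := by
    refine (norm_add₃_le (a := z - a) (b := t • e) (c := v)).trans_lt ?_
    rw [norm_smul, he, Real.norm_of_nonneg ht]
    linarith
  rw [hnear _ (by rwa [hsub]), hsub, map_add, map_add, map_smul, he_def,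
    LinearIsometryEquiv.apply_symm_apply]
  exact lt_snd_of_lipschitzWith hA ((hnear z (by linarith)).1 hz) hc ht (by rwa [ρ.norm_map])

lemma IsLipschitzDomain.exists_cones {δ : ℝ≥0} {R : ℝ} {D : Set (Euc d)}
    (hD : IsLipschitzDomain δ R D) : ∃ c r₀ : ℝ, HasInteriorCones D c r₀ := by
  have hR : 0 < R := hD.2.2.2.1
  set c : ℝ := 1 / (2 * (1 + δ))
  have hc0 : 0 < c := by positivity
  have hcδ : 2 * c * (1 + δ) = 1 := by
    simp only [c]
    field_simp
  refine ⟨c, R / 16, hc0, by nlinarith [δ.2], by linarith, fun a ha => ?_⟩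
  obtain ⟨e, he, hcone⟩ := hD.exists_open_cone hcδ.le ha
  refine ⟨e, he, fun z hz hza t ht htR v hv => ?_⟩
  obtain ⟨z', hz', hzz'⟩ := Metric.mem_closure_iff.1 hz (min (c * t) (R / 16)) (by positivity)
  rw [dist_eq_norm] at hzz'
  have hnear : ‖z - z'‖ ≤ c * t := hzz'.le.trans (min_le_left _ _)
  have hz'a : ‖z' - a‖ ≤ R / 8 := by
    rw [← sub_sub_sub_cancel_left a z' z, norm_sub_rev]
    refine (norm_sub_le _ _).trans ?_
    linarith [hzz'.le.trans (min_le_right _ _)]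
  have hmem := hcone z' hz' t ht.le (by linarith) (v + (z - z'))
    ((norm_add_le _ _).trans (by linarith))
  rwa [show z' + t • e + (v + (z - z')) = z + t • e + v by abel] at hmem

variable {D : Set (Euc d)} {c r₀ : ℝ}

lemma notMem_of_mem_frontier {X : Type*} [TopologicalSpace X] {U : Set X} (hU : IsOpen U) {a : X}
    (ha : a ∈ frontier U) : a ∉ U := by
  rw [hU.frontier_eq] at ha
  exact ha.2

namespace HasInteriorCones

lemma exists_axis (h : HasInteriorCones D c r₀) {a : Euc d} (ha : a ∈ frontier D) :
    ∃ e : Euc d, ‖e‖ = 1 ∧ ∀ z ∈ closure D, ‖z - a‖ ≤ r₀ → ∀ t, 0 < t → t ≤ r₀ →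
      z + t • e ∈ D := by
  obtain ⟨e, he, hcone⟩ := h.exists_isConeAxis a ha
  refine ⟨e, he, fun z hz hza t ht htr => ?_⟩
  simpa using hcone z hz hza t ht htr 0 (by simpa using mul_nonneg h.aperture_pos.le ht.le)

lemma frontier_closure_eq (h : HasInteriorCones D c r₀) (hD : IsOpen D) :
    frontier (closure D) = frontier D := by
  refine subset_antisymm frontier_closure_subset fun a ha => ?_
  obtain ⟨e, he, haxis⟩ := h.exists_axis ha
  rw [frontier, closure_closure]
  refine ⟨frontier_subset_closure ha, fun ha_int => ?_⟩
  obtain ⟨ε, hε, hball⟩ := Metric.isOpen_iff.1 isOpen_interior a ha_int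
  have hr := h.height_pos
  set t := min (ε / 2) r₀
  have ht : 0 < t := by positivity
  have hnorm : ‖a - t • e - a‖ = t := by
    rw [sub_sub_cancel_left, norm_neg, norm_smul, he, Real.norm_of_nonneg ht.le, mul_one]
  have hmem : a - t • e ∈ closure D := by
    refine interior_subset (hball (mem_ball_iff_norm.2 ?_))
    rw [hnorm]
    exact (min_le_left _ _).trans_lt (half_lt_self hε)
  have ha_mem := haxis _ hmem (hnorm.trans_le (min_le_right _ _)) t ht (min_le_right _ _)
  rw [sub_add_cancel] at ha_mem
  exact notMem_of_mem_frontier hD ha ha_mem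

open scoped Pointwise in
/- Translating a piece of the boundary along the axis of the cones by different amounts gives
disjoint sets, so a bounded set contains infinitely many disjoint copies of that piece. -/
lemma volume_frontier (h : HasInteriorCones D c r₀) (hD : IsOpen D) :
    volume (frontier D) = 0 := by
  refine measure_null_of_locally_null _ fun a ha => ?_
  obtain ⟨e, he, haxis⟩ := h.exists_axis ha
  have hr := h.height_pos
  set K := frontier D ∩ Metric.closedBall a r₀
  let s : ℕ → ℝ := fun k => r₀ / (k + 1)
  have hs_pos : ∀ k, 0 < s k := fun k => by positivity
  have hs_le : ∀ k, s k ≤ r₀ := fun k =>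
    div_le_self hr.le (le_add_of_nonneg_left (Nat.cast_nonneg k))
  have hs_anti : StrictAnti s := fun k l hkl =>
    div_lt_div_of_pos_left hr (by positivity) (by exact_mod_cast Nat.succ_lt_succ hkl)
  have hdisj : ∀ k l, k < l → Disjoint ({s k • e} + K) ({s l • e} + K) := by
    intro k l hkl
    rw [Set.disjoint_left]
    simp only [singleton_add, image_add_left, mem_preimage]
    intro x hxk hxl
    have hmem := haxis _ (frontier_subset_closure hxk.1) (mem_closedBall_iff_norm.1 hxk.2)
      (s k - s l) (sub_pos.2 (hs_anti hkl)) (by linarith [hs_pos l, hs_le k])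
    rw [sub_smul, neg_add_eq_sub, sub_add, sub_sub_cancel, sub_eq_neg_add] at hmem
    exact notMem_of_mem_frontier hD hxl.1 hmem
  refine ⟨K, Filter.inter_mem self_mem_nhdsWithin
    (mem_nhdsWithin_of_mem_nhds (Metric.closedBall_mem_nhds a hr)), ?_⟩
  refine Measure.addHaar_eq_zero_of_disjoint_translates volume (fun k => s k • e) ?_
    (fun k l hkl => (lt_or_gt_of_ne hkl).elim (hdisj k l) fun hlk => (hdisj l k hlk).symm)
    (isClosed_frontier.measurableSet.inter Metric.isClosed_closedBall.measurableSet)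
  refine (Metric.isBounded_closedBall (x := (0 : Euc d)) (r := r₀)).subset ?_
  rintro _ ⟨k, rfl⟩
  rw [mem_closedBall_zero_iff, norm_smul, he, mul_one, Real.norm_of_nonneg (hs_pos k).le]
  exact hs_le k

end HasInteriorCones

end Cones

section Whitney

variable {d : ℕ} {G : Set (Euc d)} {W : Set (AxisCube d)} {Q : AxisCube d}

lemma ball_subset_of_disjoint_frontier (hG : IsOpen G) {x : Euc d} {r : ℝ} (hx : x ∈ G)
    (h : Disjoint (Metric.ball x r) (frontier G)) : Metric.ball x r ⊆ G := by
  rcases le_or_gt r 0 with hr | hr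
  · simp [Metric.ball_eq_empty.2 hr]
  refine (convex_ball x r).isPreconnected.subset_of_closure_inter_subset hG
    ⟨x, Metric.mem_ball_self hr, hx⟩ fun w ⟨hw, hwr⟩ => ?_
  by_contra hwG
  exact disjoint_left.1 h hwr (hG.frontier_eq ▸ ⟨hw, hwG⟩)

namespace IsWhitneyCovering

lemma carrier_subset (hW : IsWhitneyCovering G W) (hQ : Q ∈ W) : Q.carrier ⊆ G := by
  rw [← hW.covers]
  exact subset_biUnion_of_mem (u := AxisCube.carrier) hQ

lemma exists_mem (hW : IsWhitneyCovering G W) {x : Euc d} (hx : x ∈ G) :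
    ∃ Q ∈ W, x ∈ Q.carrier := by
  rw [← hW.covers] at hx
  simpa using hx

lemma diam_le_dist (hW : IsWhitneyCovering G W) (hQ : Q ∈ W) {x a : Euc d}
    (hx : x ∈ Q.carrier) (ha : a ∈ frontier G) : Metric.diam Q.carrier ≤ dist x a := by
  have h := (hW.diam_le Q hQ).trans (setEDist_le_edist hx ha)
  rw [Q.ediam_carrier, edist_dist] at h
  exact (ENNReal.ofReal_le_ofReal_iff dist_nonneg).1 h

lemma exists_setEDist_eq (hW : IsWhitneyCovering G W) (hQ : Q ∈ W) :
    ∃ r : ℝ, setEDist Q.carrier (frontier G) = ENNReal.ofReal r ∧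
      Metric.diam Q.carrier ≤ r ∧ r ≤ 4 * Metric.diam Q.carrier := by
  have hupper := hW.le_diam Q hQ
  have hlower := hW.diam_le Q hQ
  rw [Q.ediam_carrier, ← ENNReal.ofReal_ofNat 4, ← ENNReal.ofReal_mul (by norm_num)] at hupper
  have hreal := ENNReal.ofReal_toReal (hupper.trans_lt ENNReal.ofReal_lt_top).ne
  rw [Q.ediam_carrier, ← hreal, ENNReal.ofReal_le_ofReal_iff ENNReal.toReal_nonneg] at hlower
  exact ⟨_, hreal.symm, hlower,
    ENNReal.toReal_le_of_le_ofReal (mul_nonneg (by norm_num) Metric.diam_nonneg) hupper⟩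

lemma setEDist_lt (hW : IsWhitneyCovering G W) (hd : 0 < d) (hQ : Q ∈ W) :
    setEDist Q.carrier (frontier G) < ENNReal.ofReal (5 * Metric.diam Q.carrier) := by
  obtain ⟨r, hr, -, hr4⟩ := hW.exists_setEDist_eq hQ
  have hdiam := Q.half_side_le_diam hd
  have hs := Q.side_pos
  rw [hr]
  exact (ENNReal.ofReal_lt_ofReal_iff (by linarith)).2 (by linarith)

lemma exists_dist_le (hW : IsWhitneyCovering G W) (hd : 0 < d) (hQ : Q ∈ W) :
    ∃ x ∈ Q.carrier, ∃ a ∈ frontier G, dist x a ≤ 5 * Metric.diam Q.carrier :=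
  exists_dist_le_of_setEDist_lt (hW.setEDist_lt hd hQ)

lemma scale_two_subset (hW : IsWhitneyCovering G W) (hG : IsOpen G) (hd : 0 < d) (hQ : Q ∈ W) :
    (Q.scale 2 two_pos).carrier ⊆ G := by
  intro y hy
  set x := Q.center + (2 : ℝ)⁻¹ • (y - Q.center) with hx_def
  have hx : x ∈ Q.carrier := AxisCube.center_add_inv_smul_mem two_pos hy
  have hyx : y - x = x - Q.center := by
    rw [hx_def]
    module
  refine ball_subset_of_disjoint_frontier (r := Metric.diam Q.carrier) hG
    (hW.carrier_subset hQ hx) (disjoint_left.2 fun w hw hwG => ?_) ?_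
  · exact (hW.diam_le_dist hQ hx hwG).not_gt (Metric.mem_ball'.1 hw)
  · rw [mem_ball_iff_norm, hyx]
    linarith [AxisCube.norm_sub_center_le_diam hx, Q.half_side_le_diam hd, Q.side_pos]

lemma infDist_bounds (hW : IsWhitneyCovering G W) (hd : 0 < d) (hQ : Q ∈ W) {y : Euc d}
    (hy : y ∈ (Q.scale (5 / 4) (by norm_num)).carrier) :
    Q.side / 4 ≤ Metric.infDist y (frontier G) ∧
      Metric.infDist y (frontier G) ≤ 7 * d * Q.side := by
  set x := Q.center + (5 / 4 : ℝ)⁻¹ • (y - Q.center) with hx_def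
  have hx : x ∈ Q.carrier := AxisCube.center_add_inv_smul_mem (by norm_num) hy
  have hxc := AxisCube.norm_sub_center_le_diam hx
  have hdiam := Q.half_side_le_diam hd
  have hdiam' := Q.diam_carrier_le
  have hs := Q.side_pos
  have hyx : dist y x = 1 / 4 * ‖x - Q.center‖ := by
    rw [dist_eq_norm, show y - x = (1 / 4 : ℝ) • (x - Q.center) by rw [hx_def]; module, norm_smul,
      Real.norm_of_nonneg (by norm_num)]
  obtain ⟨x', hx', a, ha, hxa⟩ := hW.exists_dist_le hd hQ
  constructor
  · rw [Metric.le_infDist ⟨a, ha⟩]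
    intro b hb
    linarith [hW.diam_le_dist hQ hx hb, dist_triangle_left x b y]
  · have : 0 ≤ (d : ℝ) * Q.side := by positivity
    linarith [Metric.infDist_le_dist_of_mem (x := y) ha, dist_triangle4 y x x' a,
      Metric.dist_le_diam_of_mem Q.isBounded_carrier hx hx']

lemma countable (hW : IsWhitneyCovering G W) : W.Countable :=
  hW.disjoint.countable_of_nonempty_interior fun Q _ => ⟨Q.center, mem_interior.2
    ⟨Metric.ball Q.center (Q.side / 2),
      fun _ hx => AxisCube.mem_carrier_of_norm_lt (mem_ball_iff_norm.1 hx), Metric.isOpen_ball,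
      Metric.mem_ball_self (half_pos Q.side_pos)⟩⟩

end IsWhitneyCovering

lemma card_le_of_pairwiseDisjoint_carrier {T : Finset (AxisCube d)}
    (hT : (T : Set (AxisCube d)).PairwiseDisjoint AxisCube.carrier) {s : ℝ} (hs : 0 < s)
    (B : AxisCube d) (hside : ∀ Q ∈ T, s ≤ Q.side) (hB : ∀ Q ∈ T, Q.carrier ⊆ B.carrier) :
    (T.card : ℝ) ≤ (B.side / s) ^ d := by
  have hvolume : (T.card : ℝ≥0∞) * ENNReal.ofReal (s ^ d) ≤ ENNReal.ofReal (B.side ^ d) :=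
    calc (T.card : ℝ≥0∞) * ENNReal.ofReal (s ^ d)
        = ∑ _Q ∈ T, ENNReal.ofReal (s ^ d) := by rw [Finset.sum_const, nsmul_eq_mul]
      _ ≤ ∑ Q ∈ T, volume Q.carrier := by
          refine Finset.sum_le_sum fun Q hQ => ?_
          rw [Q.volume_carrier]
          exact ENNReal.ofReal_le_ofReal (pow_le_pow_left₀ hs.le (hside Q hQ) d)
      _ = volume (⋃ Q ∈ T, Q.carrier) :=
          (measure_biUnion_finset hT fun Q _ => Q.measurableSet_carrier).symm
      _ ≤ volume B.carrier := measure_mono (iUnion₂_subset hB)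
      _ = ENNReal.ofReal (B.side ^ d) := B.volume_carrier
  rw [div_pow, le_div_iff₀ (by positivity)]
  rw [← ENNReal.ofReal_natCast, ← ENNReal.ofReal_mul (by positivity)] at hvolume
  exact (ENNReal.ofReal_le_ofReal_iff (pow_nonneg B.side_pos.le d)).1 hvolume

lemma finite_and_ncard_le_of_pairwiseDisjoint_carrier {F : Set (AxisCube d)}
    (hF : F.PairwiseDisjoint AxisCube.carrier) {s : ℝ} (hs : 0 < s) (B : AxisCube d)
    (hside : ∀ Q ∈ F, s ≤ Q.side) (hB : ∀ Q ∈ F, Q.carrier ⊆ B.carrier) :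
    F.Finite ∧ (F.ncard : ℝ) ≤ (B.side / s) ^ d := by
  have hcard : ∀ T : Finset (AxisCube d), (T : Set (AxisCube d)) ⊆ F →
      (T.card : ℝ) ≤ (B.side / s) ^ d := fun T hT =>
    card_le_of_pairwiseDisjoint_carrier (hF.subset hT) hs B (fun Q hQ => hside Q (hT hQ))
      fun Q hQ => hB Q (hT hQ)
  have hfin : F.Finite := by
    by_contra hinf
    obtain ⟨N, hN⟩ := exists_nat_gt ((B.side / s) ^ d)
    obtain ⟨T, hT, rfl⟩ := Set.Infinite.exists_subset_card_eq hinf N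
    exact hN.not_ge (hcard T hT)
  refine ⟨hfin, ?_⟩
  rw [Set.ncard_eq_toFinset_card F hfin]
  exact hcard _ (by simp)

namespace IsWhitneyCovering

lemma comparable_of_dist_le (hW : IsWhitneyCovering G W) (hd : 0 < d) (hQ : Q ∈ W) {x₀ y : Euc d}
    (hy : y ∈ (Q.scale (5 / 4) (by norm_num)).carrier)
    (hyx : dist y x₀ ≤ Metric.infDist x₀ (frontier G) / 2) :
    Q.side ≤ 6 * Metric.infDist x₀ (frontier G) ∧
      Metric.infDist x₀ (frontier G) ≤ 14 * d * Q.side ∧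
      ‖Q.center - x₀‖ ≤ 5 * d * Metric.infDist x₀ (frontier G) := by
  have hd1 : (1 : ℝ) ≤ d := by exact_mod_cast hd
  set ρ := Metric.infDist x₀ (frontier G)
  obtain ⟨hlower, hupper⟩ := hW.infDist_bounds hd hQ hy
  have hyx₀ := Metric.infDist_le_infDist_add_dist (s := frontier G) (x := y) (y := x₀)
  have hx₀y := Metric.infDist_le_infDist_add_dist (s := frontier G) (x := x₀) (y := y)
  rw [dist_comm x₀ y] at hx₀y
  have hside : Q.side ≤ 6 * ρ := by linarith
  refine ⟨hside, by linarith, ?_⟩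
  have hyc := AxisCube.norm_sub_center_le hy
  simp only [AxisCube.scale] at hyc
  have hdρ : (d : ℝ) * Q.side ≤ d * (6 * ρ) := by gcongr
  rw [← dist_eq_norm] at hyc ⊢
  have hρ : ρ ≤ d * ρ := le_mul_of_one_le_left Metric.infDist_nonneg hd1
  linarith [dist_triangle_left Q.center x₀ y]

lemma finite_near (hW : IsWhitneyCovering G W) (hd : 0 < d) {x₀ : Euc d}
    (hx₀ : 0 < Metric.infDist x₀ (frontier G)) {F : Set (AxisCube d)} (hFW : F ⊆ W)
    (hF : ∀ Q ∈ F, ∃ y ∈ (Q.scale (5 / 4) (by norm_num)).carrier,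
      dist y x₀ ≤ Metric.infDist x₀ (frontier G) / 2) :
    F.Finite ∧ (F.ncard : ℝ) ≤ (14 * d * (16 * d)) ^ d := by
  have hd1 : (1 : ℝ) ≤ d := by exact_mod_cast hd
  set ρ := Metric.infDist x₀ (frontier G)
  have hsize : ∀ Q ∈ F, Q.side ≤ 6 * ρ ∧ ρ ≤ 14 * d * Q.side ∧ ‖Q.center - x₀‖ ≤ 5 * d * ρ := by
    intro Q hQ
    obtain ⟨y, hy, hyx⟩ := hF Q hQ
    exact hW.comparable_of_dist_le hd (hFW hQ) hy hyx
  have hcount := finite_and_ncard_le_of_pairwiseDisjoint_carrier (hW.disjoint.subset hFW)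
    (s := ρ / (14 * d)) (by positivity) ⟨x₀, 16 * d * ρ, by positivity⟩
    (fun Q hQ => by
      rw [div_le_iff₀ (by positivity), mul_comm]
      exact (hsize Q hQ).2.1)
    (fun Q hQ => AxisCube.carrier_subset_of_norm_le (by
      obtain ⟨hside, -, hcenter⟩ := hsize Q hQ
      have hdρ : ρ ≤ d * ρ := le_mul_of_one_le_left hx₀.le hd1
      simp only
      linarith))
  refine ⟨hcount.1, hcount.2.trans_eq ?_⟩
  congr 1
  field_simp

end IsWhitneyCovering

end Whitney

section Reflection

variable {d : ℕ} {D G : Set (Euc d)} {W W' : Set (AxisCube d)} {Q S : AxisCube d}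

lemma IsReflective.upper_bounds (hd : 0 < d) (hW : IsWhitneyCovering D W)
    (hW' : IsWhitneyCovering G W') (hG : frontier G = frontier D)
    (hQ : Q ∈ W') (hS : IsReflective D W Q S) :
    S.side ≤ 32 * d * Q.side ∧ ‖S.center - Q.center‖ ≤ 27 * (d : ℝ) ^ 2 * Q.side := by
  have hd1 : (1 : ℝ) ≤ d := by exact_mod_cast hd
  obtain ⟨r, hr, hdiam_r, hr4⟩ := hW'.exists_setEDist_eq hQ
  have hdiam := Q.half_side_le_diam hd
  have hs := Q.side_pos
  have hr0 : 0 ≤ r := by linarith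
  have hlt : setEDist Q.carrier S.carrier < ENNReal.ofReal (10 * Metric.diam Q.carrier) := by
    refine hS.1.2.trans_lt ?_
    rw [← hG, hr, two_mul, ← ENNReal.ofReal_add hr0 hr0]
    exact (ENNReal.ofReal_lt_ofReal_iff (by linarith)).2 (by linarith)
  obtain ⟨x, hx, y, hy, hxy⟩ := exists_dist_le_of_setEDist_lt hlt
  obtain ⟨x', hx', a, ha, hxa⟩ := hW'.exists_dist_le hd hQ
  have hS_diam := hW.diam_le_dist hS.1.1 hy (hG ▸ ha)
  have hya := dist_triangle4 y x x' a
  rw [dist_comm y x] at hya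
  have hside : S.side ≤ 32 * d * Q.side := by
    linarith [Metric.dist_le_diam_of_mem Q.isBounded_carrier hx hx', Q.diam_carrier_le,
      S.half_side_le_diam hd]
  refine ⟨hside, ?_⟩
  have hxQ := AxisCube.norm_sub_center_le hx
  have hyS := AxisCube.norm_sub_center_le hy
  rw [← dist_eq_norm] at hxQ hyS ⊢
  have hcenters := dist_triangle4 S.center y x Q.center
  rw [dist_comm S.center y, dist_comm y x] at hcenters
  have hdS : (d : ℝ) * S.side ≤ d * (32 * d * Q.side) := by gcongr
  have hdQ : (d : ℝ) * Q.side ≤ d ^ 2 * Q.side := by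
    gcongr
    exact le_self_pow₀ hd1 two_ne_zero
  linarith [Q.diam_carrier_le]

lemma IsWhitneyCovering.le_side_of_closedBall_subset (hW : IsWhitneyCovering G W) (hG : IsOpen G)
    (hd : 0 < d) (hQ : Q ∈ W) {z : Euc d} (hz : z ∈ Q.carrier) {s : ℝ}
    (hball : Metric.closedBall z s ⊆ G) : s ≤ 6 * d * Q.side := by
  obtain ⟨x, hx, b, hb, hxb⟩ := hW.exists_dist_le hd hQ
  have hzb : s < dist z b := by
    by_contra! h
    exact notMem_of_mem_frontier hG hb (hball (Metric.mem_closedBall'.2 h))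
  linarith [dist_triangle z x b, Metric.dist_le_diam_of_mem Q.isBounded_carrier hz hx,
    Q.diam_carrier_le]

lemma HasInteriorCones.exists_closedBall_subset {c r₀ : ℝ} (hcone : HasInteriorCones D c r₀)
    (hd : 0 < d) (hW' : IsWhitneyCovering G W') (hG : frontier G = frontier D) (hQ : Q ∈ W') :
    ∃ x ∈ Q.carrier, ∃ z, edist x z ≤ 2 * setEDist Q.carrier (frontier D) ∧
      Metric.closedBall z (c * min (Q.side / 4) r₀) ⊆ D := by
  obtain ⟨r, hr, hdiam_r, -⟩ := hW'.exists_setEDist_eq hQ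
  have hdiam := Q.half_side_le_diam hd
  have hs := Q.side_pos
  have hr0 : 0 < r := by linarith
  have hr₀ := hcone.height_pos
  rw [hG] at hr
  obtain ⟨x, hx, a, ha, hxa⟩ : ∃ x ∈ Q.carrier, ∃ a ∈ frontier D, dist x a ≤ 3 / 2 * r :=
    exists_dist_le_of_setEDist_lt (by
      rw [hr]
      exact (ENNReal.ofReal_lt_ofReal_iff (by positivity)).2 (by linarith))
  obtain ⟨e, he, hsub⟩ := hcone.exists_isConeAxis a ha
  set t := min (Q.side / 4) r₀
  have ht : 0 < t := by positivity
  have htr : t ≤ r / 2 := (min_le_left _ _).trans (by linarith)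
  refine ⟨x, hx, a + t • e, ?_, fun w hw => ?_⟩
  · rw [hr, edist_dist, two_mul, ← ENNReal.ofReal_add hr0.le hr0.le]
    refine ENNReal.ofReal_le_ofReal ((dist_triangle x a _).trans ?_)
    rw [dist_self_add_right, norm_smul, he, Real.norm_of_nonneg ht.le]
    linarith
  · have hw_cone := hsub a (frontier_subset_closure ha) (by simpa using hr₀.le) t ht
      (min_le_right _ _) (w - (a + t • e)) (mem_closedBall_iff_norm.1 hw)
    rwa [add_sub_cancel] at hw_cone

/- The point of the cone over `∂D` at height `ℓ(Q)` lies in an admissible cube, whose size is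
comparable to its distance from `∂D`. -/
lemma IsReflective.lower_bound {c r₀ : ℝ} (hd : 0 < d) (hD : IsOpen D)
    (hcone : HasInteriorCones D c r₀) (hW : IsWhitneyCovering D W)
    (hW' : IsWhitneyCovering G W') (hG : frontier G = frontier D)
    (hQ : Q ∈ W') (hS : IsReflective D W Q S) : c * min (Q.side / 4) r₀ ≤ 6 * d * S.side := by
  obtain ⟨x, hx, z, hxz, hball⟩ := hcone.exists_closedBall_subset hd hW' hG hQ
  have hs := Q.side_pos
  have hr₀ := hcone.height_pos
  have hc := hcone.aperture_pos
  obtain ⟨T, hT, hzT⟩ := hW.exists_mem (hball (Metric.mem_closedBall_self (by positivity)))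
  have hTS := hS.2 T ⟨hT, (setEDist_le_edist hx hzT).trans hxz⟩
  exact (hW.le_side_of_closedBall_subset hD hd hT hzT hball).trans (by gcongr)

end Reflection

section MeanDeviation

variable {d : ℕ} {f : Euc d → ℝ}

lemma meanDev_le_ofReal_iff {P : MvPolynomial (Fin d) ℝ} {Q : AxisCube d} {B : ℝ} :
    meanDev f P Q ≤ ENNReal.ofReal B ↔
      ∫⁻ x in Q.carrier, ‖f x - polyVal P x‖ₑ ≤ ENNReal.ofReal (Q.side ^ d * B) := by
  rw [meanDev, ENNReal.inv_mul_le_iff Q.volume_carrier_ne_zero Q.volume_carrier_ne_top,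
    Q.volume_carrier, ENNReal.ofReal_mul (pow_nonneg Q.side_pos.le d)]

lemma exists_meanDev_le {ω : ℝ → ℝ} {n : ℕ} {D : Set (Euc d)} {M : ℝ} {Q : AxisCube d}
    (hω : 0 < ω Q.side) (hM : zygIntSeminorm ω n D f < ENNReal.ofReal M)
    (hQ : (Q.scale 2 two_pos).carrier ⊆ D) :
    ∃ P : MvPolynomial (Fin d) ℝ, P.totalDegree ≤ n ∧
      meanDev f P Q ≤ ENNReal.ofReal (M * ω Q.side) := by
  have hosc : cubeOsc ω n f Q < ENNReal.ofReal M :=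
    (le_iSup₂ (f := fun (Q : AxisCube d) (_ : (Q.scale 2 two_pos).carrier ⊆ D) =>
      cubeOsc ω n f Q) Q hQ).trans_lt hM
  simp only [cubeOsc, iInf_lt_iff] at hosc
  obtain ⟨P, hP, hlt⟩ := hosc
  have hω₀ : ENNReal.ofReal (ω Q.side) ≠ 0 := (ENNReal.ofReal_pos.2 hω).ne'
  rw [ENNReal.ofReal_mul' hω.le, mul_comm]
  exact ⟨P, hP, (ENNReal.inv_mul_le_iff hω₀ ENNReal.ofReal_ne_top).1 hlt.le⟩

lemma exists_abs_polyVal_le_of_setLIntegral_le (d n : ℕ) :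
    ∃ C : ℝ, 0 < C ∧ ∀ (f : Euc d → ℝ) (Q : AxisCube d) (P : MvPolynomial (Fin d) ℝ) (L B : ℝ),
      AEStronglyMeasurable f (volume.restrict Q.carrier) → P.totalDegree ≤ n → 0 ≤ L → 0 ≤ B →
      ∫⁻ x in Q.carrier, ‖f x‖ₑ ≤ ENNReal.ofReal L →
      ∫⁻ x in Q.carrier, ‖f x - polyVal P x‖ₑ ≤ ENNReal.ofReal B →
      ∀ x, |polyVal P x| ≤ C * ((L + B) / Q.side ^ d) * (1 + ‖x - Q.center‖ / Q.side) ^ n := by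
  obtain ⟨C, hC, hmean⟩ := exists_abs_polyVal_le_mean d n
  refine ⟨C, hC, fun f Q P L B hf hP hL hB hfL hfB x => ?_⟩
  have hs := Q.side_pos
  refine hmean P hP Q _ (by positivity) ?_ x
  rw [ENNReal.inv_mul_le_iff Q.volume_carrier_ne_zero Q.volume_carrier_ne_top, Q.volume_carrier,
    ← ENNReal.ofReal_mul (by positivity), mul_div_cancel₀ _ (by positivity),
    ENNReal.ofReal_add hL hB]
  calc ∫⁻ x in Q.carrier, ‖polyVal P x‖ₑ
      ≤ ∫⁻ x in Q.carrier, (‖f x‖ₑ + ‖f x - polyVal P x‖ₑ) := by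
        refine lintegral_mono fun x => ?_
        simpa using enorm_sub_le (a := f x) (b := f x - polyVal P x)
    _ = (∫⁻ x in Q.carrier, ‖f x‖ₑ) + ∫⁻ x in Q.carrier, ‖f x - polyVal P x‖ₑ :=
        lintegral_add_left' hf.enorm _
    _ ≤ ENNReal.ofReal L + ENNReal.ofReal B := add_le_add hfL hfB

lemma setLIntegral_le_of_meanDev_le {E Q : AxisCube d} {P : MvPolynomial (Fin d) ℝ} {B K : ℝ}
    (hE : E.carrier ⊆ Q.carrier) (hK : Q.side ≤ K * E.side) (hB : 0 ≤ B)
    (h : meanDev f P Q ≤ ENNReal.ofReal B) :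
    ∫⁻ x in E.carrier, ‖f x - polyVal P x‖ₑ ≤ ENNReal.ofReal (E.side ^ d * (K ^ d * B)) := by
  refine (lintegral_mono_set hE).trans ((meanDev_le_ofReal_iff.1 h).trans ?_)
  have hpow := pow_le_pow_left₀ Q.side_pos.le hK d
  rw [mul_pow] at hpow
  refine ENNReal.ofReal_le_ofReal ((mul_le_mul_of_nonneg_right hpow hB).trans_eq ?_)
  ring

/- Both polynomials approximate `f` on the half-size cube `E` concentric with `Q`, which lies in
both cubes. -/
lemma exists_polyVal_sub_le (d n : ℕ) {K : ℝ} (hK : 0 ≤ K) :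
    ∃ C : ℝ, 0 ≤ C ∧ ∀ (f : Euc d → ℝ) (Q Q' : AxisCube d) (P P' : MvPolynomial (Fin d) ℝ) (B : ℝ),
      AEStronglyMeasurable f (volume.restrict Q.carrier) →
      ‖Q.center - Q'.center‖ ≤ Q.side / 4 → Q.side ≤ Q'.side → Q'.side ≤ K * Q.side →
      P.totalDegree ≤ n → P'.totalDegree ≤ n → 0 ≤ B →
      meanDev f P Q ≤ ENNReal.ofReal B → meanDev f P' Q' ≤ ENNReal.ofReal B →
      ∀ x, ‖x - Q.center‖ ≤ K * Q.side → |polyVal P x - polyVal P' x| ≤ C * B := by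
  obtain ⟨C, hC, hbound⟩ := exists_abs_polyVal_le_of_setLIntegral_le d n
  refine ⟨C * (2 * (2 * K) ^ d * (1 + 2 * K) ^ n), by positivity, ?_⟩
  intro f Q Q' P P' B hf hcenter hle hside hP hP' hB hPB hPB' x hx
  have hs := Q.side_pos
  set E : AxisCube d := ⟨Q.center, Q.side / 2, half_pos hs⟩ with hE
  have hEQ : E.carrier ⊆ Q.carrier := AxisCube.carrier_subset_of_norm_le (by
    simp only [hE, sub_self, norm_zero]
    linarith)
  have hEQ' : E.carrier ⊆ Q'.carrier := AxisCube.carrier_subset_of_norm_le (by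
    simp only [hE]
    linarith)
  have hPE := setLIntegral_le_of_meanDev_le (K := 2 * K) hEQ
    (by simp only [hE]; linarith) hB hPB
  have hPE' := setLIntegral_le_of_meanDev_le (K := 2 * K) hEQ'
    (by simp only [hE]; linarith) hB hPB'
  have hsub : ∀ y, f y - polyVal P' y - polyVal (P - P') y = f y - polyVal P y := fun y => by
    rw [polyVal_sub]
    ring
  simp only [← hsub] at hPE
  have hxE := hbound (fun y => f y - polyVal P' y) E (P - P') _ _
    ((hf.mono_set hEQ).sub (continuous_polyVal P').aestronglyMeasurable)
    (totalDegree_sub_le_of_le hP hP') (by positivity) (by positivity) hPE' hPE x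
  have hdist : ‖x - E.center‖ / E.side ≤ 2 * K := by
    rw [div_le_iff₀ E.side_pos]
    simp only [hE]
    linarith
  rw [polyVal_sub, ← two_mul, mul_div_assoc, mul_div_cancel_left₀ _ (by positivity)] at hxE
  calc |polyVal P x - polyVal P' x|
      ≤ C * (2 * ((2 * K) ^ d * B)) * (1 + ‖x - E.center‖ / E.side) ^ n := hxE
    _ ≤ C * (2 * ((2 * K) ^ d * B)) * (1 + 2 * K) ^ n := by
        have := E.side_pos
        gcongr
    _ = C * (2 * (2 * K) ^ d * (1 + 2 * K) ^ n) * B := by ring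

end MeanDeviation

section Chains

variable {d n : ℕ} {D : Set (Euc d)} {ω : ℝ → ℝ} {Cω r c r₀ κ : ℝ} {a e : Euc d}

/-- The cube of side `κ s` centred on the axis, of direction `e`, of the cone with vertex `w`, at
height `s`. Near best polynomials are compared along sequences of such cubes. -/
def coneCube (w e : Euc d) {κ s : ℝ} (hκ : 0 < κ) (hs : 0 < s) : AxisCube d :=
  ⟨w + s • e, κ * s, mul_pos hκ hs⟩

namespace AxisCube

lemma mem_of_scale_two_subset {T : AxisCube d} (hT : (T.scale 2 two_pos).carrier ⊆ D) {y : Euc d}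
    (hy : ‖y - T.center‖ < T.side) : y ∈ D := by
  refine hT (mem_carrier_of_norm_lt ?_)
  simpa only [scale, mul_div_cancel_left₀ _ (two_ne_zero' ℝ)] using hy

lemma aestronglyMeasurable_of_scale_two_subset {f : Euc d → ℝ} {T : AxisCube d}
    (hf : AEStronglyMeasurable f (volume.restrict D)) (hT : (T.scale 2 two_pos).carrier ⊆ D) :
    AEStronglyMeasurable f (volume.restrict T.carrier) :=
  hf.mono_set ((T.carrier_subset_scale two_pos one_le_two).trans hT)

end AxisCube

lemma norm_sub_le_of_mem_scale_two_coneCube {w y : Euc d} {s : ℝ} (hκ : 0 < κ)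
    (hκc : 4 * d * κ ≤ c) (hs : 0 < s) (hy : y ∈ ((coneCube w e hκ hs).scale 2 two_pos).carrier) :
    ‖y - (w + s • e)‖ ≤ c * s / 4 := by
  have hyc := AxisCube.norm_sub_center_le hy
  simp only [AxisCube.scale, coneCube] at hyc
  have hκs := mul_le_mul_of_nonneg_right hκc hs.le
  linarith

namespace IsConeAxis

lemma scale_two_coneCube_subset_of_scale_two_subset (h : IsConeAxis D c r₀ a e) (hc : c ≤ 1)
    (hκ : 0 < κ) (hκc : 4 * d * κ ≤ c) {T : AxisCube d} (hT : (T.scale 2 two_pos).carrier ⊆ D)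
    (hTa : ‖T.center - a‖ ≤ r₀) {s : ℝ} (hs : 0 < s) (hTs : T.side ≤ s) (hsr : s ≤ r₀) :
    ((coneCube (T.center - T.side • e) e hκ hs).scale 2 two_pos).carrier ⊆ D := by
  intro y hy
  have hside := T.side_pos
  set t := s - T.side with ht
  have hc₀ : 0 ≤ c := le_trans (by positivity) hκc
  have hv := norm_sub_le_of_mem_scale_two_coneCube hκ hκc hs hy
  rw [show T.center - T.side • e + s • e = T.center + t • e by rw [ht]; module] at hv
  have hcs : c * s ≤ s := mul_le_of_le_one_left hs.le hc
  rcases le_or_gt t (T.side / 2) with hlow | hhigh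
  · refine AxisCube.mem_of_scale_two_subset hT ?_
    have hdecomp : y - T.center = t • e + (y - (T.center + t • e)) := by abel
    rw [hdecomp]
    refine (norm_add_le _ _).trans_lt ?_
    rw [norm_smul, h.norm_eq_one, Real.norm_of_nonneg (sub_nonneg.2 hTs)]
    linarith
  · have hcenter : T.center ∈ D :=
      AxisCube.mem_of_scale_two_subset hT (by simpa using hside)
    have hct : c * s ≤ c * (4 * t) := mul_le_mul_of_nonneg_left (by linarith) hc₀
    have hy_cone := h.add_mem T.center (subset_closure hcenter) hTa t (by linarith) (by linarith)
      (y - (T.center + t • e)) (by linarith)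
    rwa [add_sub_cancel] at hy_cone

lemma scale_two_coneCube_subset (h : IsConeAxis D c r₀ a e) (ha : a ∈ frontier D) (hκ : 0 < κ)
    (hκc : 4 * d * κ ≤ c) {s : ℝ} (hs : 0 < s) (hsr : s ≤ r₀) :
    ((coneCube a e hκ hs).scale 2 two_pos).carrier ⊆ D := by
  intro y hy
  have hv := norm_sub_le_of_mem_scale_two_coneCube hκ hκc hs hy
  have hcs : 0 ≤ c * s := mul_nonneg (le_trans (by positivity) hκc) hs.le
  have hy_cone := h.add_mem a (frontier_subset_closure ha) (by simpa using (hs.trans_le hsr).le)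
    s hs hsr (y - (a + s • e)) (by linarith)
  rwa [add_sub_cancel] at hy_cone

end IsConeAxis

lemma exists_polyVal_sub_le_coneCube (d n : ℕ) (hκ : 0 < κ) (hκ1 : κ ≤ 1) {K : ℝ} (hK : 1 ≤ K) :
    ∃ C : ℝ, 0 ≤ C ∧ ∀ (f : Euc d → ℝ) (w w' e x : Euc d) (s s' : ℝ) (hs : 0 < s) (hs' : 0 < s'),
      AEStronglyMeasurable f (volume.restrict (coneCube w e hκ hs).carrier) → ‖e‖ = 1 →
      ‖w - w'‖ ≤ κ / 8 * s → s ≤ s' → s' ≤ (1 + κ / 8) * s → ‖x - (w + s • e)‖ ≤ K * s →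
      ∀ (P P' : MvPolynomial (Fin d) ℝ) (B : ℝ), P.totalDegree ≤ n → P'.totalDegree ≤ n → 0 ≤ B →
        meanDev f P (coneCube w e hκ hs) ≤ ENNReal.ofReal B →
        meanDev f P' (coneCube w' e hκ hs') ≤ ENNReal.ofReal B →
        |polyVal P x - polyVal P' x| ≤ C * B := by
  obtain ⟨C, hC, hcompare⟩ := exists_polyVal_sub_le d n (K := 2 * K / κ) (by positivity)
  refine ⟨C, hC, ?_⟩
  intro f w w' e x s s' hs hs' hf he hw hss' hs's hx P P' B hP hP' hB hPB hPB'
  have hscale : 2 * K / κ * (κ * s) = 2 * (K * s) := by field_simp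
  have hKs : s ≤ K * s := le_mul_of_one_le_left hs.le hK
  have hκs' : κ * s' ≤ s' := mul_le_of_le_one_left hs'.le hκ1
  have hκs : κ * s ≤ s := mul_le_of_le_one_left hs.le hκ1
  refine hcompare f (coneCube w e hκ hs) (coneCube w' e hκ hs') P P' B hf ?_ ?_ ?_ hP hP' hB
    hPB hPB' x ?_ <;> simp only [coneCube]
  · have hdecomp : w + s • e - (w' + s' • e) = (w - w') - (s' - s) • e := by module
    rw [hdecomp]
    refine (norm_sub_le _ _).trans ?_
    rw [norm_smul, he, Real.norm_of_nonneg (sub_nonneg.2 hss')]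
    linarith
  · gcongr
  · rw [hscale]
    linarith
  · rw [hscale]
    linarith [norm_nonneg (x - (w + s • e))]

lemma exists_meanDev_coneCube_le {f : Euc d → ℝ} {M : ℝ} (hω : ModulusBounds ω n Cω r)
    (hκ : 0 < κ) (hκ1 : κ ≤ 1) (hM : 0 ≤ M) (hfM : zygIntSeminorm ω n D f < ENNReal.ofReal M)
    {w : Euc d} {s : ℝ} (hs : 0 < s)
    (hD : ((coneCube w e hκ hs).scale 2 two_pos).carrier ⊆ D) :
    ∃ P : MvPolynomial (Fin d) ℝ, P.totalDegree ≤ n ∧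
      meanDev f P (coneCube w e hκ hs) ≤ ENNReal.ofReal (M * ω s) := by
  have hκs : 0 < κ * s := mul_pos hκ hs
  obtain ⟨P, hP, hmean⟩ := exists_meanDev_le (hω.pos _ hκs) hfM hD
  exact ⟨P, hP, hmean.trans (ENNReal.ofReal_le_ofReal (mul_le_mul_of_nonneg_left
    (hω.mono _ _ hκs.le (mul_le_of_le_one_left hs.le hκ1)) hM))⟩

lemma exists_dist_polyVal_le_coneCube (hω : ModulusBounds ω n Cω r) (hκ : 0 < κ) (hκ1 : κ ≤ 1)
    {K : ℝ} (hK : 1 ≤ K) :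
    ∃ C : ℝ, 0 ≤ C ∧ ∀ (f : Euc d → ℝ) (M : ℝ) (w e x : Euc d) (ℓ s s' : ℝ) (hs : 0 < s)
      (hs' : 0 < s'), 0 ≤ M →
      AEStronglyMeasurable f (volume.restrict (coneCube w e hκ hs).carrier) → ‖e‖ = 1 →
      ‖x - (w + ℓ • e)‖ ≤ K * ℓ → ℓ ≤ s → s ≤ s' → s' ≤ (1 + κ / 8) * s →
      ∀ P P' : MvPolynomial (Fin d) ℝ, P.totalDegree ≤ n → P'.totalDegree ≤ n →
        meanDev f P (coneCube w e hκ hs) ≤ ENNReal.ofReal (M * ω s) →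
        meanDev f P' (coneCube w e hκ hs') ≤ ENNReal.ofReal (M * ω s') →
        dist (polyVal P x) (polyVal P' x) ≤ C * (M * ω s') := by
  obtain ⟨C, hC, hcompare⟩ := exists_polyVal_sub_le_coneCube d n hκ hκ1 hK
  refine ⟨C, hC, ?_⟩
  intro f M w e x ℓ s s' hs hs' hM hf he hx hℓs hss' hs's P P' hP hP' hPs hPs'
  refine hcompare f w w e x s s' hs hs' hf he ?_ hss' hs's ?_ P P' _ hP hP'
    (mul_nonneg hM (hω.pos _ hs').le) (hPs.trans (ENNReal.ofReal_le_ofReal ?_)) hPs'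
  · rw [sub_self, norm_zero]
    positivity
  · rw [show x - (w + s • e) = x - (w + ℓ • e) - (s - ℓ) • e by module]
    refine (norm_sub_le _ _).trans ?_
    rw [norm_smul, he, Real.norm_of_nonneg (sub_nonneg.2 hℓs)]
    linarith [le_mul_of_one_le_left (sub_nonneg.2 hℓs) hK]
  · exact mul_le_mul_of_nonneg_left (hω.mono _ _ hs.le hss') hM

lemma exists_dist_polyVal_le_sum (hω : ModulusBounds ω n Cω r) (hκ : 0 < κ) (hκ1 : κ ≤ 1)
    {K : ℝ} (hK : 1 ≤ K) :
    ∃ C : ℝ, 0 ≤ C ∧ ∀ (f : Euc d → ℝ) (M : ℝ) (w e x : Euc d) (ℓ : ℝ) (hℓ : 0 < ℓ)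
      (P : MvPolynomial (Fin d) ℝ), 0 ≤ M → AEStronglyMeasurable f (volume.restrict D) →
      zygIntSeminorm ω n D f < ENNReal.ofReal M → ‖e‖ = 1 → ‖x - (w + ℓ • e)‖ ≤ K * ℓ →
      P.totalDegree ≤ n → meanDev f P (coneCube w e hκ hℓ) ≤ ENNReal.ofReal (M * ω ℓ) →
      ∀ (J : ℕ) (S : ℝ) (hS : 0 < S) (P' : MvPolynomial (Fin d) ℝ),
        (1 + κ / 8) ^ J * ℓ ≤ S → S ≤ (1 + κ / 8) ^ (J + 1) * ℓ →
        (∀ s (hs : 0 < s), ℓ ≤ s → s ≤ S →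
          ((coneCube w e hκ hs).scale 2 two_pos).carrier ⊆ D) →
        P'.totalDegree ≤ n → meanDev f P' (coneCube w e hκ hS) ≤ ENNReal.ofReal (M * ω S) →
        dist (polyVal P x) (polyVal P' x) ≤
          C * M * (∑ j ∈ Finset.range J, ω ((1 + κ / 8) ^ (j + 1) * ℓ) + ω S) := by
  obtain ⟨C, hC, hlink⟩ := exists_dist_polyVal_le_coneCube (d := d) hω hκ hκ1 hK
  refine ⟨C, hC, fun f M w e x ℓ hℓ P hM hf hfM he hx hP hPℓ J => ?_⟩
  induction J with
  | zero =>
    intro S hS P' hℓS hSℓ hD hP' hPS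
    rw [pow_zero, one_mul] at hℓS
    rw [zero_add, pow_one] at hSℓ
    rw [Finset.sum_range_zero, zero_add, mul_assoc]
    exact hlink f M w e x ℓ ℓ S hℓ hS hM
      (AxisCube.aestronglyMeasurable_of_scale_two_subset hf (hD ℓ hℓ le_rfl hℓS)) he hx le_rfl hℓS
      hSℓ P P' hP hP' hPℓ hPS
  | succ J ih =>
    intro S hS P' hsS hSs hD hP' hPS
    set s := (1 + κ / 8) ^ (J + 1) * ℓ with hs_def
    have hs : 0 < s := by positivity
    have hℓs : ℓ ≤ s := le_mul_of_one_le_left hℓ.le (one_le_pow₀ (by linarith))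
    obtain ⟨p, hp, hps⟩ :=
      exists_meanDev_coneCube_le hω hκ hκ1 hM hfM hs (hD s hs hℓs hsS)
    have hPp := ih s hs p
      (mul_le_mul_of_nonneg_right (pow_le_pow_right₀ (by linarith) J.le_succ) hℓ.le) le_rfl
      (fun t ht hℓt hts => hD t ht hℓt (hts.trans hsS)) hp hps
    have hpP' := hlink f M w e x ℓ s S hs hS hM
      (AxisCube.aestronglyMeasurable_of_scale_two_subset hf (hD s hs hℓs hsS)) he hx hℓs hsS
      (by rwa [hs_def, ← mul_assoc, ← pow_succ']) p P' hp hP' hps hPS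
    rw [Finset.sum_range_succ]
    linarith [dist_triangle (polyVal P x) (polyVal p x) (polyVal P' x)]

/- The sides of the cubes grow geometrically, so the errors sum up to `O(ω(S))`. -/
lemma exists_polyVal_sub_le_along_axis (hω : ModulusBounds ω n Cω r) (hκ : 0 < κ) (hκ1 : κ ≤ 1)
    {K : ℝ} (hK : 1 ≤ K) :
    ∃ C : ℝ, 0 ≤ C ∧ ∀ (f : Euc d → ℝ) (M : ℝ) (w e x : Euc d) (ℓ S : ℝ) (hℓ : 0 < ℓ) (hS : 0 < S),
      0 ≤ M → AEStronglyMeasurable f (volume.restrict D) →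
      zygIntSeminorm ω n D f < ENNReal.ofReal M → ‖e‖ = 1 → ℓ ≤ S →
      (∀ s (hs : 0 < s), ℓ ≤ s → s ≤ S → ((coneCube w e hκ hs).scale 2 two_pos).carrier ⊆ D) →
      ‖x - (w + ℓ • e)‖ ≤ K * ℓ →
      ∀ P P' : MvPolynomial (Fin d) ℝ, P.totalDegree ≤ n → P'.totalDegree ≤ n →
        meanDev f P (coneCube w e hκ hℓ) ≤ ENNReal.ofReal (M * ω ℓ) →
        meanDev f P' (coneCube w e hκ hS) ≤ ENNReal.ofReal (M * ω S) →
        |polyVal P x - polyVal P' x| ≤ C * (M * ω S) := by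
  obtain ⟨C, hC, hdist⟩ := exists_dist_polyVal_le_sum (D := D) hω hκ hκ1 hK
  have hl : 1 < 1 + κ / 8 := by linarith
  obtain ⟨A, hA, hsum⟩ := hω.exists_sum_le hl
  refine ⟨C * (A + 1), by positivity, ?_⟩
  intro f M w e x ℓ S hℓ hS hM hf hfM he hℓS hD hx P P' hP hP' hPℓ hPS
  obtain ⟨J, hJ, hJ_lt⟩ := exists_nat_pow_near ((one_le_div hℓ).2 hℓS) hl
  rw [le_div_iff₀ hℓ] at hJ
  rw [div_lt_iff₀ hℓ] at hJ_lt
  have hSJ : ω ((1 + κ / 8) ^ J * ℓ) ≤ ω S := hω.mono _ _ (by positivity) hJ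
  have hsumS : ∑ j ∈ Finset.range J, ω ((1 + κ / 8) ^ (j + 1) * ℓ) ≤ A * ω S := by
    have hle := hsum J ℓ hℓ
    rw [Finset.sum_range_succ'] at hle
    linarith [hω.pos ((1 + κ / 8) ^ 0 * ℓ) (by positivity), mul_le_mul_of_nonneg_left hSJ hA]
  calc |polyVal P x - polyVal P' x|
      ≤ C * M * (∑ j ∈ Finset.range J, ω ((1 + κ / 8) ^ (j + 1) * ℓ) + ω S) :=
        hdist f M w e x ℓ hℓ P hM hf hfM he hx hP hPℓ J S hS P' hJ hJ_lt.le hD hP' hPS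
    _ ≤ C * M * (A * ω S + ω S) := by gcongr
    _ = C * (A + 1) * (M * ω S) := by ring

lemma exists_polyVal_sub_le_coneCube_of_center_eq (d n : ℕ) (hκ : 0 < κ) (hκ1 : κ ≤ 1) {K : ℝ}
    (hK : 1 ≤ K) :
    ∃ C : ℝ, 0 ≤ C ∧ ∀ (f : Euc d → ℝ) (w e x : Euc d) (T : AxisCube d)
      (P P' : MvPolynomial (Fin d) ℝ) (B : ℝ),
      AEStronglyMeasurable f (volume.restrict (coneCube w e hκ T.side_pos).carrier) →
      w + T.side • e = T.center → ‖x - T.center‖ ≤ K * T.side → P.totalDegree ≤ n →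
      P'.totalDegree ≤ n → 0 ≤ B → meanDev f P T ≤ ENNReal.ofReal B →
      meanDev f P' (coneCube w e hκ T.side_pos) ≤ ENNReal.ofReal B →
      |polyVal P x - polyVal P' x| ≤ C * B := by
  obtain ⟨C, hC, hcompare⟩ := exists_polyVal_sub_le d n (K := K / κ) (by positivity)
  refine ⟨C, hC, fun f w e x T P P' B hf hwT hx hP hP' hB hPB hPB' => ?_⟩
  have hT := T.side_pos
  have hKκ : K / κ * (κ * T.side) = K * T.side := by field_simp
  rw [abs_sub_comm]
  refine hcompare f (coneCube w e hκ hT) T P' P B hf ?_ ?_ ?_ hP' hP hB hPB' hPB x ?_ <;>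
    simp only [coneCube, hwT, hKκ]
  · rw [sub_self, norm_zero]
    positivity
  · exact mul_le_of_le_one_left hT.le hκ1
  · exact le_mul_of_one_le_left hT.le hK
  · exact hx

lemma exists_polyVal_sub_le_coneCube_above (hω : ModulusBounds ω n Cω r) (hc : c ≤ 1) (hκ : 0 < κ)
    (hκ1 : κ ≤ 1) (hκc : 4 * d * κ ≤ c) {K C₁ : ℝ} (hK : 1 ≤ K) (hC₁ : 0 ≤ C₁) :
    ∃ C : ℝ, 0 ≤ C ∧ ∀ (f : Euc d → ℝ) (M : ℝ) (a e x : Euc d) (h : ℝ) (hh : 0 < h)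
      (T : AxisCube d) (P P' : MvPolynomial (Fin d) ℝ), 0 ≤ M →
      AEStronglyMeasurable f (volume.restrict D) →
      zygIntSeminorm ω n D f < ENNReal.ofReal M → IsConeAxis D c r₀ a e → h ≤ r₀ →
      (T.scale 2 two_pos).carrier ⊆ D → ‖T.center - a‖ ≤ r₀ → T.side ≤ h →
      ‖x - T.center‖ ≤ K * T.side → P.totalDegree ≤ n → P'.totalDegree ≤ n →
      meanDev f P T ≤ ENNReal.ofReal (C₁ * (M * ω T.side)) →
      meanDev f P' (coneCube (T.center - T.side • e) e hκ hh) ≤ ENNReal.ofReal (M * ω h) →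
      |polyVal P x - polyVal P' x| ≤ C * (M * ω h) := by
  obtain ⟨C_T, hC_T, hnear⟩ := exists_polyVal_sub_le_coneCube_of_center_eq d n hκ hκ1 hK
  obtain ⟨C_w, hC_w, haxis⟩ := exists_polyVal_sub_le_along_axis (d := d) (D := D) hω hκ hκ1 hK
  refine ⟨C_T * (C₁ + 1) + C_w, by positivity, ?_⟩
  intro f M a e x h hh T P P' hM hf hfM haxe hhr hT hTa hTh hx hP hP' hPT hPh
  have hℓ := T.side_pos
  have hMω : 0 ≤ M * ω T.side := mul_nonneg hM (hω.pos _ hℓ).le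
  have hMωh : M * ω T.side ≤ M * ω h := mul_le_mul_of_nonneg_left (hω.mono _ _ hℓ.le hTh) hM
  set w := T.center - T.side • e
  have hwT : w + T.side • e = T.center := sub_add_cancel _ _
  have hD : ∀ s (hs : 0 < s), T.side ≤ s → s ≤ h →
      ((coneCube w e hκ hs).scale 2 two_pos).carrier ⊆ D := fun s hs hTs hsh =>
    haxe.scale_two_coneCube_subset_of_scale_two_subset hc hκ hκc hT hTa hs hTs (hsh.trans hhr)
  obtain ⟨p, hp, hpℓ⟩ := exists_meanDev_coneCube_le hω hκ hκ1 hM hfM hℓ (hD _ hℓ le_rfl hTh)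
  have hPp : |polyVal P x - polyVal p x| ≤ C_T * ((C₁ + 1) * (M * ω T.side)) :=
    hnear f w e x T P p _
      (AxisCube.aestronglyMeasurable_of_scale_two_subset hf (hD _ hℓ le_rfl hTh)) hwT hx hP hp
      (by positivity) (hPT.trans (ENNReal.ofReal_le_ofReal (by linarith)))
      (hpℓ.trans (ENNReal.ofReal_le_ofReal (by linarith [mul_nonneg hC₁ hMω])))
  have hpP' := haxis f M w e x T.side h hℓ hh hM hf hfM haxe.norm_eq_one hTh hD
    (by rwa [hwT]) p P' hp hP' hpℓ hPh
  calc |polyVal P x - polyVal P' x|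
      ≤ |polyVal P x - polyVal p x| + |polyVal p x - polyVal P' x| := abs_sub_le _ _ _
    _ ≤ C_T * ((C₁ + 1) * (M * ω h)) + C_w * (M * ω h) := by
        refine add_le_add (hPp.trans ?_) hpP'
        gcongr
    _ = (C_T * (C₁ + 1) + C_w) * (M * ω h) := by ring

lemma exists_polyVal_sub_le_of_cube_near_vertex (hω : ModulusBounds ω n Cω r) (hc : c ≤ 1)
    (hκ : 0 < κ) (hκ1 : κ ≤ 1) (hκc : 4 * d * κ ≤ c) {K C₁ : ℝ} (hK : 1 ≤ K) (hC₁ : 0 ≤ C₁) :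
    ∃ C : ℝ, 0 ≤ C ∧ ∀ (f : Euc d → ℝ) (M : ℝ) (a e x : Euc d) (h : ℝ) (hh : 0 < h)
      (T : AxisCube d) (P P' : MvPolynomial (Fin d) ℝ), 0 ≤ M →
      AEStronglyMeasurable f (volume.restrict D) →
      zygIntSeminorm ω n D f < ENNReal.ofReal M → IsConeAxis D c r₀ a e → h ≤ r₀ →
      (T.scale 2 two_pos).carrier ⊆ D → ‖T.center - a‖ + T.side ≤ κ / 16 * h →
      ‖x - T.center‖ ≤ K * T.side → P.totalDegree ≤ n → P'.totalDegree ≤ n →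
      meanDev f P T ≤ ENNReal.ofReal (C₁ * (M * ω T.side)) →
      meanDev f P' (coneCube a e hκ hh) ≤ ENNReal.ofReal (M * ω h) →
      |polyVal P x - polyVal P' x| ≤ C * (M * ω h) := by
  obtain ⟨C_w, hC_w, habove⟩ := exists_polyVal_sub_le_coneCube_above (d := d) (D := D) (r₀ := r₀)
    hω hc hκ hκ1 hκc hK hC₁
  obtain ⟨C_a, hC_a, hvertex⟩ := exists_polyVal_sub_le_coneCube d n hκ hκ1 (K := K + 1)
    (by linarith)
  refine ⟨C_w + C_a, by positivity, ?_⟩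
  intro f M a e x h hh T P P' hM hf hfM haxe hhr hT hTa hx hP hP' hPT hPh
  have hℓ := T.side_pos
  have hκh : κ / 16 * h ≤ h := mul_le_of_le_one_left hh.le (by linarith)
  have hκh_pos : 0 < κ * h := mul_pos hκ hh
  have hℓh : T.side ≤ h := by linarith [norm_nonneg (T.center - a)]
  have hTr : ‖T.center - a‖ ≤ r₀ := by linarith
  set w := T.center - T.side • e with hw
  have hD : ((coneCube w e hκ hh).scale 2 two_pos).carrier ⊆ D :=
    haxe.scale_two_coneCube_subset_of_scale_two_subset hc hκ hκc hT hTr hh hℓh hhr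
  obtain ⟨q, hq, hqh⟩ := exists_meanDev_coneCube_le hω hκ hκ1 hM hfM hh hD
  have hPq := habove f M a e x h hh T P q hM hf hfM haxe hhr hT hTr hℓh hx hP hq hPT hqh
  have hwa : ‖w - a‖ ≤ κ / 8 * h := by
    rw [hw, sub_right_comm]
    refine (norm_sub_le _ _).trans ?_
    rw [norm_smul, haxe.norm_eq_one, Real.norm_of_nonneg hℓ.le]
    linarith
  have hxw : ‖x - (w + h • e)‖ ≤ (K + 1) * h := by
    rw [show x - (w + h • e) = (x - T.center) - (h - T.side) • e by rw [hw]; module]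
    refine (norm_sub_le _ _).trans ?_
    rw [norm_smul, haxe.norm_eq_one, Real.norm_of_nonneg (sub_nonneg.2 hℓh)]
    linarith [mul_le_mul_of_nonneg_left hℓh (zero_le_one.trans hK)]
  have hqP' := hvertex f w a e x h h hh hh
    (AxisCube.aestronglyMeasurable_of_scale_two_subset hf hD) haxe.norm_eq_one hwa le_rfl
    (by linarith) hxw q P' _ hq hP' (mul_nonneg hM (hω.pos _ hh).le) hqh hPh
  rw [add_mul]
  exact (abs_sub_le _ _ _).trans (add_le_add hPq hqP')

end Chains

section Setup

/-- The geometric data of the Whitney extension of functions on `D`, with interior cones of aperture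
`c` and height `r₀`, and with the growth constants of the modulus of continuity. -/
structure ExtensionSetup {d : ℕ} (D : Set (Euc d)) (W W' : Set (AxisCube d))
    (ψ : AxisCube d → Euc d → ℝ) (refl : AxisCube d → AxisCube d) (ω : ℝ → ℝ) (n : ℕ)
    (R c r₀ Cω r : ℝ) : Prop where
  dim_pos : 0 < d
  isOpen : IsOpen D
  nonempty : D.Nonempty
  bounded : Bornology.IsBounded D
  cones : HasInteriorCones D c r₀
  R_pos : 0 < R
  modulus : ModulusBounds ω n Cω r
  whitney : IsWhitneyCovering D W
  whitney' : IsWhitneyCovering (closure D)ᶜ W'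
  partition : IsWhitneyPartition (closure D)ᶜ W' ψ
  reflective : ∀ Q ∈ W', Q.side ≤ R → IsReflective D W Q (refl Q)

/-- A function `f` on `D` with interior seminorm less than `M`, and polynomials of near best
approximation on the reflective cubes. The strict bound `M` replaces the seminorm, which may vanish,
so that polynomials realizing it exist on every cube. -/
structure ExtensionData {d : ℕ} (D : Set (Euc d)) (W' : Set (AxisCube d))
    (refl : AxisCube d → AxisCube d) (ω : ℝ → ℝ) (n : ℕ) (R : ℝ) (C₀ : ℝ≥0) (f : Euc d → ℝ)
    (P : AxisCube d → MvPolynomial (Fin d) ℝ) (M : ℝ) : Prop where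
  nonneg : 0 ≤ M
  meas : AEStronglyMeasurable f (volume.restrict D)
  seminorm_lt : zygIntSeminorm ω n D f < ENNReal.ofReal M
  degree : ∀ Q ∈ W', Q.side ≤ R → (P (refl Q)).totalDegree ≤ n
  near : ∀ Q ∈ W', Q.side ≤ R →
    meanDev f (P (refl Q)) (refl Q) ≤ ENNReal.ofReal (C₀ * (M * ω (refl Q).side))

variable {d n : ℕ} {D : Set (Euc d)} {W W' : Set (AxisCube d)}
  {ψ : AxisCube d → Euc d → ℝ} {refl : AxisCube d → AxisCube d} {ω : ℝ → ℝ}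
  {R c r₀ Cω r : ℝ} {C₀ : ℝ≥0} {f : Euc d → ℝ} {P : AxisCube d → MvPolynomial (Fin d) ℝ} {M : ℝ}

lemma IsNearBest.meanDev_le_ofReal {Q : AxisCube d} {p : MvPolynomial (Fin d) ℝ}
    (h : IsNearBest ω n D C₀ f Q p) (hM : zygIntSeminorm ω n D f ≤ ENNReal.ofReal M)
    (hω : 0 ≤ ω Q.side) :
    meanDev f p Q ≤ ENNReal.ofReal (C₀ * (M * ω Q.side)) := by
  rw [ENNReal.ofReal_mul C₀.coe_nonneg, ENNReal.ofReal_mul' hω, ENNReal.ofReal_coe_nnreal]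
  refine h.2.trans ?_
  rw [mul_assoc, mul_comm (ENNReal.ofReal _)]
  gcongr

lemma setLIntegral_le_of_meanDev_le_of_abs_sub_le {Q : AxisCube d} {p q : MvPolynomial (Fin d) ℝ}
    {A B : ℝ} (hA : 0 ≤ A) (hB : 0 ≤ B) (hq : meanDev f q Q ≤ ENNReal.ofReal A)
    (hqp : ∀ x ∈ Q.carrier, |polyVal q x - polyVal p x| ≤ B) :
    ∫⁻ x in Q.carrier, ‖f x - polyVal p x‖ₑ ≤ ENNReal.ofReal (A + B) * volume Q.carrier := by
  calc ∫⁻ x in Q.carrier, ‖f x - polyVal p x‖ₑ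
      ≤ ∫⁻ x in Q.carrier, (‖f x - polyVal q x‖ₑ + ENNReal.ofReal B) := by
        refine setLIntegral_mono' Q.measurableSet_carrier fun x hx => ?_
        rw [← sub_add_sub_cancel (f x) (polyVal q x)]
        refine (enorm_add_le _ _).trans ?_
        rw [Real.enorm_eq_ofReal_abs (polyVal q x - _)]
        gcongr
        exact hqp x hx
    _ = (∫⁻ x in Q.carrier, ‖f x - polyVal q x‖ₑ) + ENNReal.ofReal B * volume Q.carrier := by
        rw [lintegral_add_right _ measurable_const, setLIntegral_const]
    _ ≤ ENNReal.ofReal A * volume Q.carrier + ENNReal.ofReal B * volume Q.carrier := by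
        gcongr
        refine (meanDev_le_ofReal_iff.1 hq).trans_eq ?_
        rw [mul_comm, ENNReal.ofReal_mul hA, Q.volume_carrier]
    _ = ENNReal.ofReal (A + B) * volume Q.carrier := by
        rw [← add_mul, ENNReal.ofReal_add hA hB]

namespace IsWhitneyCovering

lemma setLIntegral_le_of_forall_carrier (hW : IsWhitneyCovering D W) {F : Set (AxisCube d)}
    (hF : F ⊆ W) {U : Set (Euc d)} (hU : U ⊆ ⋃ Q ∈ F, Q.carrier) {B : AxisCube d}
    (hB : ∀ Q ∈ F, Q.carrier ⊆ B.carrier) {g : Euc d → ℝ≥0∞} {b : ℝ≥0∞}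
    (hg : ∀ Q ∈ F, ∫⁻ x in Q.carrier, g x ≤ b * volume Q.carrier) :
    ∫⁻ x in U, g x ≤ b * volume B.carrier := by
  have hcount : F.Countable := hW.countable.mono hF
  have hdisj : F.PairwiseDisjoint AxisCube.carrier := hW.disjoint.subset hF
  calc ∫⁻ x in U, g x ≤ ∫⁻ x in ⋃ Q ∈ F, Q.carrier, g x := lintegral_mono_set hU
    _ = ∑' Q : F, ∫⁻ x in (Q : AxisCube d).carrier, g x :=
        lintegral_biUnion hcount (fun Q _ => Q.measurableSet_carrier) hdisj _
    _ ≤ ∑' Q : F, b * volume (Q : AxisCube d).carrier :=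
        ENNReal.tsum_le_tsum fun Q => hg Q Q.2
    _ = b * volume (⋃ Q ∈ F, Q.carrier) := by
        rw [ENNReal.tsum_mul_left, measure_biUnion hcount hdisj fun Q _ => Q.measurableSet_carrier]
    _ ≤ b * volume B.carrier := by
        gcongr
        exact iUnion₂_subset hB

lemma side_le_and_norm_sub_le_of_mem_closedBall (hW : IsWhitneyCovering D W) (hd : 0 < d)
    {Q : AxisCube d} (hQ : Q ∈ W) {x a : Euc d} {ρ : ℝ} (hx : x ∈ Q.carrier)
    (ha : a ∈ frontier D) (hxa : x ∈ Metric.closedBall a ρ) :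
    Q.side ≤ 2 * ρ ∧ ‖Q.center - a‖ ≤ (d + 1) * ρ := by
  rw [Metric.mem_closedBall] at hxa
  have hside : Q.side ≤ 2 * ρ := by
    linarith [hW.diam_le_dist hQ hx ha, Q.half_side_le_diam hd]
  refine ⟨hside, ?_⟩
  rw [← dist_eq_norm]
  calc dist Q.center a ≤ dist x Q.center + dist x a := dist_triangle_left ..
    _ ≤ d * (Q.side / 2) + ρ := by
        rw [dist_eq_norm x Q.center]
        exact add_le_add (AxisCube.norm_sub_center_le hx) hxa
    _ ≤ d * ρ + ρ := by
        gcongr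
        linarith
    _ = (d + 1) * ρ := by ring

end IsWhitneyCovering

lemma exists_abs_polyVal_le_of_meanDev_coneCube_le (d n : ℕ) {κ : ℝ} (hκ : 0 < κ) (hκ1 : κ ≤ 1) :
    ∃ C : ℝ, 0 ≤ C ∧ ∀ (f : Euc d → ℝ) (a e x : Euc d) (h : ℝ) (hh : 0 < h)
      (p : MvPolynomial (Fin d) ℝ) (L B : ℝ),
      AEStronglyMeasurable f (volume.restrict (coneCube a e hκ hh).carrier) → ‖e‖ = 1 →
      p.totalDegree ≤ n → 0 ≤ L → 0 ≤ B →
      ∫⁻ y in (coneCube a e hκ hh).carrier, ‖f y‖ₑ ≤ ENNReal.ofReal L →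
      meanDev f p (coneCube a e hκ hh) ≤ ENNReal.ofReal B → ‖x - a‖ ≤ h →
      |polyVal p x| ≤ C * (L / h ^ d + B) := by
  obtain ⟨C, hC, hbound⟩ := exists_abs_polyVal_le_of_setLIntegral_le d n
  refine ⟨C * (1 / κ ^ d) * (1 + 2 / κ) ^ n, by positivity, ?_⟩
  intro f a e x h hh p L B hf he hp hL hB hfL hpB hx
  set Q := coneCube a e hκ hh
  have hQ : Q.side = κ * h := rfl
  have hxQ : ‖x - Q.center‖ ≤ 2 * h := by
    rw [show x - Q.center = (x - a) - h • e from (sub_sub _ _ _).symm]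
    refine (norm_sub_le _ _).trans ?_
    rw [norm_smul, he, Real.norm_of_nonneg hh.le]
    linarith
  have hratio : ‖x - Q.center‖ / Q.side ≤ 2 / κ := by
    rw [hQ, div_le_div_iff₀ (by positivity) hκ]
    nlinarith
  have hmean : (L + Q.side ^ d * B) / Q.side ^ d ≤ 1 / κ ^ d * (L / h ^ d + B) := by
    have hκB : B ≤ 1 / κ ^ d * B :=
      le_mul_of_one_le_left hB (one_le_one_div (by positivity) (pow_le_one₀ hκ.le hκ1))
    rw [add_div, mul_div_cancel_left₀ _ (pow_pos Q.side_pos d).ne', hQ, mul_pow, mul_add,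
      div_mul_div_comm, one_mul]
    exact add_le_add_right hκB _
  have hside := Q.side_pos
  calc |polyVal p x|
      ≤ C * ((L + Q.side ^ d * B) / Q.side ^ d) * (1 + ‖x - Q.center‖ / Q.side) ^ n :=
        hbound f Q p L _ hf hp hL (by positivity) hfL (meanDev_le_ofReal_iff.1 hpB) x
    _ ≤ C * (1 / κ ^ d * (L / h ^ d + B)) * (1 + 2 / κ) ^ n := by gcongr
    _ = C * (1 / κ ^ d) * (1 + 2 / κ) ^ n * (L / h ^ d + B) := by ring

namespace ExtensionSetup

lemma frontier_exterior (S : ExtensionSetup D W W' ψ refl ω n R c r₀ Cω r) :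
    frontier (closure D)ᶜ = frontier D := by
  rw [frontier_compl, S.cones.frontier_closure_eq S.isOpen]

lemma volume_frontier (S : ExtensionSetup D W W' ψ refl ω n R c r₀ Cω r) :
    volume (frontier D) = 0 :=
  S.cones.volume_frontier S.isOpen

lemma frontier_nonempty (S : ExtensionSetup D W W' ψ refl ω n R c r₀ Cω r) :
    (frontier D).Nonempty := by
  have : Nonempty (Fin d) := ⟨⟨0, S.dim_pos⟩⟩
  exact nonempty_frontier_iff.2 ⟨S.nonempty,
    fun h => NormedSpace.unbounded_univ ℝ (Euc d) (h ▸ S.bounded)⟩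

lemma one_le_dim (S : ExtensionSetup D W W' ψ refl ω n R c r₀ Cω r) : (1 : ℝ) ≤ d :=
  Nat.one_le_cast.2 S.dim_pos

lemma side_le_four_mul_dist (S : ExtensionSetup D W W' ψ refl ω n R c r₀ Cω r) {Q : AxisCube d}
    (hQ : Q ∈ W') {y a : Euc d} (hy : y ∈ (Q.scale (5 / 4) (by norm_num)).carrier)
    (ha : a ∈ frontier D) : Q.side ≤ 4 * dist y a := by
  have hinf := (S.whitney'.infDist_bounds S.dim_pos hQ hy).1
  rw [S.frontier_exterior] at hinf
  linarith [Metric.infDist_le_dist_of_mem (x := y) ha]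

lemma exists_lintegral_near_vertex_le (S : ExtensionSetup D W W' ψ refl ω n R c r₀ Cω r)
    {κ η : ℝ} (hκ : 0 < κ) (hκ1 : κ ≤ 1) (hκc : 4 * d * κ ≤ c) (hηκ : (d + 3) * η ≤ κ / 16) :
    ∃ C : ℝ, 0 ≤ C ∧ ∀ (f : Euc d → ℝ) (M : ℝ) (a e : Euc d) (h : ℝ) (hh : 0 < h)
      (p : MvPolynomial (Fin d) ℝ), 0 ≤ M → AEStronglyMeasurable f (volume.restrict D) →
      zygIntSeminorm ω n D f < ENNReal.ofReal M → a ∈ frontier D → IsConeAxis D c r₀ a e →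
      h ≤ r₀ → p.totalDegree ≤ n → meanDev f p (coneCube a e hκ hh) ≤ ENNReal.ofReal (M * ω h) →
      ∫⁻ x in D ∩ Metric.closedBall a (η * h), ‖f x - polyVal p x‖ₑ ≤
        ENNReal.ofReal (C * (M * ω h) * h ^ d) := by
  have hd := S.one_le_dim
  obtain ⟨C, hC, hnear⟩ := exists_polyVal_sub_le_of_cube_near_vertex (D := D) (r₀ := r₀)
    S.modulus S.cones.aperture_le_one hκ hκ1 hκc hd zero_le_one
  refine ⟨1 + C, by positivity, ?_⟩
  intro f M a e h hh p hM hf hfM ha haxe hhr hp hph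
  have hMω : 0 ≤ M * ω h := mul_nonneg hM (S.modulus.pos h hh).le
  have hηh : (d + 3) * (η * h) ≤ κ / 16 * h := by
    rw [← mul_assoc]
    exact mul_le_mul_of_nonneg_right hηκ hh.le
  have hκh : κ / 16 * h ≤ h / 16 := by nlinarith
  set F : Set (AxisCube d) := {Q ∈ W | (Q.carrier ∩ Metric.closedBall a (η * h)).Nonempty}
  have hgeo : ∀ Q ∈ F, ‖Q.center - a‖ + Q.side ≤ κ / 16 * h := fun Q ⟨hQ, x, hxQ, hxa⟩ => by
    linarith [S.whitney.side_le_and_norm_sub_le_of_mem_closedBall S.dim_pos hQ hxQ ha hxa]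
  have hside : ∀ Q ∈ F, Q.side ≤ h := fun Q hQ => by
    linarith [hgeo Q hQ, norm_nonneg (Q.center - a)]
  have hcover : D ∩ Metric.closedBall a (η * h) ⊆ ⋃ Q ∈ F, Q.carrier := by
    rintro x ⟨hxD, hxa⟩
    obtain ⟨Q, hQ, hxQ⟩ := S.whitney.exists_mem hxD
    exact mem_biUnion (show Q ∈ F from ⟨hQ, x, hxQ, hxa⟩) hxQ
  have hsub : ∀ Q ∈ F, Q.carrier ⊆ (⟨a, h, hh⟩ : AxisCube d).carrier := fun Q hQ =>
    AxisCube.carrier_subset_of_norm_le (by linarith [hgeo Q hQ, Q.side_pos])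
  have hcube : ∀ Q ∈ F, ∫⁻ x in Q.carrier, ‖f x - polyVal p x‖ₑ ≤
      ENNReal.ofReal (M * ω h + C * (M * ω h)) * volume Q.carrier := fun Q hQ => by
    have h2Q := S.whitney.scale_two_subset S.isOpen S.dim_pos hQ.1
    obtain ⟨q, hq, hqQ⟩ := exists_meanDev_le (S.modulus.pos _ Q.side_pos) hfM h2Q
    have hωQ : M * ω Q.side ≤ M * ω h := mul_le_mul_of_nonneg_left
      (S.modulus.mono _ _ Q.side_pos.le (hside Q hQ)) hM
    refine setLIntegral_le_of_meanDev_le_of_abs_sub_le hMω (by positivity)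
      (hqQ.trans (ENNReal.ofReal_le_ofReal hωQ)) fun x hx => ?_
    refine hnear f M a e x h hh Q q p hM hf hfM haxe hhr h2Q (hgeo Q hQ) ?_ hq hp
      (by rwa [one_mul]) hph
    nlinarith [AxisCube.norm_sub_center_le hx, Q.side_pos]
  refine (S.whitney.setLIntegral_le_of_forall_carrier (fun Q hQ => hQ.1) hcover hsub
    hcube).trans_eq ?_
  rw [AxisCube.volume_carrier, ← ENNReal.ofReal_mul (by positivity), one_add_mul]

lemma norm_refl_center_sub_add_side_le (S : ExtensionSetup D W W' ψ refl ω n R c r₀ Cω r)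
    {Q : AxisCube d} (hQ : Q ∈ W') (hQR : Q.side ≤ R) {y a : Euc d}
    (hy : y ∈ (Q.scale (5 / 4) (by norm_num)).carrier) (ha : a ∈ frontier D) :
    ‖(refl Q).center - a‖ + (refl Q).side ≤ 240 * (d : ℝ) ^ 2 * dist y a := by
  have hd := S.one_le_dim
  have hside := S.side_le_four_mul_dist hQ hy ha
  obtain ⟨hrefl_side, hrefl_center⟩ := (S.reflective Q hQ hQR).upper_bounds S.dim_pos S.whitney
    S.whitney' S.frontier_exterior hQ
  have hyQ : ‖Q.center - y‖ ≤ d * (5 / 4 * Q.side / 2) := by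
    rw [norm_sub_rev]
    exact AxisCube.norm_sub_center_le hy
  calc ‖(refl Q).center - a‖ + (refl Q).side
      ≤ ‖(refl Q).center - Q.center‖ + ‖Q.center - y‖ + ‖y - a‖ + (refl Q).side := by
        gcongr
        refine (norm_sub_le_norm_sub_add_norm_sub _ Q.center _).trans ?_
        rw [add_assoc]
        gcongr
        exact norm_sub_le_norm_sub_add_norm_sub _ _ _
    _ ≤ 27 * (d : ℝ) ^ 2 * Q.side + d * (5 / 4 * Q.side / 2) + dist y a + 32 * d * Q.side := by
        rw [dist_eq_norm]
        gcongr
    _ ≤ 27 * (d : ℝ) ^ 2 * (4 * dist y a) + d * (5 / 4 * (4 * dist y a) / 2) + dist y a +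
          32 * d * (4 * dist y a) := by gcongr
    _ = (27 * (d : ℝ) ^ 2 * 4 + d * (5 / 2) + 1 + 32 * d * 4) * dist y a := by ring
    _ ≤ 240 * (d : ℝ) ^ 2 * dist y a := by
        gcongr
        nlinarith

lemma norm_sub_refl_center_le (S : ExtensionSetup D W W' ψ refl ω n R c r₀ Cω r) {Q : AxisCube d}
    (hQ : Q ∈ W') (hQR : Q.side ≤ R) (hQr : Q.side ≤ 4 * r₀) {x : Euc d}
    (hx : ‖x - Q.center‖ ≤ 100 * (d : ℝ) ^ 2 * Q.side) :
    ‖x - (refl Q).center‖ ≤ 127 * (d : ℝ) ^ 2 * (24 * d / c) * (refl Q).side := by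
  have hc := S.cones.aperture_pos
  have hrefl := S.reflective Q hQ hQR
  have hcenter := (hrefl.upper_bounds S.dim_pos S.whitney S.whitney' S.frontier_exterior hQ).2
  have hlower := hrefl.lower_bound S.dim_pos S.isOpen S.cones S.whitney S.whitney'
    S.frontier_exterior hQ
  rw [min_eq_left (by linarith)] at hlower
  have hside : Q.side ≤ 24 * d / c * (refl Q).side := by
    rw [div_mul_eq_mul_div, le_div_iff₀ hc]
    linarith
  calc ‖x - (refl Q).center‖ ≤ ‖x - Q.center‖ + ‖Q.center - (refl Q).center‖ :=
        norm_sub_le_norm_sub_add_norm_sub _ _ _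
    _ ≤ 127 * (d : ℝ) ^ 2 * Q.side := by
        rw [norm_sub_rev Q.center]
        linarith
    _ ≤ 127 * (d : ℝ) ^ 2 * (24 * d / c * (refl Q).side) := by gcongr
    _ = 127 * (d : ℝ) ^ 2 * (24 * d / c) * (refl Q).side := by ring

lemma exists_abs_refl_sub_near_vertex_le (S : ExtensionSetup D W W' ψ refl ω n R c r₀ Cω r)
    (C₀ : ℝ≥0) {κ η : ℝ} (hκ : 0 < κ) (hκ1 : κ ≤ 1) (hκc : 4 * d * κ ≤ c)
    (hηκ : 240 * (d : ℝ) ^ 2 * η ≤ κ / 16) :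
    ∃ C : ℝ, 0 ≤ C ∧ ∀ (f : Euc d → ℝ) (P : AxisCube d → MvPolynomial (Fin d) ℝ) (M : ℝ)
      (a e : Euc d) (h : ℝ) (hh : 0 < h) (p : MvPolynomial (Fin d) ℝ),
      ExtensionData D W' refl ω n R C₀ f P M → a ∈ frontier D → IsConeAxis D c r₀ a e →
      h ≤ r₀ → p.totalDegree ≤ n → meanDev f p (coneCube a e hκ hh) ≤ ENNReal.ofReal (M * ω h) →
      ∀ Q ∈ W', Q.side ≤ R →
      ∀ y ∈ (Q.scale (5 / 4) (by norm_num)).carrier, dist y a ≤ η * h →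
      ∀ x, ‖x - Q.center‖ ≤ 100 * (d : ℝ) ^ 2 * Q.side →
        |polyVal (P (refl Q)) x - polyVal p x| ≤ C * (M * ω h) := by
  have hd := S.one_le_dim
  have hc := S.cones.aperture_pos
  have hc1 := S.cones.aperture_le_one
  have hK : 1 ≤ 127 * (d : ℝ) ^ 2 * (24 * d / c) :=
    one_le_mul_of_one_le_of_one_le (by nlinarith) ((one_le_div₀ hc).2 (by linarith))
  obtain ⟨C, hC, hnear⟩ := exists_polyVal_sub_le_of_cube_near_vertex (D := D) (r₀ := r₀)
    S.modulus hc1 hκ hκ1 hκc hK C₀.coe_nonneg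
  refine ⟨C, hC, ?_⟩
  intro f P M a e h hh p hf ha haxe hhr hp hph Q hQ hQR y hy hya x hx
  have hηh : 240 * (d : ℝ) ^ 2 * (η * h) ≤ κ / 16 * h := by
    rw [← mul_assoc]
    exact mul_le_mul_of_nonneg_right hηκ hh.le
  have hya' : 240 * (d : ℝ) ^ 2 * dist y a ≤ κ / 16 * h := by
    refine le_trans ?_ hηh
    gcongr
  have hside : Q.side ≤ 4 * r₀ := by
    have hQy := S.side_le_four_mul_dist hQ hy ha
    have hdist : dist y a ≤ 240 * (d : ℝ) ^ 2 * dist y a :=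
      le_mul_of_one_le_left dist_nonneg (by nlinarith)
    have hκh : κ / 16 * h ≤ h := mul_le_of_le_one_left hh.le (by linarith)
    linarith
  have hrefl := S.reflective Q hQ hQR
  exact hnear f M a e x h hh (refl Q) _ p hf.nonneg hf.meas hf.seminorm_lt haxe hhr
    (S.whitney.scale_two_subset S.isOpen S.dim_pos hrefl.1.1)
    ((S.norm_refl_center_sub_add_side_le hQ hQR hy ha).trans hya')
    (S.norm_sub_refl_center_le hQ hQR hside hx) (hf.degree Q hQ hQR) hp (hf.near Q hQ hQR) hph

end ExtensionSetup

/-- The polynomial `p` represents `f` and its extension near the boundary point `a` at the scale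
`h`, up to errors proportional to `B`: it is close to `f` in the mean on the part of `D` within
`η h` of `a`, and pointwise close to the polynomials of the exterior cubes meeting that ball. The
last field bounds it by the `L¹` norm of `f`. -/
structure IsBoundaryApprox (D : Set (Euc d)) (W' : Set (AxisCube d))
    (refl : AxisCube d → AxisCube d) (n : ℕ) (R : ℝ) (f : Euc d → ℝ)
    (P : AxisCube d → MvPolynomial (Fin d) ℝ) (η C B : ℝ) (a : Euc d) (h : ℝ)
    (p : MvPolynomial (Fin d) ℝ) : Prop where
  totalDegree_le : p.totalDegree ≤ n
  lintegral_le : ∫⁻ x in D ∩ Metric.closedBall a (η * h), ‖f x - polyVal p x‖ₑ ≤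
    ENNReal.ofReal (C * B * h ^ d)
  abs_refl_sub_le : ∀ Q ∈ W', Q.side ≤ R → ∀ y ∈ (Q.scale (5 / 4) (by norm_num)).carrier,
    dist y a ≤ η * h → ∀ x, ‖x - Q.center‖ ≤ 100 * (d : ℝ) ^ 2 * Q.side →
      |polyVal (P (refl Q)) x - polyVal p x| ≤ C * B
  abs_le : ∀ L : ℝ, 0 ≤ L → ∫⁻ x in D, ‖f x‖ₑ ≤ ENNReal.ofReal L → ∀ x, ‖x - a‖ ≤ h →
    |polyVal p x| ≤ C * (L / h ^ d + B)

lemma ExtensionSetup.exists_isBoundaryApprox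
    (S : ExtensionSetup D W W' ψ refl ω n R c r₀ Cω r) (C₀ : ℝ≥0) :
    ∃ η C : ℝ, 0 < η ∧ η ≤ 1 / 4 ∧ 0 ≤ C ∧ ∀ f P M,
      ExtensionData D W' refl ω n R C₀ f P M → ∀ a ∈ frontier D, ∀ h, 0 < h → h ≤ r₀ →
        ∃ p, IsBoundaryApprox D W' refl n R f P η C (M * ω h) a h p := by
  have hd := S.one_le_dim
  have hc := S.cones.aperture_pos
  obtain ⟨κ, hκ, hκ1, hκc⟩ : ∃ κ : ℝ, 0 < κ ∧ κ ≤ 1 ∧ 4 * d * κ ≤ c :=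
    ⟨c / (4 * d), by positivity, (div_le_one₀ (by positivity)).2
      (by linarith [S.cones.aperture_le_one]), (mul_div_cancel₀ _ (by positivity)).le⟩
  obtain ⟨η, hη, hηκ⟩ : ∃ η : ℝ, 0 < η ∧ 240 * (d : ℝ) ^ 2 * η = κ / 16 :=
    ⟨κ / 16 / (240 * (d : ℝ) ^ 2), by positivity, mul_div_cancel₀ _ (by positivity)⟩
  obtain ⟨C₁, hC₁, hint⟩ := S.exists_lintegral_near_vertex_le hκ hκ1 hκc (η := η)
    (hηκ ▸ mul_le_mul_of_nonneg_right (by nlinarith) hη.le)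
  obtain ⟨C₂, hC₂, hrefl⟩ := S.exists_abs_refl_sub_near_vertex_le C₀ hκ hκ1 hκc hηκ.le
  obtain ⟨C₃, hC₃, habs⟩ := exists_abs_polyVal_le_of_meanDev_coneCube_le d n hκ hκ1
  refine ⟨η, C₁ + C₂ + C₃, hη, by nlinarith, by positivity, ?_⟩
  intro f P M hf a ha h hh hhr
  have hMω : 0 ≤ M * ω h := mul_nonneg hf.nonneg (S.modulus.pos h hh).le
  obtain ⟨e, haxe⟩ := S.cones.exists_isConeAxis a ha
  have h2D := haxe.scale_two_coneCube_subset ha hκ hκc hh hhr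
  obtain ⟨p, hp, hph⟩ :=
    exists_meanDev_coneCube_le S.modulus hκ hκ1 hf.nonneg hf.seminorm_lt hh h2D
  refine ⟨p, hp, ?_, fun Q hQ hQR y hy hya x hx => ?_, fun L hL hfL x hx => ?_⟩
  · refine (hint f M a e h hh p hf.nonneg hf.meas hf.seminorm_lt ha haxe hhr hp hph).trans ?_
    gcongr
    linarith
  · refine (hrefl f P M a e h hh p hf ha haxe hhr hp hph Q hQ hQR y hy hya x hx).trans ?_
    gcongr
    linarith
  · have hQD := (AxisCube.carrier_subset_scale two_pos one_le_two _).trans h2D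
    refine (habs f a e x h hh p L _ (hf.meas.mono_set hQD) haxe.norm_eq_one hp hL hMω
      ((lintegral_mono_set hQD).trans hfL) hph hx).trans ?_
    gcongr
    linarith

end Setup

section Exterior

variable {d n : ℕ} {D : Set (Euc d)} {W W' : Set (AxisCube d)}
  {ψ : AxisCube d → Euc d → ℝ} {refl : AxisCube d → AxisCube d} {ω : ℝ → ℝ}
  {R c r₀ Cω r : ℝ} {f : Euc d → ℝ} {P : AxisCube d → MvPolynomial (Fin d) ℝ} {x₀ x : Euc d}

namespace IsWhitneyPartition

variable {G : Set (Euc d)} {Q : AxisCube d}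

lemma nonneg (h : IsWhitneyPartition G W ψ) (hQ : Q ∈ W) (x : Euc d) : 0 ≤ ψ Q x :=
  (indicator_nonneg (fun _ _ => zero_le_one) x).trans (h.lower Q hQ x)

lemma mem_of_ne_zero (h : IsWhitneyPartition G W ψ) (hQ : Q ∈ W) (hx : ψ Q x ≠ 0) :
    x ∈ (Q.scale (5 / 4) (by norm_num)).carrier := by
  by_contra hmem
  have hupper := h.upper Q hQ x
  rw [indicator_of_notMem hmem] at hupper
  exact hx (le_antisymm hupper (h.nonneg hQ x))

end IsWhitneyPartition

/-- The cubes `Q` for which `5/4 Q` meets the ball about `x₀` that reaches half way to `∂D`. Only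
these cubes contribute to the extension in that ball. -/
def nearCubes (D : Set (Euc d)) (W : Set (AxisCube d)) (x₀ : Euc d) : Set (AxisCube d) :=
  {Q ∈ W | ∃ y ∈ (Q.scale (5 / 4) (by norm_num)).carrier,
    dist y x₀ ≤ Metric.infDist x₀ (frontier D) / 2}

namespace ExtensionSetup

lemma infDist_pos (S : ExtensionSetup D W W' ψ refl ω n R c r₀ Cω r) (hx : x ∈ (closure D)ᶜ) :
    0 < Metric.infDist x (frontier D) :=
  (isClosed_frontier.notMem_iff_infDist_pos S.frontier_nonempty).1
    fun h => hx (frontier_subset_closure h)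

lemma exists_infDist_eq (S : ExtensionSetup D W W' ψ refl ω n R c r₀ Cω r) (x : Euc d) :
    ∃ a ∈ frontier D, Metric.infDist x (frontier D) = dist x a :=
  isClosed_frontier.exists_infDist_eq_dist S.frontier_nonempty x

lemma closedBall_half_infDist_subset (S : ExtensionSetup D W W' ψ refl ω n R c r₀ Cω r)
    (hx₀ : x₀ ∈ (closure D)ᶜ) :
    Metric.closedBall x₀ (Metric.infDist x₀ (frontier D) / 2) ⊆ (closure D)ᶜ := by
  refine (Metric.closedBall_subset_ball (half_lt_self (S.infDist_pos hx₀))).trans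
    (ball_subset_of_disjoint_frontier isClosed_closure.isOpen_compl hx₀ ?_)
  rw [S.frontier_exterior]
  exact Metric.disjoint_ball_infDist

lemma comparable_of_mem_nearCubes (S : ExtensionSetup D W W' ψ refl ω n R c r₀ Cω r)
    {Q : AxisCube d} (hQ : Q ∈ nearCubes D W' x₀) :
    Metric.infDist x₀ (frontier D) ≤ 14 * d * Q.side ∧
      ‖Q.center - x₀‖ ≤ 5 * d * Metric.infDist x₀ (frontier D) := by
  obtain ⟨hQW, y, hy, hyx⟩ := hQ
  rw [← S.frontier_exterior] at hyx ⊢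
  exact (S.whitney'.comparable_of_dist_le S.dim_pos hQW hy hyx).2

lemma finite_nearCubes (S : ExtensionSetup D W W' ψ refl ω n R c r₀ Cω r)
    (hx₀ : x₀ ∈ (closure D)ᶜ) : (nearCubes D W' x₀).Finite :=
  (S.whitney'.finite_near S.dim_pos (S.frontier_exterior ▸ S.infDist_pos hx₀)
    (fun _ hQ => hQ.1) (fun _ hQ => S.frontier_exterior ▸ hQ.2)).1

lemma ncard_nearCubes_le (S : ExtensionSetup D W W' ψ refl ω n R c r₀ Cω r)
    (hx₀ : x₀ ∈ (closure D)ᶜ) :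
    ((nearCubes D W' x₀).ncard : ℝ) ≤ (14 * d * (16 * d)) ^ d :=
  (S.whitney'.finite_near S.dim_pos (S.frontier_exterior ▸ S.infDist_pos hx₀)
    (fun _ hQ => hQ.1) (fun _ hQ => S.frontier_exterior ▸ hQ.2)).2

lemma norm_sub_center_le_of_mem_nearCubes (S : ExtensionSetup D W W' ψ refl ω n R c r₀ Cω r)
    {Q : AxisCube d} (hQ : Q ∈ nearCubes D W' x₀)
    (hx : ‖x - x₀‖ ≤ d * Metric.infDist x₀ (frontier D)) :
    ‖x - Q.center‖ ≤ 100 * (d : ℝ) ^ 2 * Q.side := by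
  obtain ⟨hside, hcenter⟩ := S.comparable_of_mem_nearCubes hQ
  calc ‖x - Q.center‖ ≤ ‖x - x₀‖ + ‖Q.center - x₀‖ := by
        rw [norm_sub_rev Q.center]
        exact norm_sub_le_norm_sub_add_norm_sub x x₀ Q.center
    _ ≤ 6 * d * Metric.infDist x₀ (frontier D) := by linarith
    _ ≤ 6 * d * (14 * d * Q.side) := by gcongr
    _ ≤ 100 * (d : ℝ) ^ 2 * Q.side := by nlinarith [sq_nonneg (d : ℝ), Q.side_pos]

lemma side_le_of_mem_nearCubes (S : ExtensionSetup D W W' ψ refl ω n R c r₀ Cω r)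
    {Q : AxisCube d} (hQ : Q ∈ nearCubes D W' x) {a : Euc d} (ha : a ∈ frontier D)
    (hxa : dist x a + Metric.infDist x (frontier D) / 2 ≤ R / 4) : Q.side ≤ R := by
  obtain ⟨hQW, y, hy, hyx⟩ := hQ
  linarith [S.side_le_four_mul_dist hQW hy ha, dist_triangle y x a]

lemma sum_nearCubes_eq_one (S : ExtensionSetup D W W' ψ refl ω n R c r₀ Cω r)
    (hx₀ : x₀ ∈ (closure D)ᶜ) (hx : dist x x₀ ≤ Metric.infDist x₀ (frontier D) / 2) :
    ∑ Q ∈ (S.finite_nearCubes hx₀).toFinset, ψ Q x = 1 := by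
  have hsum := S.partition.sum_eq x
  rw [indicator_of_mem (S.closedBall_half_infDist_subset hx₀ hx)] at hsum
  rw [← hsum, finsum_mem_eq_sum_of_subset]
  · rintro Q ⟨hQ, hne⟩
    rw [Finite.coe_toFinset]
    exact ⟨hQ, x, S.partition.mem_of_ne_zero hQ hne, hx⟩
  · rw [Finite.coe_toFinset]
    exact fun Q hQ => hQ.1

open Classical in
lemma whitneyExt_eq_sum (S : ExtensionSetup D W W' ψ refl ω n R c r₀ Cω r)
    (hx₀ : x₀ ∈ (closure D)ᶜ) (hx : dist x x₀ ≤ Metric.infDist x₀ (frontier D) / 2) :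
    whitneyExt D R W' ψ refl P f x =
      ∑ Q ∈ (S.finite_nearCubes hx₀).toFinset with Q.side ≤ R,
        ψ Q x * polyVal (P (refl Q)) x := by
  have hxD : x ∉ D := fun h => S.closedBall_half_infDist_subset hx₀ hx (subset_closure h)
  rw [whitneyExt, indicator_of_notMem hxD, zero_add]
  apply finsum_mem_eq_sum_of_subset
  · rintro Q ⟨⟨hQ, hQR⟩, hne⟩
    simp only [Finset.coe_filter, Finite.mem_toFinset]
    exact ⟨⟨hQ, x, S.partition.mem_of_ne_zero hQ (left_ne_zero_of_mul hne), hx⟩, hQR⟩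
  · intro Q hQ
    simp only [Finset.coe_filter, Finite.mem_toFinset] at hQ
    exact ⟨hQ.1.1, hQ.2⟩

lemma whitneyExt_sub_eq_sum (S : ExtensionSetup D W W' ψ refl ω n R c r₀ Cω r)
    (hx₀ : x₀ ∈ (closure D)ᶜ) (hx : dist x x₀ ≤ Metric.infDist x₀ (frontier D) / 2)
    (hR : ∀ Q ∈ nearCubes D W' x₀, Q.side ≤ R) (p : MvPolynomial (Fin d) ℝ) :
    whitneyExt D R W' ψ refl P f x - polyVal p x =
      ∑ Q ∈ (S.finite_nearCubes hx₀).toFinset,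
        ψ Q x * (polyVal (P (refl Q)) x - polyVal p x) := by
  classical
  rw [S.whitneyExt_eq_sum hx₀ hx, Finset.filter_true_of_mem fun Q hQ => hR Q (by simpa using hQ)]
  simp only [mul_sub, Finset.sum_sub_distrib, ← Finset.sum_mul, S.sum_nearCubes_eq_one hx₀ hx,
    one_mul]

lemma contDiffOn_whitneyExt (S : ExtensionSetup D W W' ψ refl ω n R c r₀ Cω r) :
    ContDiffOn ℝ ((⊤ : ℕ∞) : WithTop ℕ∞) (whitneyExt D R W' ψ refl P f) (closure D)ᶜ := by
  classical
  intro x₀ hx₀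
  have hsmooth : ContDiff ℝ ((⊤ : ℕ∞) : WithTop ℕ∞) fun x =>
      ∑ Q ∈ (S.finite_nearCubes hx₀).toFinset with Q.side ≤ R,
        ψ Q x * polyVal (P (refl Q)) x := by
    refine ContDiff.sum fun Q hQ => ?_
    simp only [Finset.mem_filter, Finite.mem_toFinset] at hQ
    exact (S.partition.smooth Q hQ.1.1).mul (contDiff_polyVal _)
  refine (hsmooth.contDiffAt.congr_of_eventuallyEq ?_).contDiffWithinAt
  filter_upwards [Metric.closedBall_mem_nhds x₀ (half_pos (S.infDist_pos hx₀))] with x hx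
  exact S.whitneyExt_eq_sum hx₀ hx

lemma abs_sum_nearCubes_le (S : ExtensionSetup D W W' ψ refl ω n R c r₀ Cω r)
    (hx₀ : x₀ ∈ (closure D)ᶜ) (hx : dist x x₀ ≤ Metric.infDist x₀ (frontier D) / 2)
    {F : Finset (AxisCube d)} (hF : F ⊆ (S.finite_nearCubes hx₀).toFinset) {g : AxisCube d → ℝ}
    {B : ℝ} (hB : 0 ≤ B) (hg : ∀ Q ∈ F, |g Q| ≤ B) : |∑ Q ∈ F, ψ Q x * g Q| ≤ B := by
  have hψ : ∀ Q ∈ (S.finite_nearCubes hx₀).toFinset, 0 ≤ ψ Q x := fun Q hQ =>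
    S.partition.nonneg ((Finite.mem_toFinset _).1 hQ).1 x
  calc |∑ Q ∈ F, ψ Q x * g Q| ≤ ∑ Q ∈ F, ψ Q x * B := by
        refine (Finset.abs_sum_le_sum_abs _ _).trans (Finset.sum_le_sum fun Q hQ => ?_)
        rw [abs_mul, abs_of_nonneg (hψ Q (hF hQ))]
        exact mul_le_mul_of_nonneg_left (hg Q hQ) (hψ Q (hF hQ))
    _ = (∑ Q ∈ F, ψ Q x) * B := (Finset.sum_mul _ _ _).symm
    _ ≤ 1 * B := by
        gcongr
        rw [← S.sum_nearCubes_eq_one hx₀ hx]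
        exact Finset.sum_le_sum_of_subset_of_nonneg hF fun Q hQ _ => hψ Q hQ
    _ = B := one_mul B

lemma abs_polyVal_refl_sub_le (S : ExtensionSetup D W W' ψ refl ω n R c r₀ Cω r)
    {a : Euc d} {p : MvPolynomial (Fin d) ℝ} {η C B h : ℝ} (ha : a ∈ frontier D)
    (hp : IsBoundaryApprox D W' refl n R f P η C B a h p) (hh : η * h ≤ R / 4)
    (hxa : dist x₀ a + Metric.infDist x₀ (frontier D) / 2 ≤ η * h) {Q : AxisCube d}
    (hQ : Q ∈ nearCubes D W' x₀) (hx : ‖x - x₀‖ ≤ d * Metric.infDist x₀ (frontier D)) :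
    |polyVal (P (refl Q)) x - polyVal p x| ≤ C * B := by
  have hQR := S.side_le_of_mem_nearCubes hQ ha (hxa.trans hh)
  have hxQ := S.norm_sub_center_le_of_mem_nearCubes hQ hx
  obtain ⟨hQW, y, hy, hyx⟩ := hQ
  exact hp.abs_refl_sub_le Q hQW hQR y hy (by linarith [dist_triangle y x₀ a]) x hxQ

lemma abs_whitneyExt_sub_polyVal_le (S : ExtensionSetup D W W' ψ refl ω n R c r₀ Cω r)
    (hx : x ∈ (closure D)ᶜ) {a : Euc d} {p : MvPolynomial (Fin d) ℝ} {η C B h : ℝ}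
    (ha : a ∈ frontier D) (hp : IsBoundaryApprox D W' refl n R f P η C B a h p) (hC : 0 ≤ C)
    (hB : 0 ≤ B) (hh : η * h ≤ R / 4)
    (hxa : dist x a + Metric.infDist x (frontier D) / 2 ≤ η * h) :
    |whitneyExt D R W' ψ refl P f x - polyVal p x| ≤ C * B := by
  have hxx : dist x x ≤ Metric.infDist x (frontier D) / 2 := by
    rw [dist_self]
    exact (half_pos (S.infDist_pos hx)).le
  rw [S.whitneyExt_sub_eq_sum hx hxx
    fun Q hQ => S.side_le_of_mem_nearCubes hQ ha (hxa.trans hh)]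
  refine S.abs_sum_nearCubes_le hx hxx subset_rfl (by positivity) fun Q hQ =>
    S.abs_polyVal_refl_sub_le ha hp hh hxa ((Finite.mem_toFinset _).1 hQ) ?_
  rw [sub_self, norm_zero]
  exact mul_nonneg d.cast_nonneg Metric.infDist_nonneg

lemma exists_le_side_refl (S : ExtensionSetup D W W' ψ refl ω n R c r₀ Cω r) {s : ℝ}
    (hs : 0 < s) :
    ∃ t : ℝ, 0 < t ∧ ∀ Q ∈ W', s ≤ Q.side → Q.side ≤ R → t ≤ (refl Q).side := by
  have hd := S.one_le_dim
  have hc := S.cones.aperture_pos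
  have hr₀ := S.cones.height_pos
  refine ⟨c * min (s / 4) r₀ / (6 * d), by positivity, fun Q hQ hsQ hQR => ?_⟩
  rw [div_le_iff₀' (by positivity)]
  refine le_trans ?_ ((S.reflective Q hQ hQR).lower_bound S.dim_pos S.isOpen S.cones S.whitney
    S.whitney' S.frontier_exterior hQ)
  gcongr

lemma exists_abs_polyVal_refl_le (S : ExtensionSetup D W W' ψ refl ω n R c r₀ Cω r)
    (C₀ : ℝ≥0) {s : ℝ} (hs : 0 < s) :
    ∃ C : ℝ, 0 ≤ C ∧ ∀ f P M, ExtensionData D W' refl ω n R C₀ f P M → ∀ L : ℝ, 0 ≤ L →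
      ∫⁻ x in D, ‖f x‖ₑ ≤ ENNReal.ofReal L → ∀ Q ∈ W', s ≤ Q.side → Q.side ≤ R →
      ∀ x, ‖x - Q.center‖ ≤ 100 * (d : ℝ) ^ 2 * Q.side →
        |polyVal (P (refl Q)) x| ≤ C * (M + L) := by
  have hd := S.one_le_dim
  have hR := S.R_pos
  obtain ⟨C₁, hC₁, hpoly⟩ := exists_abs_polyVal_le_of_setLIntegral_le d n
  obtain ⟨t, ht, hrefl_ge⟩ := S.exists_le_side_refl hs
  have hωR := S.modulus.pos (32 * d * R) (by positivity)
  refine ⟨C₁ * (1 / t ^ d + C₀ * ω (32 * d * R)) * (1 + 127 * (d : ℝ) ^ 2 * R / t) ^ n,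
    by positivity, ?_⟩
  intro f P M hf L hL hfL Q hQ hsQ hQR x hx
  have hM := hf.nonneg
  have hrefl := S.reflective Q hQ hQR
  obtain ⟨hside, hcenter⟩ := hrefl.upper_bounds S.dim_pos S.whitney S.whitney'
    S.frontier_exterior hQ
  have htT := hrefl_ge Q hQ hsQ hQR
  have hnear := hf.near Q hQ hQR
  have hdegree := hf.degree Q hQ hQR
  set T := refl Q
  have hT := T.side_pos
  have hωT := S.modulus.pos _ hT
  have hω : ω T.side ≤ ω (32 * d * R) := S.modulus.mono _ _ hT.le (hside.trans (by gcongr))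
  have hTD : T.carrier ⊆ D := S.whitney.carrier_subset hrefl.1.1
  have hmean : (L + T.side ^ d * (C₀ * (M * ω T.side))) / T.side ^ d ≤
      (1 / t ^ d + C₀ * ω (32 * d * R)) * (M + L) := by
    calc (L + T.side ^ d * (C₀ * (M * ω T.side))) / T.side ^ d
        = L / T.side ^ d + C₀ * (M * ω T.side) := by field_simp
      _ ≤ L / t ^ d + C₀ * (M * ω (32 * d * R)) := by gcongr
      _ ≤ (1 / t ^ d + C₀ * ω (32 * d * R)) * (M + L) := by
        have : 0 ≤ 1 / t ^ d * M + C₀ * ω (32 * d * R) * L := by positivity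
        linear_combination this
  have hxT : ‖x - T.center‖ ≤ 127 * (d : ℝ) ^ 2 * R := by
    have htri := norm_sub_le_norm_sub_add_norm_sub x Q.center T.center
    rw [norm_sub_rev Q.center] at htri
    have : 127 * (d : ℝ) ^ 2 * Q.side ≤ 127 * (d : ℝ) ^ 2 * R := by gcongr
    linarith
  calc |polyVal (P T) x|
      ≤ C₁ * ((L + T.side ^ d * (C₀ * (M * ω T.side))) / T.side ^ d) *
          (1 + ‖x - T.center‖ / T.side) ^ n :=
        hpoly f T (P T) L _ (hf.meas.mono_set hTD) hdegree hL (by positivity)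
          ((lintegral_mono_set hTD).trans hfL) (meanDev_le_ofReal_iff.1 hnear) x
    _ ≤ C₁ * ((1 / t ^ d + C₀ * ω (32 * d * R)) * (M + L)) *
          (1 + 127 * (d : ℝ) ^ 2 * R / t) ^ n := by gcongr
    _ = _ := by ring

lemma exists_abs_whitneyExt_le_of_le_infDist (S : ExtensionSetup D W W' ψ refl ω n R c r₀ Cω r)
    (C₀ : ℝ≥0) {s : ℝ} (hs : 0 < s) :
    ∃ C : ℝ, 0 ≤ C ∧ ∀ f P M, ExtensionData D W' refl ω n R C₀ f P M → ∀ L : ℝ, 0 ≤ L →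
      ∫⁻ x in D, ‖f x‖ₑ ≤ ENNReal.ofReal L → ∀ x ∈ (closure D)ᶜ,
      s ≤ Metric.infDist x (frontier D) → |whitneyExt D R W' ψ refl P f x| ≤ C * (M + L) := by
  classical
  have hd := S.one_le_dim
  obtain ⟨C, hC, hrefl⟩ := S.exists_abs_polyVal_refl_le C₀ (s := s / (14 * d)) (by positivity)
  refine ⟨C, hC, fun f P M hf L hL hfL x hx hxs => ?_⟩
  have hM := hf.nonneg
  have hxx : dist x x ≤ Metric.infDist x (frontier D) / 2 := by
    rw [dist_self]
    exact (half_pos (S.infDist_pos hx)).le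
  rw [S.whitneyExt_eq_sum hx hxx]
  refine S.abs_sum_nearCubes_le hx hxx (Finset.filter_subset _ _) (by positivity) fun Q hQ => ?_
  simp only [Finset.mem_filter, Finite.mem_toFinset] at hQ
  refine hrefl f P M hf L hL hfL Q hQ.1.1 ?_ hQ.2 x
    (S.norm_sub_center_le_of_mem_nearCubes hQ.1 ?_)
  · rw [div_le_iff₀' (by positivity)]
    exact hxs.trans (S.comparable_of_mem_nearCubes hQ.1).1
  · rw [sub_self, norm_zero]
    exact mul_nonneg d.cast_nonneg Metric.infDist_nonneg

lemma exists_abs_whitneyExt_le (S : ExtensionSetup D W W' ψ refl ω n R c r₀ Cω r) (C₀ : ℝ≥0) :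
    ∃ C : ℝ, 0 ≤ C ∧ ∀ f P M, ExtensionData D W' refl ω n R C₀ f P M → ∀ L : ℝ, 0 ≤ L →
      ∫⁻ x in D, ‖f x‖ₑ ≤ ENNReal.ofReal L → ∀ x ∈ (closure D)ᶜ,
        |whitneyExt D R W' ψ refl P f x| ≤ C * (M + L) := by
  have hε : 0 < min r₀ R := lt_min S.cones.height_pos S.R_pos
  set ε := min r₀ R
  obtain ⟨η, C₁, hη, hη4, hC₁, happrox⟩ := S.exists_isBoundaryApprox C₀
  obtain ⟨C₂, -, hdeep⟩ :=
    S.exists_abs_whitneyExt_le_of_le_infDist C₀ (s := η * ε / 2) (by positivity)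
  have hωε := S.modulus.pos ε hε
  refine ⟨max (C₁ * (1 / ε ^ d + 2 * ω ε)) C₂, by positivity, ?_⟩
  intro f P M hf L hL hfL x hx
  have hM := hf.nonneg
  rcases le_or_gt (η * ε / 2) (Metric.infDist x (frontier D)) with hfar | hclose
  · exact (hdeep f P M hf L hL hfL x hx hfar).trans (by gcongr; exact le_max_right _ _)
  obtain ⟨a, ha, hxa⟩ := S.exists_infDist_eq x
  obtain ⟨p, hp⟩ := happrox f P M hf a ha ε hε (min_le_left _ _)
  have hηε : η * ε ≤ ε / 4 := by nlinarith
  have hεR : η * ε ≤ R / 4 := by linarith [min_le_right r₀ R]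
  calc |whitneyExt D R W' ψ refl P f x|
      ≤ |whitneyExt D R W' ψ refl P f x - polyVal p x| + |polyVal p x| := by
        simpa using abs_add_le (whitneyExt D R W' ψ refl P f x - polyVal p x) (polyVal p x)
    _ ≤ C₁ * (M * ω ε) + C₁ * (L / ε ^ d + M * ω ε) := by
        refine add_le_add (S.abs_whitneyExt_sub_polyVal_le hx ha hp hC₁ (by positivity) hεR
          (by linarith [mul_pos hη hε])) (hp.abs_le L hL hfL x ?_)
        rw [← dist_eq_norm]
        linarith
    _ ≤ C₁ * (1 / ε ^ d + 2 * ω ε) * (M + L) := by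
        have : 0 ≤ C₁ * (1 / ε ^ d * M + 2 * ω ε * L) := by positivity
        linear_combination this
    _ ≤ _ := by gcongr; exact le_max_left _ _

end ExtensionSetup

end Exterior

section FarApproximation

variable {d n : ℕ} {D : Set (Euc d)} {W W' : Set (AxisCube d)}
  {ψ : AxisCube d → Euc d → ℝ} {refl : AxisCube d → AxisCube d} {ω : ℝ → ℝ}
  {R c r₀ Cω r : ℝ}

namespace ExtensionSetup

lemma exists_norm_iteratedFDeriv_le (S : ExtensionSetup D W W' ψ refl ω n R c r₀ Cω r) :
    ∃ A : ℝ, 0 ≤ A ∧ ∀ Q ∈ W', ∀ s : ℝ, 0 < s → s ≤ 14 * d * Q.side →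
      ∀ k ≤ n + 1, ∀ x, ‖iteratedFDeriv ℝ k (ψ Q) x‖ ≤ A / s ^ k := by
  choose C hC using S.partition.deriv_le
  refine ⟨∑ k ∈ Finset.range (n + 2), |C k| * (14 * d) ^ k, by positivity,
    fun Q hQ s hs hsQ k hk x => ?_⟩
  have hside := Q.side_pos
  calc ‖iteratedFDeriv ℝ k (ψ Q) x‖ ≤ |C k| / Q.side ^ k :=
        (hC k Q hQ x).trans (by gcongr; exact le_abs_self _)
    _ ≤ |C k| * (14 * d) ^ k / s ^ k := by
        rw [div_le_div_iff₀ (by positivity) (by positivity), mul_assoc, ← mul_pow]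
        gcongr
    _ ≤ (∑ k ∈ Finset.range (n + 2), |C k| * (14 * d) ^ k) / s ^ k := by
        gcongr
        exact Finset.single_le_sum (f := fun k => |C k| * (14 * (d : ℝ)) ^ k)
          (fun k _ => by positivity) (Finset.mem_range.2 (by lia))

lemma exists_polyVal_approx_sum_nearCubes
    (S : ExtensionSetup D W W' ψ refl ω n R c r₀ Cω r) :
    ∃ C : ℝ, 0 ≤ C ∧ ∀ (x₀ : Euc d) (hx₀ : x₀ ∈ (closure D)ᶜ) (s : ℝ), 0 < s →
      s ≤ Metric.infDist x₀ (frontier D) → ∀ F ⊆ (S.finite_nearCubes hx₀).toFinset,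
      ∀ (g : AxisCube d → MvPolynomial (Fin d) ℝ) (B : ℝ), 0 ≤ B →
      (∀ Q ∈ F, (g Q).totalDegree ≤ n) →
      (∀ Q ∈ F, ∀ x, ‖x - x₀‖ ≤ d * Metric.infDist x₀ (frontier D) → |polyVal (g Q) x| ≤ B) →
      ∃ p : MvPolynomial (Fin d) ℝ, p.totalDegree ≤ n ∧ ∀ x, ‖x - x₀‖ ≤ s →
        |∑ Q ∈ F, ψ Q x * polyVal (g Q) x - polyVal p x| ≤ C * B * (‖x - x₀‖ / s) ^ (n + 1) := by
  obtain ⟨C, hC, happrox⟩ := exists_polyVal_approx_mul_polyVal d n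
  obtain ⟨A, hA, hderiv⟩ := S.exists_norm_iteratedFDeriv_le
  refine ⟨(14 * d * (16 * d)) ^ d * (C * A), by positivity, ?_⟩
  intro x₀ hx₀ s hs hsx₀ F hF g B hB hdegree hg
  have hnear : ∀ Q ∈ F, Q ∈ nearCubes D W' x₀ := fun Q hQ => (Finite.mem_toFinset _).1 (hF hQ)
  have hcard : (F.card : ℝ) ≤ (14 * d * (16 * d)) ^ d := by
    refine le_trans ?_ (S.ncard_nearCubes_le hx₀)
    rw [ncard_eq_toFinset_card _ (S.finite_nearCubes hx₀)]
    exact_mod_cast Finset.card_le_card hF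
  have hcube : ∀ x ∈ (AxisCube.mk x₀ s hs).carrier,
      ‖x - x₀‖ ≤ d * Metric.infDist x₀ (frontier D) := fun x hx =>
    (AxisCube.norm_sub_center_le hx).trans (by gcongr; exact (half_le_self hs.le).trans hsx₀)
  have hterm : ∀ Q ∈ F, ∃ p : MvPolynomial (Fin d) ℝ, p.totalDegree ≤ n ∧ ∀ x, ‖x - x₀‖ ≤ s →
      |ψ Q x * polyVal (g Q) x - polyVal p x| ≤ C * A * B * (‖x - x₀‖ / s) ^ (n + 1) :=
    fun Q hQ => happrox ⟨x₀, s, hs⟩ A B (ψ Q) (g Q)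
      ((S.partition.smooth Q (hnear Q hQ).1).of_le (mod_cast le_top))
      (hderiv Q (hnear Q hQ).1 s hs (hsx₀.trans (S.comparable_of_mem_nearCubes (hnear Q hQ)).1))
      (hdegree Q hQ) fun x hx => hg Q hQ x (hcube x hx)
  choose! p hp hpx using hterm
  refine ⟨∑ Q ∈ F, p Q, MvPolynomial.totalDegree_finsetSum_le hp, fun x hx => ?_⟩
  rw [polyVal_sum, ← Finset.sum_sub_distrib]
  calc |∑ Q ∈ F, (ψ Q x * polyVal (g Q) x - polyVal (p Q) x)|
      ≤ ∑ _Q ∈ F, C * A * B * (‖x - x₀‖ / s) ^ (n + 1) :=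
        (Finset.abs_sum_le_sum_abs _ _).trans (Finset.sum_le_sum fun Q hQ => hpx Q hQ x hx)
    _ = F.card * (C * A * B * (‖x - x₀‖ / s) ^ (n + 1)) := by rw [Finset.sum_const, nsmul_eq_mul]
    _ ≤ (14 * d * (16 * d)) ^ d * (C * A * B * (‖x - x₀‖ / s) ^ (n + 1)) := by gcongr
    _ = _ := by ring

lemma exists_polyVal_approx_whitneyExt_of_isBoundaryApprox
    (S : ExtensionSetup D W W' ψ refl ω n R c r₀ Cω r) (C₀ : ℝ≥0) :
    ∃ C : ℝ, 0 ≤ C ∧ ∀ f P M, ExtensionData D W' refl ω n R C₀ f P M →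
      ∀ (a : Euc d) (p : MvPolynomial (Fin d) ℝ) (η C₁ B h : ℝ), a ∈ frontier D →
      IsBoundaryApprox D W' refl n R f P η C₁ B a h p → 0 ≤ C₁ → 0 ≤ B → η * h ≤ R / 4 →
      ∀ x₀ ∈ (closure D)ᶜ, dist x₀ a + Metric.infDist x₀ (frontier D) / 2 ≤ η * h →
      ∃ q : MvPolynomial (Fin d) ℝ, q.totalDegree ≤ n ∧
        ∀ x, ‖x - x₀‖ ≤ Metric.infDist x₀ (frontier D) / 2 →
          |whitneyExt D R W' ψ refl P f x - polyVal q x| ≤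
            C * (C₁ * B) * (‖x - x₀‖ / Metric.infDist x₀ (frontier D)) ^ (n + 1) := by
  obtain ⟨C, hC, happrox⟩ := S.exists_polyVal_approx_sum_nearCubes
  refine ⟨C, hC, fun f P M hf a p η C₁ B h ha hp hC₁ hB hh x₀ hx₀ hx₀a => ?_⟩
  have hpos := S.infDist_pos hx₀
  have hR : ∀ Q ∈ nearCubes D W' x₀, Q.side ≤ R := fun Q hQ =>
    S.side_le_of_mem_nearCubes hQ ha (hx₀a.trans hh)
  obtain ⟨q, hq, hqx⟩ := happrox x₀ hx₀ _ hpos le_rfl _ subset_rfl (fun Q => P (refl Q) - p)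
    (C₁ * B) (by positivity)
    (fun Q hQ => by
      rw [Finite.mem_toFinset] at hQ
      exact totalDegree_sub_le_of_le (hf.degree Q hQ.1 (hR Q hQ)) hp.totalDegree_le)
    (fun Q hQ x hx => by
      rw [polyVal_sub]
      exact S.abs_polyVal_refl_sub_le ha hp hh hx₀a ((Finite.mem_toFinset _).1 hQ) hx)
  refine ⟨p + q, (MvPolynomial.totalDegree_add _ _).trans (max_le hp.totalDegree_le hq),
    fun x hx => ?_⟩
  have hsum := hqx x (by linarith)
  simp only [polyVal_sub] at hsum
  rwa [← S.whitneyExt_sub_eq_sum (f := f) hx₀ (by rwa [dist_eq_norm]) hR p, sub_sub,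
    ← polyVal_add] at hsum

lemma exists_polyVal_approx_whitneyExt_of_le_infDist
    (S : ExtensionSetup D W W' ψ refl ω n R c r₀ Cω r) (C₀ : ℝ≥0) {s : ℝ} (hs : 0 < s) :
    ∃ C : ℝ, 0 ≤ C ∧ ∀ f P M, ExtensionData D W' refl ω n R C₀ f P M → ∀ L : ℝ, 0 ≤ L →
      ∫⁻ x in D, ‖f x‖ₑ ≤ ENNReal.ofReal L → ∀ x₀ ∈ (closure D)ᶜ,
      s ≤ Metric.infDist x₀ (frontier D) →
      ∃ q : MvPolynomial (Fin d) ℝ, q.totalDegree ≤ n ∧ ∀ x, ‖x - x₀‖ ≤ s / 2 →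
        |whitneyExt D R W' ψ refl P f x - polyVal q x| ≤
          C * (M + L) * (‖x - x₀‖ / s) ^ (n + 1) := by
  classical
  have hd := S.one_le_dim
  obtain ⟨C, hC, happrox⟩ := S.exists_polyVal_approx_sum_nearCubes
  obtain ⟨C', hC', hrefl⟩ := S.exists_abs_polyVal_refl_le C₀ (s := s / (14 * d)) (by positivity)
  refine ⟨C * C', by positivity, fun f P M hf L hL hfL x₀ hx₀ hsx₀ => ?_⟩
  have hM := hf.nonneg
  obtain ⟨q, hq, hqx⟩ := happrox x₀ hx₀ s hs hsx₀
    {Q ∈ (S.finite_nearCubes hx₀).toFinset | Q.side ≤ R} (Finset.filter_subset _ _)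
    (fun Q => P (refl Q)) (C' * (M + L)) (by positivity)
    (fun Q hQ => by
      simp only [Finset.mem_filter, Finite.mem_toFinset] at hQ
      exact hf.degree Q hQ.1.1 hQ.2)
    (fun Q hQ x hx => by
      simp only [Finset.mem_filter, Finite.mem_toFinset] at hQ
      refine hrefl f P M hf L hL hfL Q hQ.1.1 ?_ hQ.2 x
        (S.norm_sub_center_le_of_mem_nearCubes hQ.1 hx)
      rw [div_le_iff₀' (by positivity)]
      exact hsx₀.trans (S.comparable_of_mem_nearCubes hQ.1).1)
  refine ⟨q, hq, fun x hx => ?_⟩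
  rw [S.whitneyExt_eq_sum hx₀ (by rw [dist_eq_norm]; linarith), mul_assoc C]
  exact hqx x (by linarith)

lemma exists_polyVal_approx_whitneyExt_of_infDist_le
    (S : ExtensionSetup D W W' ψ refl ω n R c r₀ Cω r) (C₀ : ℝ≥0) :
    ∃ s C : ℝ, 0 < s ∧ 0 ≤ C ∧ ∀ f P M, ExtensionData D W' refl ω n R C₀ f P M →
      ∀ Q : AxisCube d, Q.center ∈ (closure D)ᶜ →
      d * Q.side ≤ Metric.infDist Q.center (frontier D) →
      Metric.infDist Q.center (frontier D) ≤ s →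
      ∃ p : MvPolynomial (Fin d) ℝ, p.totalDegree ≤ n ∧ ∀ x ∈ Q.carrier,
        |whitneyExt D R W' ψ refl P f x - polyVal p x| ≤ C * M * ω Q.side := by
  have hd := S.one_le_dim
  have hε : 0 < min r₀ R := lt_min S.cones.height_pos S.R_pos
  have hCω := S.modulus.nonneg
  obtain ⟨η, C₁, hη, hη4, hC₁, hlocal⟩ := S.exists_isBoundaryApprox C₀
  obtain ⟨C₂, hC₂, hclose⟩ := S.exists_polyVal_approx_whitneyExt_of_isBoundaryApprox C₀
  refine ⟨η * min r₀ R / 2, C₂ * C₁ * (d / η) ^ (n + 1) * Cω, by positivity, by positivity,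
    fun f P M hf Q hQ hfar hρs => ?_⟩
  have hM := hf.nonneg
  have hρ := S.infDist_pos hQ
  obtain ⟨a, ha, hρa⟩ := S.exists_infDist_eq Q.center
  set ρ := Metric.infDist Q.center (frontier D)
  have hh : 0 < 2 * ρ / η := by positivity
  set h := 2 * ρ / η with h_def
  have hηh : η * h = 2 * ρ := mul_div_cancel₀ _ hη.ne'
  have hhε : h ≤ min r₀ R := (div_le_iff₀' hη).2 (by linarith)
  have hQh : Q.side ≤ h := (le_div_iff₀' hη).2 (by nlinarith [Q.side_pos])
  have hωh := S.modulus.pos h hh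
  obtain ⟨p, hp⟩ := hlocal f P M hf a ha h hh (hhε.trans (min_le_left _ _))
  obtain ⟨q, hq, hqx⟩ := hclose f P M hf a p η C₁ (M * ω h) h ha hp hC₁ (by positivity)
    (by nlinarith [min_le_right r₀ R]) Q.center hQ (by linarith)
  refine ⟨q, hq, fun x hx => ?_⟩
  have hxQ := AxisCube.norm_sub_center_le hx
  calc |whitneyExt D R W' ψ refl P f x - polyVal q x|
      ≤ C₂ * (C₁ * (M * ω h)) * (‖x - Q.center‖ / ρ) ^ (n + 1) := hqx x (by linarith)
    _ ≤ C₂ * (C₁ * (M * ω h)) * (d * (Q.side / 2) / ρ) ^ (n + 1) := by gcongr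
    _ = C₂ * C₁ * (d / η) ^ (n + 1) * M * (ω h * (Q.side / h) ^ (n + 1)) := by
        have : d * (Q.side / 2) / ρ = d / η * (Q.side / h) := by
          rw [h_def]
          field_simp
        rw [this, mul_pow]
        ring
    _ ≤ C₂ * C₁ * (d / η) ^ (n + 1) * M * (Cω * ω Q.side) :=
        mul_le_mul_of_nonneg_left (S.modulus.mul_div_pow_le Q.side_pos hQh) (by positivity)
    _ = C₂ * C₁ * (d / η) ^ (n + 1) * Cω * M * ω Q.side := by ring

lemma exists_polyVal_approx_whitneyExt_of_side_le
    (S : ExtensionSetup D W W' ψ refl ω n R c r₀ Cω r) (C₀ : ℝ≥0) {s : ℝ} (hs : 0 < s) :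
    ∃ C : ℝ, 0 ≤ C ∧ ∀ f P M, ExtensionData D W' refl ω n R C₀ f P M → ∀ L : ℝ, 0 ≤ L →
      ∫⁻ x in D, ‖f x‖ₑ ≤ ENNReal.ofReal L → ∀ Q : AxisCube d, Q.center ∈ (closure D)ᶜ →
      d * Q.side ≤ s → s ≤ Metric.infDist Q.center (frontier D) →
      ∃ p : MvPolynomial (Fin d) ℝ, p.totalDegree ≤ n ∧ ∀ x ∈ Q.carrier,
        |whitneyExt D R W' ψ refl P f x - polyVal p x| ≤ C * (M + L) * ω Q.side := by
  have hd := S.one_le_dim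
  have hCω := S.modulus.nonneg
  have hωs := S.modulus.pos s hs
  obtain ⟨C, hC, happrox⟩ := S.exists_polyVal_approx_whitneyExt_of_le_infDist C₀ hs
  refine ⟨C * (d / 2) ^ (n + 1) * Cω / ω s, by positivity, fun f P M hf L hL hfL Q hQ hQs hsρ => ?_⟩
  have hM := hf.nonneg
  have hQs' : Q.side ≤ s := (le_mul_of_one_le_left Q.side_pos.le hd).trans hQs
  obtain ⟨q, hq, hqx⟩ := happrox f P M hf L hL hfL Q.center hQ hsρ
  refine ⟨q, hq, fun x hx => ?_⟩
  have hxQ := AxisCube.norm_sub_center_le hx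
  calc |whitneyExt D R W' ψ refl P f x - polyVal q x|
      ≤ C * (M + L) * (‖x - Q.center‖ / s) ^ (n + 1) := hqx x (by linarith)
    _ ≤ C * (M + L) * (d * (Q.side / 2) / s) ^ (n + 1) := by gcongr
    _ = C * (d / 2) ^ (n + 1) / ω s * (M + L) * (ω s * (Q.side / s) ^ (n + 1)) := by
        have : d * (Q.side / 2) / s = d / 2 * (Q.side / s) := by ring
        rw [this, mul_pow]
        field_simp
    _ ≤ C * (d / 2) ^ (n + 1) / ω s * (M + L) * (Cω * ω Q.side) :=
        mul_le_mul_of_nonneg_left (S.modulus.mul_div_pow_le Q.side_pos hQs') (by positivity)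
    _ = C * (d / 2) ^ (n + 1) * Cω / ω s * (M + L) * ω Q.side := by ring

end ExtensionSetup

end FarApproximation

section Extension

variable {d n : ℕ} {D : Set (Euc d)} {W W' : Set (AxisCube d)}
  {ψ : AxisCube d → Euc d → ℝ} {refl : AxisCube d → AxisCube d} {ω : ℝ → ℝ}
  {R c r₀ Cω r : ℝ} {C₀ : ℝ≥0} {f : Euc d → ℝ} {P : AxisCube d → MvPolynomial (Fin d) ℝ} {M : ℝ}

lemma cubeOsc_le_of_meanDev_le {p : MvPolynomial (Fin d) ℝ} {Q : AxisCube d} {B : ℝ}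
    (hp : p.totalDegree ≤ n) (hω : 0 < ω Q.side)
    (h : meanDev f p Q ≤ ENNReal.ofReal (B * ω Q.side)) :
    cubeOsc ω n f Q ≤ ENNReal.ofReal B := by
  refine (iInf₂_le p hp).trans ?_
  rwa [ENNReal.inv_mul_le_iff (ENNReal.ofReal_pos.2 hω).ne' ENNReal.ofReal_ne_top, mul_comm,
    ← ENNReal.ofReal_mul' hω.le]

lemma cubeOsc_congr {g : Euc d → ℝ} {Q : AxisCube d} (h : EqOn f g Q.carrier) :
    cubeOsc ω n f Q = cubeOsc ω n g Q := by
  have hmean : ∀ p : MvPolynomial (Fin d) ℝ, meanDev f p Q = meanDev g p Q := fun p => by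
    simp only [meanDev]
    congr 1
    exact setLIntegral_congr_fun Q.measurableSet_carrier fun x hx => by rw [h hx]
  simp only [cubeOsc, hmean]

lemma setLIntegral_enorm_le_of_abs_le {s : Set (Euc d)} (hs : MeasurableSet s) {Q : AxisCube d}
    (hsQ : s ⊆ Q.carrier) {B : ℝ} (h : ∀ x ∈ s, |f x| ≤ B) :
    ∫⁻ x in s, ‖f x‖ₑ ≤ ENNReal.ofReal (Q.side ^ d * B) := by
  calc ∫⁻ x in s, ‖f x‖ₑ ≤ ∫⁻ _ in s, ENNReal.ofReal B := by
        refine setLIntegral_mono' hs fun x hx => ?_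
        rw [Real.enorm_eq_ofReal_abs]
        exact ENNReal.ofReal_le_ofReal (h x hx)
    _ ≤ ENNReal.ofReal B * volume Q.carrier := by
        rw [setLIntegral_const]
        gcongr
    _ = ENNReal.ofReal (Q.side ^ d * B) := by
        rw [Q.volume_carrier, mul_comm, ENNReal.ofReal_mul (pow_nonneg Q.side_pos.le d)]

lemma meanDev_le_of_abs_sub_le {p : MvPolynomial (Fin d) ℝ} {Q : AxisCube d} {B : ℝ}
    (h : ∀ x ∈ Q.carrier, |f x - polyVal p x| ≤ B) : meanDev f p Q ≤ ENNReal.ofReal B :=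
  meanDev_le_ofReal_iff.2 (setLIntegral_enorm_le_of_abs_le Q.measurableSet_carrier subset_rfl h)

lemma IsBoundaryApprox.integrableOn {η C B h : ℝ} {a : Euc d} {p : MvPolynomial (Fin d) ℝ}
    (hp : IsBoundaryApprox D W' refl n R f P η C B a h p)
    (hf : AEStronglyMeasurable f (volume.restrict D)) :
    IntegrableOn f (D ∩ Metric.closedBall a (η * h)) := by
  have hpoly : IntegrableOn (polyVal p) (D ∩ Metric.closedBall a (η * h)) :=
    ((continuous_polyVal p).locallyIntegrable.integrableOn_isCompact
      (isCompact_closedBall a (η * h))).mono_set inter_subset_right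
  have hsub : IntegrableOn (fun x => f x - polyVal p x) (D ∩ Metric.closedBall a (η * h)) :=
    ⟨(hf.mono_set inter_subset_left).sub (continuous_polyVal p).aestronglyMeasurable,
      hp.lintegral_le.trans_lt ENNReal.ofReal_lt_top⟩
  refine (hsub.add hpoly).congr (Filter.Eventually.of_forall fun x => ?_)
  exact sub_add_cancel _ _

namespace ExtensionSetup

lemma whitneyExt_of_mem_closure (S : ExtensionSetup D W W' ψ refl ω n R c r₀ Cω r)
    {x : Euc d} (hx : x ∈ closure D) :
    whitneyExt D R W' ψ refl P f x = D.indicator f x := by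
  rw [whitneyExt, finsum_mem_of_eqOn_zero, add_zero]
  rintro Q ⟨hQ, -⟩
  by_contra hne
  refine S.whitney'.scale_two_subset isClosed_closure.isOpen_compl S.dim_pos hQ ?_ hx
  refine AxisCube.carrier_subset_of_abs_le (fun i => ?_)
    (S.partition.mem_of_ne_zero hQ (left_ne_zero_of_mul hne))
  simp only [AxisCube.scale, sub_self, abs_zero]
  linarith [Q.side_pos]

lemma whitneyExt_of_mem (S : ExtensionSetup D W W' ψ refl ω n R c r₀ Cω r)
    {x : Euc d} (hx : x ∈ D) : whitneyExt D R W' ψ refl P f x = f x := by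
  rw [S.whitneyExt_of_mem_closure (subset_closure hx), indicator_of_mem hx]

lemma exists_whitneyExt_eq_zero_of_notMem_closedBall
    (S : ExtensionSetup D W W' ψ refl ω n R c r₀ Cω r) :
    ∃ ρ : ℝ, ∀ (f : Euc d → ℝ) (P : AxisCube d → MvPolynomial (Fin d) ℝ),
      ∀ x ∉ Metric.closedBall (0 : Euc d) ρ, whitneyExt D R W' ψ refl P f x = 0 := by
  obtain ⟨ρ, hρ⟩ := S.bounded.closure.subset_closedBall (0 : Euc d)
  have hR : 0 ≤ 7 * d * R := mul_nonneg (by positivity) S.R_pos.le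
  refine ⟨ρ + 7 * d * R, fun f P x hx => ?_⟩
  rw [Metric.mem_closedBall, not_le] at hx
  have hxD : x ∉ D := fun h => by
    linarith [Metric.mem_closedBall.1 (hρ (subset_closure h))]
  rw [whitneyExt, indicator_of_notMem hxD, zero_add]
  apply finsum_mem_of_eqOn_zero
  rintro Q ⟨hQ, hQR⟩
  by_contra hne
  have hupper := (S.whitney'.infDist_bounds S.dim_pos hQ
    (S.partition.mem_of_ne_zero hQ (left_ne_zero_of_mul hne))).2
  obtain ⟨a, ha, hxa⟩ := S.exists_infDist_eq x
  rw [S.frontier_exterior, hxa] at hupper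
  have hQd : 7 * d * Q.side ≤ 7 * d * R := by gcongr
  linarith [Metric.mem_closedBall.1 (hρ (frontier_subset_closure ha)), dist_triangle x a 0]

lemma integrableOn (S : ExtensionSetup D W W' ψ refl ω n R c r₀ Cω r)
    (hf : ExtensionData D W' refl ω n R C₀ f P M) (hloc : LocallyIntegrableOn f D) :
    IntegrableOn f D := by
  obtain ⟨η, C, hη, -, -, happrox⟩ := S.exists_isBoundaryApprox C₀
  have hr₀ := S.cones.height_pos
  have hclosure : IntegrableOn (D.indicator f) (closure D) := by
    refine LocallyIntegrableOn.integrableOn_isCompact (fun x hx => ?_) S.bounded.isCompact_closure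
    by_cases hxD : x ∈ D
    · obtain ⟨s, hs, hfs⟩ := hloc x hxD
      rw [S.isOpen.nhdsWithin_eq hxD] at hs
      exact ⟨s, mem_nhdsWithin_of_mem_nhds hs, hfs.indicator S.isOpen.measurableSet⟩
    · obtain ⟨p, hp⟩ := happrox f P M hf x (S.isOpen.frontier_eq ▸ ⟨hx, hxD⟩) r₀ hr₀ le_rfl
      refine ⟨Metric.closedBall x (η * r₀), mem_nhdsWithin_of_mem_nhds
        (Metric.closedBall_mem_nhds x (by positivity)), ?_⟩
      rw [IntegrableOn, integrable_indicator_iff S.isOpen.measurableSet, IntegrableOn,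
        Measure.restrict_restrict S.isOpen.measurableSet]
      exact hp.integrableOn hf.meas
  exact (hclosure.mono_set subset_closure).congr_fun (fun x hx => indicator_of_mem hx f)
    S.isOpen.measurableSet

lemma aestronglyMeasurable_whitneyExt (S : ExtensionSetup D W W' ψ refl ω n R c r₀ Cω r)
    (hf : AEStronglyMeasurable f (volume.restrict D)) :
    AEStronglyMeasurable (whitneyExt D R W' ψ refl P f) volume := by
  have hmeas : MeasurableSet (closure D)ᶜ := isClosed_closure.measurableSet.compl
  have hsplit : whitneyExt D R W' ψ refl P f =
      D.indicator f + (closure D)ᶜ.indicator (whitneyExt D R W' ψ refl P f) := by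
    ext x
    by_cases hx : x ∈ closure D
    · rw [Pi.add_apply, S.whitneyExt_of_mem_closure hx,
        indicator_of_notMem (notMem_compl_iff.2 hx), add_zero]
    · rw [Pi.add_apply, indicator_of_notMem (fun h => hx (subset_closure h)),
        indicator_of_mem (mem_compl hx), zero_add]
  rw [hsplit]
  exact ((aestronglyMeasurable_indicator_iff S.isOpen.measurableSet).2 hf).add
    ((aestronglyMeasurable_indicator_iff hmeas).2
      (S.contDiffOn_whitneyExt.continuousOn.aestronglyMeasurable hmeas))

lemma exists_lintegral_whitneyExt_le (S : ExtensionSetup D W W' ψ refl ω n R c r₀ Cω r)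
    (C₀ : ℝ≥0) :
    ∃ C : ℝ, 0 ≤ C ∧ ∀ f P M, ExtensionData D W' refl ω n R C₀ f P M → ∀ L : ℝ, 0 ≤ L →
      ∫⁻ x in D, ‖f x‖ₑ ≤ ENNReal.ofReal L →
      ∫⁻ x, ‖whitneyExt D R W' ψ refl P f x‖ₑ ≤ ENNReal.ofReal (C * (M + L)) := by
  obtain ⟨C, hC, hext⟩ := S.exists_abs_whitneyExt_le C₀
  obtain ⟨ρ, hsupp⟩ := S.exists_whitneyExt_eq_zero_of_notMem_closedBall
  have hball : MeasurableSet (Metric.closedBall (0 : Euc d) ρ) :=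
    Metric.isClosed_closedBall.measurableSet
  set V : ℝ := (volume (Metric.closedBall (0 : Euc d) ρ)).toReal
  have hV : volume (Metric.closedBall (0 : Euc d) ρ) = ENNReal.ofReal V :=
    (ENNReal.ofReal_toReal (measure_closedBall_lt_top.ne)).symm
  have : 0 ≤ V := ENNReal.toReal_nonneg
  refine ⟨1 + C * V, by positivity, fun f P M hf L hL hfL => ?_⟩
  have hM := hf.nonneg
  have hpointwise : ∀ x, ‖whitneyExt D R W' ψ refl P f x‖ₑ ≤ D.indicator (fun x => ‖f x‖ₑ) x +
      (Metric.closedBall 0 ρ).indicator (fun _ => ENNReal.ofReal (C * (M + L))) x := fun x => by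
    by_cases hx : x ∈ closure D
    · rw [S.whitneyExt_of_mem_closure hx, enorm_indicator_eq_indicator_enorm]
      exact le_self_add
    · by_cases hxρ : x ∈ Metric.closedBall (0 : Euc d) ρ
      · rw [indicator_of_mem hxρ, Real.enorm_eq_ofReal_abs]
        exact (ENNReal.ofReal_le_ofReal (hext f P M hf L hL hfL x hx)).trans le_add_self
      · simp [hsupp f P x hxρ]
  calc ∫⁻ x, ‖whitneyExt D R W' ψ refl P f x‖ₑ
      ≤ (∫⁻ x in D, ‖f x‖ₑ) + ENNReal.ofReal (C * (M + L)) * ENNReal.ofReal V := by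
        refine (lintegral_mono hpointwise).trans_eq ?_
        rw [lintegral_add_right _ (measurable_const.indicator hball),
          lintegral_indicator S.isOpen.measurableSet, lintegral_indicator hball,
          setLIntegral_const, hV]
    _ ≤ ENNReal.ofReal (L + C * (M + L) * V) := by
        rw [← ENNReal.ofReal_mul (by positivity), ENNReal.ofReal_add hL (by positivity)]
        gcongr
    _ ≤ ENNReal.ofReal ((1 + C * V) * (M + L)) :=
        ENNReal.ofReal_le_ofReal (by linarith)

lemma setLIntegral_whitneyExt_sub_le (S : ExtensionSetup D W W' ψ refl ω n R c r₀ Cω r)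
    {η C B h : ℝ} {a : Euc d} {p : MvPolynomial (Fin d) ℝ} {Q : AxisCube d} (ha : a ∈ frontier D)
    (hp : IsBoundaryApprox D W' refl n R f P η C B a h p) (hC : 0 ≤ C) (hB : 0 ≤ B) (hh : 0 ≤ h)
    (hR : η * h ≤ R / 4) (hQ : ∀ x ∈ Q.carrier, 2 * dist x a ≤ η * h) :
    ∫⁻ x in Q.carrier, ‖whitneyExt D R W' ψ refl P f x - polyVal p x‖ₑ ≤
      ENNReal.ofReal (C * B * (h ^ d + Q.side ^ d)) := by
  have hcover : Q.carrier ⊆ (D ∩ Metric.closedBall a (η * h)) ∪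
      ((Q.carrier ∩ (closure D)ᶜ) ∪ frontier D) := by
    intro x hx
    by_cases hxD : x ∈ D
    · refine Or.inl ⟨hxD, Metric.mem_closedBall.2 ?_⟩
      linarith [hQ x hx, dist_nonneg (x := x) (y := a)]
    · by_cases hxc : x ∈ closure D
      · exact Or.inr (Or.inr (S.isOpen.frontier_eq ▸ ⟨hxc, hxD⟩))
      · exact Or.inr (Or.inl ⟨hx, hxc⟩)
  have hint : ∫⁻ x in D ∩ Metric.closedBall a (η * h),
      ‖whitneyExt D R W' ψ refl P f x - polyVal p x‖ₑ ≤ ENNReal.ofReal (C * B * h ^ d) := by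
    refine (setLIntegral_congr_fun (S.isOpen.measurableSet.inter
      Metric.isClosed_closedBall.measurableSet) fun x hx => ?_).trans_le hp.lintegral_le
    rw [S.whitneyExt_of_mem hx.1]
  have hext : ∫⁻ x in Q.carrier ∩ (closure D)ᶜ,
      ‖whitneyExt D R W' ψ refl P f x - polyVal p x‖ₑ ≤ ENNReal.ofReal (Q.side ^ d * (C * B)) := by
    refine setLIntegral_enorm_le_of_abs_le (Q.measurableSet_carrier.inter
      isClosed_closure.measurableSet.compl) inter_subset_left fun x ⟨hxQ, hxD⟩ => ?_
    refine S.abs_whitneyExt_sub_polyVal_le hxD ha hp hC hB hR ?_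
    linarith [hQ x hxQ, Metric.infDist_le_dist_of_mem (x := x) ha, dist_nonneg (x := x) (y := a)]
  have : 0 ≤ C * B := mul_nonneg hC hB
  have hside := Q.side_pos
  refine (lintegral_mono_set hcover).trans ((lintegral_union_le _ _ _).trans ?_)
  rw [mul_add, ENNReal.ofReal_add (by positivity) (by positivity), mul_comm (C * B) (Q.side ^ d)]
  refine add_le_add hint ((lintegral_union_le _ _ _).trans ?_)
  rwa [setLIntegral_measure_zero _ _ S.volume_frontier, add_zero]

lemma exists_cubeOsc_whitneyExt_le_of_infDist_le
    (S : ExtensionSetup D W W' ψ refl ω n R c r₀ Cω r) (C₀ : ℝ≥0) :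
    ∃ ℓ C : ℝ, 0 < ℓ ∧ 0 ≤ C ∧ ∀ f P M, ExtensionData D W' refl ω n R C₀ f P M →
      ∀ Q : AxisCube d, Q.side ≤ ℓ → Metric.infDist Q.center (frontier D) ≤ 2 * d * Q.side →
      cubeOsc ω n (whitneyExt D R W' ψ refl P f) Q ≤ ENNReal.ofReal (C * M) := by
  have hd := S.one_le_dim
  have hε : 0 < min r₀ R := lt_min S.cones.height_pos S.R_pos
  have hCω := S.modulus.nonneg
  obtain ⟨η, C, hη, hη4, hC, happrox⟩ := S.exists_isBoundaryApprox C₀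
  have hτ : 0 < 6 * d / η := by positivity
  have hτ1 : 1 ≤ 6 * d / η := (one_le_div hη).2 (by linarith)
  have hητ : η * (6 * d / η) = 6 * d := mul_div_cancel₀ _ hη.ne'
  set τ : ℝ := 6 * d / η
  refine ⟨min r₀ R / τ, C * (Cω * τ ^ (n + 1)) * (τ ^ d + 1), by positivity, by positivity,
    fun f P M hf Q hQℓ hQa => ?_⟩
  have hM := hf.nonneg
  have hside := Q.side_pos
  have hh : τ * Q.side ≤ min r₀ R := (le_div_iff₀' hτ).1 hQℓ
  have hωh := S.modulus.pos (τ * Q.side) (by positivity)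
  obtain ⟨a, ha, hQ_dist⟩ := S.exists_infDist_eq Q.center
  obtain ⟨p, hp⟩ := happrox f P M hf a ha (τ * Q.side) (by positivity)
    (hh.trans (min_le_left _ _))
  have hQ : ∀ x ∈ Q.carrier, 2 * dist x a ≤ η * (τ * Q.side) := fun x hx => by
    have hxQ := AxisCube.norm_sub_center_le hx
    rw [← dist_eq_norm] at hxQ
    rw [← mul_assoc, hητ]
    linarith [dist_triangle x Q.center a, mul_nonneg (zero_le_one.trans hd) hside.le]
  have hR : η * (τ * Q.side) ≤ R / 4 := by
    nlinarith [min_le_right r₀ R, mul_pos hτ hside]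
  refine cubeOsc_le_of_meanDev_le hp.totalDegree_le (S.modulus.pos _ hside)
    (meanDev_le_ofReal_iff.2 ((S.setLIntegral_whitneyExt_sub_le ha hp hC (by positivity)
      (by positivity) hR hQ).trans (ENNReal.ofReal_le_ofReal ?_)))
  calc C * (M * ω (τ * Q.side)) * ((τ * Q.side) ^ d + Q.side ^ d)
      ≤ C * (M * (Cω * τ ^ (n + 1) * ω Q.side)) * ((τ * Q.side) ^ d + Q.side ^ d) := by
        gcongr
        exact S.modulus.growth τ Q.side hτ1 hside
    _ = Q.side ^ d * (C * (Cω * τ ^ (n + 1)) * (τ ^ d + 1) * M * ω Q.side) := by ring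

lemma exists_cubeOsc_whitneyExt_le_of_center_mem_exterior
    (S : ExtensionSetup D W W' ψ refl ω n R c r₀ Cω r) (C₀ : ℝ≥0) :
    ∃ ℓ C : ℝ, 0 < ℓ ∧ 0 ≤ C ∧ ∀ f P M, ExtensionData D W' refl ω n R C₀ f P M →
      ∀ L : ℝ, 0 ≤ L → ∫⁻ x in D, ‖f x‖ₑ ≤ ENNReal.ofReal L → ∀ Q : AxisCube d, Q.side ≤ ℓ →
      Q.center ∈ (closure D)ᶜ → d * Q.side ≤ Metric.infDist Q.center (frontier D) →
      cubeOsc ω n (whitneyExt D R W' ψ refl P f) Q ≤ ENNReal.ofReal (C * (M + L)) := by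
  have hd := S.one_le_dim
  obtain ⟨s, C₁, hs, hC₁, hnear⟩ := S.exists_polyVal_approx_whitneyExt_of_infDist_le C₀
  obtain ⟨C₂, hC₂, hfar⟩ := S.exists_polyVal_approx_whitneyExt_of_side_le C₀ hs
  refine ⟨s / d, C₁ + C₂, by positivity, by positivity, fun f P M hf L hL hfL Q hQs hQ hQd => ?_⟩
  have hM := hf.nonneg
  have hω := S.modulus.pos _ Q.side_pos
  rcases le_total (Metric.infDist Q.center (frontier D)) s with hle | hle
  · obtain ⟨p, hp, hpQ⟩ := hnear f P M hf Q hQ hQd hle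
    refine (cubeOsc_le_of_meanDev_le hp hω (meanDev_le_of_abs_sub_le hpQ)).trans
      (ENNReal.ofReal_le_ofReal ?_)
    gcongr <;> linarith
  · obtain ⟨p, hp, hpQ⟩ := hfar f P M hf L hL hfL Q hQ ((le_div_iff₀' (by positivity)).1 hQs) hle
    refine (cubeOsc_le_of_meanDev_le hp hω (meanDev_le_of_abs_sub_le hpQ)).trans
      (ENNReal.ofReal_le_ofReal ?_)
    gcongr
    linarith

lemma cubeOsc_whitneyExt_le_of_center_mem (S : ExtensionSetup D W W' ψ refl ω n R c r₀ Cω r)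
    {Q : AxisCube d} (hQ : Q.center ∈ D)
    (hdist : 2 * d * Q.side ≤ Metric.infDist Q.center (frontier D)) :
    cubeOsc ω n (whitneyExt D R W' ψ refl P f) Q ≤ zygIntSeminorm ω n D f := by
  have hQD : (Q.scale 2 two_pos).carrier ⊆ D := fun x hx => by
    refine ball_subset_of_disjoint_frontier S.isOpen hQ Metric.disjoint_ball_infDist ?_
    have hxQ := AxisCube.norm_sub_center_le hx
    simp only [AxisCube.scale] at hxQ
    rw [mem_ball_iff_norm]
    linarith [mul_pos (zero_lt_one.trans_le S.one_le_dim) Q.side_pos]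
  rw [cubeOsc_congr fun x hx =>
    S.whitneyExt_of_mem (hQD (Q.carrier_subset_scale two_pos one_le_two hx))]
  exact le_iSup₂ (f := fun (Q : AxisCube d) (_ : (Q.scale 2 two_pos).carrier ⊆ D) =>
    cubeOsc ω n f Q) Q hQD

lemma exists_cubeOsc_whitneyExt_le_of_le_side
    (S : ExtensionSetup D W W' ψ refl ω n R c r₀ Cω r) (C₀ : ℝ≥0) {ℓ : ℝ} (hℓ : 0 < ℓ) :
    ∃ C : ℝ, 0 ≤ C ∧ ∀ f P M, ExtensionData D W' refl ω n R C₀ f P M → ∀ L : ℝ, 0 ≤ L →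
      ∫⁻ x in D, ‖f x‖ₑ ≤ ENNReal.ofReal L → ∀ Q : AxisCube d, ℓ ≤ Q.side →
      cubeOsc ω n (whitneyExt D R W' ψ refl P f) Q ≤ ENNReal.ofReal (C * (M + L)) := by
  obtain ⟨C, hC, hL1⟩ := S.exists_lintegral_whitneyExt_le C₀
  have hω := S.modulus.pos ℓ hℓ
  refine ⟨C / (ℓ ^ d * ω ℓ), by positivity, fun f P M hf L hL hfL Q hQ => ?_⟩
  have hM := hf.nonneg
  have hωQ : ω ℓ ≤ ω Q.side := S.modulus.mono _ _ hℓ.le hQ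
  refine cubeOsc_le_of_meanDev_le (p := 0) (by simp) (hω.trans_le hωQ)
    (meanDev_le_ofReal_iff.2 ?_)
  simp only [polyVal_zero, sub_zero]
  refine (setLIntegral_le_lintegral _ _).trans ((hL1 f P M hf L hL hfL).trans
    (ENNReal.ofReal_le_ofReal ?_))
  have hside := Q.side_pos
  calc C * (M + L) = C / (ℓ ^ d * ω ℓ) * (M + L) * (ℓ ^ d * ω ℓ) := by field_simp
    _ ≤ C / (ℓ ^ d * ω ℓ) * (M + L) * (Q.side ^ d * ω Q.side) := by gcongr
    _ = Q.side ^ d * (C / (ℓ ^ d * ω ℓ) * (M + L) * ω Q.side) := by ring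

lemma exists_zygSeminorm_whitneyExt_le (S : ExtensionSetup D W W' ψ refl ω n R c r₀ Cω r)
    (C₀ : ℝ≥0) :
    ∃ C : ℝ, 0 ≤ C ∧ ∀ f P M, ExtensionData D W' refl ω n R C₀ f P M → ∀ L : ℝ, 0 ≤ L →
      ∫⁻ x in D, ‖f x‖ₑ ≤ ENNReal.ofReal L →
      zygSeminorm ω n univ (whitneyExt D R W' ψ refl P f) ≤ ENNReal.ofReal (C * (M + L)) := by
  have hd := S.one_le_dim
  obtain ⟨ℓ₁, C₁, hℓ₁, hC₁, hbdry⟩ := S.exists_cubeOsc_whitneyExt_le_of_infDist_le C₀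
  obtain ⟨ℓ₂, C₂, hℓ₂, hC₂, hext⟩ := S.exists_cubeOsc_whitneyExt_le_of_center_mem_exterior C₀
  obtain ⟨C₃, hC₃, hlarge⟩ := S.exists_cubeOsc_whitneyExt_le_of_le_side C₀ (lt_min hℓ₁ hℓ₂)
  refine ⟨1 + C₁ + C₂ + C₃, by positivity, fun f P M hf L hL hfL => iSup₂_le fun Q _ => ?_⟩
  have hM := hf.nonneg
  suffices h : cubeOsc ω n (whitneyExt D R W' ψ refl P f) Q ≤
      ENNReal.ofReal (max (max M (C₁ * M)) (max (C₂ * (M + L)) (C₃ * (M + L)))) by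
    refine h.trans (ENNReal.ofReal_le_ofReal ?_)
    have h₁ : 0 ≤ C₁ * (M + L) := by positivity
    have h₂ : 0 ≤ C₂ * (M + L) := by positivity
    have h₃ : 0 ≤ C₃ * (M + L) := by positivity
    refine max_le (max_le ?_ ?_) (max_le ?_ ?_) <;> nlinarith
  rcases le_total (min ℓ₁ ℓ₂) Q.side with hside | hside
  · exact (hlarge f P M hf L hL hfL Q hside).trans (ENNReal.ofReal_le_ofReal (by simp))
  rcases le_or_gt (Metric.infDist Q.center (frontier D)) (2 * d * Q.side) with hdist | hdist
  · exact (hbdry f P M hf Q (hside.trans (min_le_left _ _)) hdist).trans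
      (ENNReal.ofReal_le_ofReal (by simp))
  have hdQ : 0 < d * Q.side := mul_pos (by positivity) Q.side_pos
  by_cases hQ : Q.center ∈ closure D
  · have hQD : Q.center ∈ D := by
      by_contra hQD
      rw [Metric.infDist_zero_of_mem (S.isOpen.frontier_eq ▸ ⟨hQ, hQD⟩)] at hdist
      linarith
    exact (S.cubeOsc_whitneyExt_le_of_center_mem hQD hdist.le).trans
      (hf.seminorm_lt.le.trans (ENNReal.ofReal_le_ofReal (by simp)))
  · exact (hext f P M hf L hL hfL Q (hside.trans (min_le_right _ _)) hQ (by linarith)).trans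
      (ENNReal.ofReal_le_ofReal (by simp))

lemma extensionData (S : ExtensionSetup D W W' ψ refl ω n R c r₀ Cω r) (hf : MemZygInt ω n D f)
    (hP : ∀ Q ∈ W', Q.side ≤ R → IsNearBest ω n D C₀ f (refl Q) (P (refl Q)))
    (hM : zygIntSeminorm ω n D f < ENNReal.ofReal M) :
    ExtensionData D W' refl ω n R C₀ f P M where
  nonneg := (ENNReal.ofReal_pos.1 (bot_le.trans_lt hM)).le
  meas := hf.1.aestronglyMeasurable
  seminorm_lt := hM
  degree Q hQ hQR := (hP Q hQ hQR).1
  near Q hQ hQR := (hP Q hQ hQR).meanDev_le_ofReal hM.le (S.modulus.pos _ (refl Q).side_pos).le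

lemma integrableOn_of_memZygInt (S : ExtensionSetup D W W' ψ refl ω n R c r₀ Cω r)
    (hf : MemZygInt ω n D f)
    (hP : ∀ Q ∈ W', Q.side ≤ R → IsNearBest ω n D C₀ f (refl Q) (P (refl Q))) :
    IntegrableOn f D := by
  obtain ⟨M, -, hM⟩ := ENNReal.lt_iff_exists_real_btwn.1 hf.2
  exact S.integrableOn (S.extensionData hf hP hM.1) hf.1

lemma exists_zygSeminorm_add_lintegral_whitneyExt_le
    (S : ExtensionSetup D W W' ψ refl ω n R c r₀ Cω r) (C₀ : ℝ≥0) :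
    ∃ C : ℝ≥0, ∀ (f : Euc d → ℝ) (P : AxisCube d → MvPolynomial (Fin d) ℝ),
      MemZygInt ω n D f →
      (∀ Q ∈ W', Q.side ≤ R → IsNearBest ω n D C₀ f (refl Q) (P (refl Q))) →
      zygSeminorm ω n univ (whitneyExt D R W' ψ refl P f)
          + ∫⁻ x, ‖whitneyExt D R W' ψ refl P f x‖ₑ
        ≤ C * (zygIntSeminorm ω n D f + ∫⁻ x in D, ‖f x‖ₑ) := by
  obtain ⟨C₁, hC₁, hsemi⟩ := S.exists_zygSeminorm_whitneyExt_le C₀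
  obtain ⟨C₂, hC₂, hint⟩ := S.exists_lintegral_whitneyExt_le C₀
  refine ⟨(C₁ + C₂).toNNReal, fun f P hf hP => ?_⟩
  have hN : zygIntSeminorm ω n D f = ENNReal.ofReal (zygIntSeminorm ω n D f).toReal :=
    (ENNReal.ofReal_toReal hf.2.ne).symm
  have hL : ∫⁻ x in D, ‖f x‖ₑ = ENNReal.ofReal (∫⁻ x in D, ‖f x‖ₑ).toReal :=
    (ENNReal.ofReal_toReal (S.integrableOn_of_memZygInt hf hP).2.ne).symm
  have hN₀ : 0 ≤ (zygIntSeminorm ω n D f).toReal := ENNReal.toReal_nonneg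
  have hL₀ : 0 ≤ (∫⁻ x in D, ‖f x‖ₑ).toReal := ENNReal.toReal_nonneg
  set N := (zygIntSeminorm ω n D f).toReal
  set L := (∫⁻ x in D, ‖f x‖ₑ).toReal
  rw [hN, hL, ← ENNReal.ofReal_add hN₀ hL₀, ← ENNReal.ofReal, ← ENNReal.ofReal_mul (by positivity)]
  have hcont : Continuous fun M => ENNReal.ofReal ((C₁ + C₂) * (M + L)) :=
    ENNReal.continuous_ofReal.comp (by fun_prop)
  refine ge_of_tendsto ((hcont.tendsto N).mono_left (nhdsWithin_le_nhds (s := Ioi N)))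
    (Filter.eventually_of_mem self_mem_nhdsWithin fun M hM => ?_)
  have hdata : ExtensionData D W' refl ω n R C₀ f P M := S.extensionData hf hP
    (hN ▸ (ENNReal.ofReal_lt_ofReal_iff (hN₀.trans_lt hM)).2 hM)
  have hM₀ := hdata.nonneg
  rw [add_mul, ENNReal.ofReal_add (by positivity) (by positivity)]
  exact add_le_add (hsemi f P M hdata L hL₀ hL.le) (hint f P M hdata L hL₀ hL.le)

end ExtensionSetup

lemma IsLipschitzDomain.exists_extensionSetup {δ : ℝ≥0} (hd : 0 < d) (hD : IsLipschitzDomain δ R D)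
    (hω : IsModulusOfOrder ω n) (hW : IsWhitneyCovering D W)
    (hW' : IsWhitneyCovering (closure D)ᶜ W') (hψ : IsWhitneyPartition (closure D)ᶜ W' ψ)
    (hrefl : ∀ Q ∈ W', Q.side ≤ R → IsReflective D W Q (refl Q)) :
    ∃ c r₀ Cω r, ExtensionSetup D W W' ψ refl ω n R c r₀ Cω r := by
  obtain ⟨c, r₀, hcones⟩ := hD.exists_cones
  obtain ⟨Cω, r, hmod⟩ := hω.exists_bounds
  obtain ⟨hopen, hconn, hbdd, hR, -⟩ := hD
  exact ⟨c, r₀, Cω, r, hd, hopen, hconn.nonempty, hbdd, hcones, hR, hmod, hW, hW', hψ, hrefl⟩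

theorem proposition3_general (S : ExtensionSetup D W W' ψ refl ω n R c r₀ Cω r) (C₀ : ℝ≥0) :
    ∃ C : ℝ≥0, ∀ (f : Euc d → ℝ) (P : AxisCube d → MvPolynomial (Fin d) ℝ),
      MemZygInt ω n D f →
      (∀ Q ∈ W', Q.side ≤ R → IsNearBest ω n D C₀ f (refl Q) (P (refl Q))) →
      HasCompactSupport (whitneyExt D R W' ψ refl P f) ∧
      ContDiffOn ℝ ((⊤ : ℕ∞) : WithTop ℕ∞) (whitneyExt D R W' ψ refl P f) (closure D)ᶜ ∧
      Integrable (whitneyExt D R W' ψ refl P f) ∧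
      MemZyg ω n univ (whitneyExt D R W' ψ refl P f) ∧
      zygSeminorm ω n univ (whitneyExt D R W' ψ refl P f)
          + ∫⁻ x, ‖whitneyExt D R W' ψ refl P f x‖ₑ
        ≤ C * (zygIntSeminorm ω n D f + ∫⁻ x in D, ‖f x‖ₑ) := by
  obtain ⟨C, hC⟩ := S.exists_zygSeminorm_add_lintegral_whitneyExt_le C₀
  obtain ⟨ρ, hρ⟩ := S.exists_whitneyExt_eq_zero_of_notMem_closedBall
  refine ⟨C, fun f P hf hP => ?_⟩
  have hbound := hC f P hf hP
  have hfinite := hbound.trans_lt (ENNReal.mul_lt_top ENNReal.coe_lt_top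
    (ENNReal.add_lt_top.2 ⟨hf.2, (S.integrableOn_of_memZygInt hf hP).2⟩))
  have hint : Integrable (whitneyExt D R W' ψ refl P f) :=
    ⟨S.aestronglyMeasurable_whitneyExt hf.1.aestronglyMeasurable, le_add_self.trans_lt hfinite⟩
  exact ⟨HasCompactSupport.intro (isCompact_closedBall 0 ρ) (hρ f P), S.contDiffOn_whitneyExt,
    hint, ⟨hint.locallyIntegrable.locallyIntegrableOn _, le_self_add.trans_lt hfinite⟩, hbound⟩

end Extension

theorem proposition3 {d : ℕ} (hd : 0 < d) (δ : ℝ≥0) (R : ℝ) (D : Set (Euc d))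
    (hD : IsLipschitzDomain δ R D)
    (n : ℕ) (ω : ℝ → ℝ) (hω : IsModulusOfOrder ω n)
    (W W' : Set (AxisCube d))
    (hW : IsWhitneyCovering D W) (hW' : IsWhitneyCovering (closure D)ᶜ W')
    (ψ : AxisCube d → Euc d → ℝ) (hψ : IsWhitneyPartition (closure D)ᶜ W' ψ)
    (refl : AxisCube d → AxisCube d)
    (hrefl : ∀ Q ∈ W', Q.side ≤ R → IsReflective D W Q (refl Q))
    (C₀ : ℝ≥0) :
    ∃ C : ℝ≥0, ∀ (f : Euc d → ℝ) (P : AxisCube d → MvPolynomial (Fin d) ℝ),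
      MemZygInt ω n D f →
      (∀ Q ∈ W', Q.side ≤ R → IsNearBest ω n D C₀ f (refl Q) (P (refl Q))) →
      HasCompactSupport (whitneyExt D R W' ψ refl P f) ∧
      ContDiffOn ℝ ((⊤ : ℕ∞) : WithTop ℕ∞) (whitneyExt D R W' ψ refl P f) (closure D)ᶜ ∧
      Integrable (whitneyExt D R W' ψ refl P f) ∧
      MemZyg ω n univ (whitneyExt D R W' ψ refl P f) ∧
      zygSeminorm ω n univ (whitneyExt D R W' ψ refl P f)
          + ∫⁻ x, ‖whitneyExt D R W' ψ refl P f x‖ₑ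
        ≤ C * (zygIntSeminorm ω n D f + ∫⁻ x in D, ‖f x‖ₑ) := by
  obtain ⟨c, r₀, Cω, r, S⟩ := hD.exists_extensionSetup hd hω hW hW' hψ hrefl
  exact proposition3_general S C₀
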